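/- Setting. Let $N=\mathbb Z e_1\oplus\mathbb Z e_2$, let $\delta_1,\delta_2$ be positive integers, $N^\circ=\mathbb Z\delta_1e_1\oplus\mathbb Z\delta_2e_2$, and let $\{\cdot,\cdot\}\colon N\times N\to\mathbb Q$ be a skew-symmetric bilinear form with $\{N^\circ,N\}\subset\mathbb Z$ and $b_{12}=\{\delta_1e_1,e_2\}\neq 0$. Put $\delta_0=\mathrm{lcm}(\delta_1,\delta_2)$, let $N^+$ be the set of nonzero vectors $n=a_1e_1+a_2e_2$ with $a_1,a_2\in\mathbb Z_{\ge0}$, put $\deg n=a_1+a_2$, and let $\delta(n)$ be the smallest positive rational number with $\delta(n)n\in N^\circ$. Let $\widehat{\mathfrak g}$ be the degree completion of the Lie algebra over $\mathbb Q(q^{1/\delta_0})$ with basis $X_n$ $(n\in N^+)$ and bracket $[X_n,X_{n'}]=[\{n,n'\}]_q\,X_{n+n'}$, where $[\alpha]_q=(q^\alpha-q^{-\alpha})/(q-q^{-1})$; let $G=\exp\widehat{\mathfrak g}$ be its exponential group, let $G^{>\ell}$ be the normal subgroup of the elements $\exp(\sum_{\deg n>\ell}c_nX_n)$, and let $G^{\le\ell}=G/G^{>\ell}$.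 For $n\in N^+$, $a\in\frac1{\delta_0}\mathbb Z_{>0}$, $b\in\frac1{\delta_0}\mathbb Z$ let $$\Psi_{a,b}[n]=\exp\Bigl(\sum_{j\ge1}\frac{(-1)^{j+1}}{j[ja]_q}q^{jb}X_{jn}\Bigr),\qquad \Psi_a[n]=\Psi_{a,0}[n].$$ For primitive $n\in N^+$ let $G_n^{\parallel}$ be the group of the elements $\exp(\sum_{j\ge1}c_jX_{jn})$. A wall consists of a primitive normal vector $n\in N^+$, a cone of codimension one in $n^\perp\subset M_{\mathbb R}=\mathrm{Hom}(N,\mathbb R)$ and a wall element in $G_n^{\parallel}$; it is incoming if $\{\cdot,n\}$ lies in the cone. A scattering diagram is a collection of walls of which, for each $\ell$, only finitely many have a nontrivial element in $G^{\le\ell}$; it is consistent if the path-ordered product of its wall elements along every admissible loop is trivial. (A curve is admissible if it is smooth, crosses the walls transversally, has its end points off the walls, and avoids the boundaries of the walls and their intersections of codimension two.) A quantum cluster scattering diagram (QCSD) is a consistent scattering diagram whose incoming walls are exactly $(e_i^\perp,\Psi_{1/\delta_i}[e_i])$, $i=1,2$. Call a QCSD positive up to $G^{\le\ell}$ if there is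 a scattering diagram that is consistent modulo $G^{>\ell}$, has the same path-ordered products modulo $G^{>\ell}$ (along all curves admissible for both diagrams), and all of whose wall elements have the form $$\Psi_{1/\delta(n),b}[n]^c\qquad(n\in N^+,\ b\in\tfrac1{\delta_0}\mathbb Z,\ c\in\mathbb Z_{>0}).\tag{$*$}$$ Proposition. Suppose that $\delta_1\mid\delta_2$ or $\delta_2\mid\delta_1$. Then: (1) Every QCSD for these data is positive up to $G^{\le4}$. (2) If $\{i,j\}=\{1,2\}$ is such that $\{e_j,e_i\}>0$, then there is a finite product of elements of the form $(*)$ that is ordered (that is, $\{n',n\}\le0$ whenever a factor with vector $n'$ stands to the left of a factor with vector $n$) and satisfies $$\Psi_{1/\delta_j}[e_j]\,\Psi_{1/\delta_i}[e_i]\equiv\prod\Psi_{1/\delta(n),b}[n]^c\pmod{G^{>4}}.$$ -/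

import Mathlib

universe u v

namespace QCSD

/-- Fixed data of rank 2 with a chosen seed `(e₁, e₂)`.  The lattice `N` is `ℤe₁ ⊕ ℤe₂`, the
sublattice `N°` is `ℤδ₁e₁ ⊕ ℤδ₂e₂`, and the skew-symmetric form `N × N → ℚ` is determined by the
rational number `ω = {e₂, e₁}`; the two integrality fields say `{N°, N} ⊆ ℤ`. -/
structure FixedData where
  δ₁ : ℕ
  δ₂ : ℕ
  ω : ℚ
  δ₁_pos : 0 < δ₁
  δ₂_pos : 0 < δ₂
  int₁ : ∃ z : ℤ, (δ₁ : ℚ) * ω = z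
  int₂ : ∃ z : ℤ, (δ₂ : ℚ) * ω = z

/-- The field `ℚ(q^{1/δ₀})`: rational functions in the variable `u = q^{1/δ₀}`. -/
abbrev K : Type := RatFunc ℚ

/-- The degree `deg (a₁e₁ + a₂e₂) = a₁ + a₂`.  Vectors of `N⁺ ⊔ {0}` are written as
pairs `(a₁, a₂)` of natural numbers. -/
def deg (n : ℕ × ℕ) : ℕ := n.1 + n.2

/-- The seed vectors `e₁, e₂` (indexed by `0, 1 : Fin 2`). -/
def e (i : Fin 2) : ℕ × ℕ := if i = 0 then (1, 0) else (0, 1)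

/-- Pairs `(a, b)` of vectors of `N⁺ ⊔ {0}` with `a + b = n`. -/
def splits (n : ℕ × ℕ) : Finset ((ℕ × ℕ) × (ℕ × ℕ)) :=
  (Finset.Iic n ×ˢ Finset.Iic n).filter fun p => p.1 + p.2 = n

theorem mem_splits {n : ℕ × ℕ} {p : (ℕ × ℕ) × (ℕ × ℕ)} : p ∈ splits n ↔ p.1 + p.2 = n := by
  unfold splits
  simp only [Finset.mem_filter, Finset.mem_product, Finset.mem_Iic, and_iff_right_iff_imp]
  rintro rfl
  exact ⟨le_self_add, le_add_self⟩

theorem deg_add (a b : ℕ × ℕ) : deg (a + b) = deg a + deg b := by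
  simp only [deg, Prod.fst_add, Prod.snd_add]; omega

theorem deg_eq_zero {n : ℕ × ℕ} : deg n = 0 ↔ n = 0 := by
  simp only [deg, Prod.ext_iff, Prod.fst_zero, Prod.snd_zero]; omega

noncomputable section

namespace FixedData

variable (Γ : FixedData)

/-- `δ i` is `δ₁` for `i = 0` and `δ₂` for `i = 1`. -/
def δ (i : Fin 2) : ℕ := if i = 0 then Γ.δ₁ else Γ.δ₂

/-- `δ₀`, the least common multiple of `δ₁` and `δ₂`. -/
def δ₀ : ℕ := Nat.lcm Γ.δ₁ Γ.δ₂

/-- The skew-symmetric form `{n, n'}`. -/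
def form (n n' : ℕ × ℕ) : ℚ := Γ.ω * ((n.2 : ℚ) * n'.1 - (n.1 : ℚ) * n'.2)

/-- The entries `b_{ij} = {δᵢeᵢ, eⱼ}` of the initial exchange matrix. -/
def exchangeMatrix : Matrix (Fin 2) (Fin 2) ℚ := fun i j => Γ.δ i * Γ.form (e i) (e j)

/-- Membership in `(1/δ₀)ℤ`. -/
def InLattice (α : ℚ) : Prop := ∃ z : ℤ, (Γ.δ₀ : ℚ) * α = z

/-- `q^α = u^{δ₀α}` for `α ∈ (1/δ₀)ℤ`.  The floor is exact on these `α`; no other `α` occur. -/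
def qpow (α : ℚ) : K := RatFunc.X ^ ⌊(Γ.δ₀ : ℚ) * α⌋

/-- The `q`-number `[α]_q = (q^α - q^{-α}) / (q - q⁻¹)`. -/
def qnum (α : ℚ) : K := (Γ.qpow α - Γ.qpow (-α)) / (Γ.qpow 1 - Γ.qpow (-1))

/-! ### Elementary facts on exponents -/

theorem δ₀_pos : 0 < Γ.δ₀ := Nat.lcm_pos Γ.δ₁_pos Γ.δ₂_pos

theorem qpow_of_eq {α : ℚ} {z : ℤ} (h : (Γ.δ₀ : ℚ) * α = z) : Γ.qpow α = RatFunc.X ^ z := by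
  unfold qpow; rw [h, Int.floor_intCast]

theorem X_ne : (RatFunc.X : K) ≠ 0 := RatFunc.X_ne_zero

theorem qpow_add {α β : ℚ} (hα : Γ.InLattice α) (hβ : Γ.InLattice β) :
    Γ.qpow (α + β) = Γ.qpow α * Γ.qpow β := by
  obtain ⟨a, ha⟩ := hα
  obtain ⟨b, hb⟩ := hβ
  rw [Γ.qpow_of_eq ha, Γ.qpow_of_eq hb, ← zpow_add₀ X_ne]
  exact Γ.qpow_of_eq (by push_cast; rw [← ha, ← hb]; ring)

theorem qpow_zero : Γ.qpow 0 = 1 := by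
  rw [Γ.qpow_of_eq (z := 0) (by simp), zpow_zero]

theorem inLattice_form (n n' : ℕ × ℕ) : Γ.InLattice (Γ.form n n') := by
  obtain ⟨z, hz⟩ := Γ.int₁
  obtain ⟨k, hk⟩ : Γ.δ₁ ∣ Γ.δ₀ := Nat.dvd_lcm_left _ _
  refine ⟨k * z * ((n.2 : ℤ) * n'.1 - (n.1 : ℤ) * n'.2), ?_⟩
  unfold form
  rw [hk]
  push_cast
  rw [← hz]
  ring

theorem form_add_left (a b c : ℕ × ℕ) : Γ.form (a + b) c = Γ.form a c + Γ.form b c := by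
  simp only [form, Prod.fst_add, Prod.snd_add]; push_cast; ring

theorem form_add_right (a b c : ℕ × ℕ) : Γ.form a (b + c) = Γ.form a b + Γ.form a c := by
  simp only [form, Prod.fst_add, Prod.snd_add]; push_cast; ring

theorem form_swap (a b : ℕ × ℕ) : Γ.form b a = -Γ.form a b := by
  simp only [form]; ring

theorem form_zero_left (a : ℕ × ℕ) : Γ.form 0 a = 0 := by simp [form]

theorem form_zero_right (a : ℕ × ℕ) : Γ.form a 0 = 0 := by simp [form]

theorem qpow_one_sub_ne : Γ.qpow 1 - Γ.qpow (-1) ≠ 0 := by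
  have hd := Γ.δ₀_pos
  rw [Γ.qpow_of_eq (z := (Γ.δ₀ : ℤ)) (by simp), Γ.qpow_of_eq (z := -(Γ.δ₀ : ℤ)) (by simp),
    zpow_neg, sub_ne_zero]
  intro h
  have hx : (RatFunc.X : K) ^ (Γ.δ₀ : ℤ) ≠ 0 := zpow_ne_zero _ X_ne
  have h1 : (RatFunc.X : K) ^ (2 * Γ.δ₀) = 1 := by
    rw [two_mul, pow_add]
    have h' := congrArg (· * (RatFunc.X : K) ^ (Γ.δ₀ : ℤ)) h
    simp only [inv_mul_cancel₀ hx] at h'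
    exact_mod_cast h'
  rw [← RatFunc.algebraMap_X, ← map_pow, ← map_one (algebraMap (Polynomial ℚ) (RatFunc ℚ))] at h1
  have h2 := RatFunc.algebraMap_injective ℚ h1
  have h3 := congrArg Polynomial.natDegree h2
  simp at h3
  omega

/-! ### The normalization factor -/

/-- The normalization factor `δ(n)`, the smallest positive rational number with `δ(n)n ∈ N°`
(see `isLeast_normFactor`). -/
def normFactor (n : ℕ × ℕ) : ℚ :=
  (Nat.lcm (Γ.δ₁ / Nat.gcd Γ.δ₁ (n.1 / Nat.gcd n.1 n.2))
    (Γ.δ₂ / Nat.gcd Γ.δ₂ (n.2 / Nat.gcd n.1 n.2)) : ℕ) / (Nat.gcd n.1 n.2 : ℕ)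

/-- The positive rational numbers `t` with `tn ∈ N°`. -/
def multipliers (n : ℕ × ℕ) : Set ℚ :=
  {t | 0 < t ∧ (∃ a : ℤ, t * n.1 = Γ.δ₁ * a) ∧ ∃ b : ℤ, t * n.2 = Γ.δ₂ * b}

theorem isLeast_normFactor {n : ℕ × ℕ} (hn : n ≠ 0) :
    IsLeast (Γ.multipliers n) (Γ.normFactor n) := by
  obtain ⟨n₁, n₂⟩ := n
  have hg : 0 < Nat.gcd n₁ n₂ := by
    rcases Nat.eq_zero_or_pos (Nat.gcd n₁ n₂) with h | h
    · rw [Nat.gcd_eq_zero_iff] at h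
      exact absurd (Prod.ext h.1 h.2) hn
    · exact h
  obtain ⟨g, p₁, p₂, hg0, hc, rfl, rfl⟩ := Nat.exists_coprime' hg
  have hgcd : Nat.gcd (p₁ * g) (p₂ * g) = g := by
    rw [Nat.gcd_mul_right, hc, one_mul]
  have hgQ : (0 : ℚ) < g := by exact_mod_cast hg0
  have hgne : (g : ℚ) ≠ 0 := hgQ.ne'
  unfold normFactor multipliers
  simp only [hgcd, Nat.mul_div_cancel _ hg0]
  set d₁ := Nat.gcd Γ.δ₁ p₁ with hd₁
  set d₂ := Nat.gcd Γ.δ₂ p₂ with hd₂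
  have hd₁0 : 0 < d₁ := Nat.gcd_pos_of_pos_left _ Γ.δ₁_pos
  have hd₂0 : 0 < d₂ := Nat.gcd_pos_of_pos_left _ Γ.δ₂_pos
  set L := Nat.lcm (Γ.δ₁ / d₁) (Γ.δ₂ / d₂) with hL
  have hLpos : 0 < L := Nat.lcm_pos
    (Nat.div_pos (Nat.le_of_dvd Γ.δ₁_pos (Nat.gcd_dvd_left _ _)) hd₁0)
    (Nat.div_pos (Nat.le_of_dvd Γ.δ₂_pos (Nat.gcd_dvd_left _ _)) hd₂0)
  have key : ∀ s δ p : ℕ, 0 < Nat.gcd δ p → (δ / Nat.gcd δ p ∣ s ↔ δ ∣ s * p) := by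
    intro s δ p hd
    rw [Nat.div_dvd_iff_dvd_mul (Nat.gcd_dvd_left _ _) hd]
    constructor
    · intro h
      exact h.trans (by rw [mul_comm]; exact mul_dvd_mul_left s (Nat.gcd_dvd_right _ _))
    · intro h
      rw [mul_comm, ← Nat.gcd_mul_left]
      exact Nat.dvd_gcd (dvd_mul_left _ _) h
  have m₁ : Γ.δ₁ ∣ L * p₁ := (key L _ _ hd₁0).1 (Nat.dvd_lcm_left _ _)
  have m₂ : Γ.δ₂ ∣ L * p₂ := (key L _ _ hd₂0).1 (Nat.dvd_lcm_right _ _)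
  constructor
  · refine ⟨by positivity, ?_, ?_⟩
    · obtain ⟨a, ha⟩ := m₁
      refine ⟨a, ?_⟩
      have : (L : ℚ) * p₁ = Γ.δ₁ * a := by exact_mod_cast ha
      push_cast
      rw [← this]; field_simp
    · obtain ⟨a, ha⟩ := m₂
      refine ⟨a, ?_⟩
      have : (L : ℚ) * p₂ = Γ.δ₂ * a := by exact_mod_cast ha
      push_cast
      rw [← this]; field_simp
  · rintro t ⟨ht, ⟨a, ha⟩, ⟨b, hb⟩⟩
    push_cast at ha hb
    rw [div_le_iff₀ hgQ]
    -- the number `t * g` is a positive integer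
    have hbez : (Nat.gcdA p₁ p₂ : ℚ) * p₁ + Nat.gcdB p₁ p₂ * p₂ = 1 := by
      have h := Nat.gcd_eq_gcd_ab p₁ p₂
      rw [hc] at h
      have h' : ((1 : ℤ) : ℚ) = ((p₁ * Nat.gcdA p₁ p₂ + p₂ * Nat.gcdB p₁ p₂ : ℤ) : ℚ) := by
        rw [← h]; simp
      push_cast at h'
      linarith
    have hz : t * g = ((Nat.gcdA p₁ p₂ * (Γ.δ₁ * a) + Nat.gcdB p₁ p₂ * (Γ.δ₂ * b) : ℤ) : ℚ) := by
      push_cast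
      rw [← ha, ← hb]
      linear_combination (-(t * g)) * hbez
    have hzpos : 0 < t * g := by positivity
    generalize Nat.gcdA p₁ p₂ * (Γ.δ₁ * a) + Nat.gcdB p₁ p₂ * (Γ.δ₂ * b) = z at hz
    have hz0 : 0 < z := by rw [hz] at hzpos; exact_mod_cast hzpos
    obtain ⟨s, rfl⟩ := Int.eq_ofNat_of_zero_le hz0.le
    have hs : t * g = s := by rw [hz]; simp
    have hs0 : 0 < s := by exact_mod_cast hz0
    have e₁ : Γ.δ₁ ∣ s * p₁ := by
      have : ((s * p₁ : ℕ) : ℤ) = Γ.δ₁ * a := by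
        have : ((s * p₁ : ℕ) : ℚ) = ((Γ.δ₁ * a : ℤ) : ℚ) := by
          push_cast; rw [← hs, ← ha]; ring
        exact_mod_cast this
      exact Int.natCast_dvd_natCast.1 ⟨a, this⟩
    have e₂ : Γ.δ₂ ∣ s * p₂ := by
      have : ((s * p₂ : ℕ) : ℤ) = Γ.δ₂ * b := by
        have : ((s * p₂ : ℕ) : ℚ) = ((Γ.δ₂ * b : ℤ) : ℚ) := by
          push_cast; rw [← hs, ← hb]; ring
        exact_mod_cast this
      exact Int.natCast_dvd_natCast.1 ⟨b, this⟩
    rw [hs]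
    exact_mod_cast Nat.le_of_dvd hs0
      (Nat.lcm_dvd ((key s _ _ hd₁0).2 e₁) ((key s _ _ hd₂0).2 e₂))

/-! ### The completed quantum torus algebra -/

/-- The completed algebra `R_q(y)`: formal infinite sums `∑ cₙ yⁿ` over `n ∈ N⁺ ⊔ {0}` with the
product `yⁿ yⁿ' = q^{{n,n'}} yⁿ⁺ⁿ'`. -/
def Torus (_Γ : FixedData) : Type := ℕ × ℕ → K

namespace Torus

variable {Γ : FixedData}

instance : AddCommGroup Γ.Torus := inferInstanceAs (AddCommGroup (ℕ × ℕ → K))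

instance : Module K Γ.Torus := inferInstanceAs (Module K (ℕ × ℕ → K))

/-- The coefficient of `yⁿ`. -/
def coeff (n : ℕ × ℕ) (f : Γ.Torus) : K := f n

instance : Mul Γ.Torus where
  mul f g := fun n => ∑ p ∈ splits n, Γ.qpow (Γ.form p.1 p.2) * (f.coeff p.1 * g.coeff p.2)

instance : One Γ.Torus where
  one := fun n => if n = 0 then 1 else 0

theorem ext {f g : Γ.Torus} (h : ∀ n, f.coeff n = g.coeff n) : f = g := funext h

theorem coeff_mul (f g : Γ.Torus) (n : ℕ × ℕ) : (f * g).coeff n =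
    ∑ p ∈ splits n, Γ.qpow (Γ.form p.1 p.2) * (f.coeff p.1 * g.coeff p.2) := rfl

theorem coeff_one (n : ℕ × ℕ) : (1 : Γ.Torus).coeff n = if n = 0 then 1 else 0 := rfl

theorem coeff_zero (n : ℕ × ℕ) : (0 : Γ.Torus).coeff n = 0 := rfl

theorem coeff_add (f g : Γ.Torus) (n : ℕ × ℕ) :
    (f + g).coeff n = f.coeff n + g.coeff n := rfl

theorem coeff_sub (f g : Γ.Torus) (n : ℕ × ℕ) :
    (f - g).coeff n = f.coeff n - g.coeff n := rfl

theorem coeff_smul (c : K) (f : Γ.Torus) (n : ℕ × ℕ) :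
    (c • f).coeff n = c * f.coeff n := rfl

theorem coeff_sum {ι : Type*} (s : Finset ι) (f : ι → Γ.Torus) (n : ℕ × ℕ) :
    (∑ i ∈ s, f i).coeff n = ∑ i ∈ s, (f i).coeff n :=
  Finset.sum_apply (M := fun _ => K) n s f

theorem mul_assoc' (f g h : Γ.Torus) : f * g * h = f * (g * h) := by
  refine ext fun n => ?_
  simp only [coeff_mul, Finset.sum_mul, Finset.mul_sum, Finset.sum_sigma']
  refine Finset.sum_nbij' (fun x => ⟨(x.2.1, x.2.2 + x.1.2), (x.2.2, x.1.2)⟩)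
    (fun x => ⟨(x.1.1 + x.2.1, x.2.2), (x.1.1, x.2.1)⟩) ?_ ?_ ?_ ?_ ?_
  · rintro ⟨⟨a, b⟩, ⟨c, d⟩⟩ hx
    simp only [Finset.mem_sigma, mem_splits] at hx ⊢
    exact ⟨by rw [← hx.1, ← hx.2, add_assoc], trivial⟩
  · rintro ⟨⟨a, b⟩, ⟨c, d⟩⟩ hx
    simp only [Finset.mem_sigma, mem_splits] at hx ⊢
    exact ⟨by rw [← hx.1, ← hx.2, add_assoc], trivial⟩
  · rintro ⟨⟨a, b⟩, ⟨c, d⟩⟩ hx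
    simp only [Finset.mem_sigma, mem_splits] at hx
    obtain ⟨rfl, rfl⟩ := hx
    rfl
  · rintro ⟨⟨a, b⟩, ⟨c, d⟩⟩ hx
    simp only [Finset.mem_sigma, mem_splits] at hx
    obtain ⟨rfl, rfl⟩ := hx
    rfl
  · rintro ⟨⟨a, b⟩, ⟨c, d⟩⟩ hx
    simp only [Finset.mem_sigma, mem_splits] at hx
    obtain ⟨rfl, rfl⟩ := hx
    have h1 := Γ.qpow_add (Γ.inLattice_form (c + d) b) (Γ.inLattice_form c d)
    have h2 := Γ.qpow_add (Γ.inLattice_form c (d + b)) (Γ.inLattice_form d b)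
    have h3 : Γ.form (c + d) b + Γ.form c d = Γ.form c (d + b) + Γ.form d b := by
      rw [form_add_left, form_add_right]; ring
    rw [h3, h2] at h1
    linear_combination (-(f.coeff c * g.coeff d * h.coeff b)) * h1

theorem one_mul' (f : Γ.Torus) : 1 * f = f := by
  refine ext fun n => ?_
  rw [coeff_mul, Finset.sum_eq_single (0, n)]
  · simp [coeff_one, form_zero_left, qpow_zero]
  · rintro ⟨a, b⟩ h hne
    rw [mem_splits] at h
    have : a ≠ 0 := by
      rintro rfl
      exact hne (by simpa using h)
    simp [coeff_one, this]
  · intro h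
    exact absurd (mem_splits.2 (zero_add n)) h

theorem mul_one' (f : Γ.Torus) : f * 1 = f := by
  refine ext fun n => ?_
  rw [coeff_mul, Finset.sum_eq_single (n, 0)]
  · simp [coeff_one, form_zero_right, qpow_zero]
  · rintro ⟨a, b⟩ h hne
    rw [mem_splits] at h
    have : b ≠ 0 := by
      rintro rfl
      exact hne (by simpa using h)
    simp [coeff_one, this]
  · intro h
    exact absurd (mem_splits.2 (add_zero n)) h

instance : Ring Γ.Torus :=
  { (inferInstance : AddCommGroup Γ.Torus), (inferInstance : Mul Γ.Torus),
    (inferInstance : One Γ.Torus) with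
    mul_assoc := mul_assoc'
    one_mul := one_mul'
    mul_one := mul_one'
    zero_mul := fun f => ext fun n => by simp [coeff_mul, coeff_zero]
    mul_zero := fun f => ext fun n => by simp [coeff_mul, coeff_zero]
    left_distrib := fun f g h => ext fun n => by
      simp only [coeff_mul, coeff_add, mul_add, Finset.sum_add_distrib]
    right_distrib := fun f g h => ext fun n => by
      simp only [coeff_mul, coeff_add, mul_add, add_mul, Finset.sum_add_distrib] }

theorem splits_zero : splits 0 = {(0, 0)} := by
  ext ⟨a, b⟩
  rw [mem_splits, Finset.mem_singleton]
  simp only [Prod.ext_iff, Prod.fst_add, Prod.snd_add, Prod.fst_zero, Prod.snd_zero]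
  omega

theorem coeff_zero_mul (f g : Γ.Torus) : (f * g).coeff 0 = f.coeff 0 * g.coeff 0 := by
  rw [coeff_mul, splits_zero, Finset.sum_singleton]
  simp [form_zero_left, qpow_zero]

/-- All coefficients of degree `< d` vanish. -/
def Van (d : ℕ) (f : Γ.Torus) : Prop := ∀ n, deg n < d → f.coeff n = 0

theorem Van.mono {a b : ℕ} {f : Γ.Torus} (h : Van b f) (hab : a ≤ b) : Van a f :=
  fun n hn => h n (hn.trans_le hab)

theorem Van.add {d : ℕ} {f g : Γ.Torus} (hf : Van d f) (hg : Van d g) : Van d (f + g) :=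
  fun n hn => by rw [coeff_add, hf n hn, hg n hn, add_zero]

theorem Van.sub {d : ℕ} {f g : Γ.Torus} (hf : Van d f) (hg : Van d g) : Van d (f - g) :=
  fun n hn => by rw [coeff_sub, hf n hn, hg n hn, sub_zero]

theorem Van.smul {d : ℕ} {f : Γ.Torus} (c : K) (hf : Van d f) : Van d (c • f) :=
  fun n hn => by rw [coeff_smul, hf n hn, mul_zero]

theorem van_zero (d : ℕ) : Van d (0 : Γ.Torus) := fun _ _ => rfl

theorem Van.mul {a b : ℕ} {f g : Γ.Torus} (hf : Van a f) (hg : Van b g) :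
    Van (a + b) (f * g) := by
  intro n hn
  rw [coeff_mul]
  refine Finset.sum_eq_zero fun p hp => ?_
  rw [mem_splits] at hp
  rw [← hp, deg_add] at hn
  rcases Nat.lt_or_ge (deg p.1) a with h | h
  · rw [hf _ h]; ring
  · rw [hg p.2 (by omega)]; ring

theorem van_any (f : Γ.Torus) : Van 0 f := fun _ hn => absurd hn (Nat.not_lt_zero _)

theorem van_one_iff {f : Γ.Torus} : Van 1 f ↔ f.coeff 0 = 0 := by
  refine ⟨fun h => h 0 (by simp [deg]), fun h n hn => ?_⟩
  have : n = 0 := deg_eq_zero.1 (by omega)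
  rw [this, h]

theorem Van.pow {f : Γ.Torus} (hf : Van 1 f) (j : ℕ) : Van j (f ^ j) := by
  induction j with
  | zero => exact van_any _
  | succ j ih => rw [pow_succ]; exact ih.mul hf

/-- The exponential series `∑ⱼ Xʲ / j!` of a series `X` without constant term.  The powers with
`j > deg n` do not contribute to the coefficient of `yⁿ`. -/
def exp (X : Γ.Torus) : Γ.Torus :=
  fun n => ∑ j ∈ Finset.range (deg n + 1), ((j.factorial : K))⁻¹ * (X ^ j).coeff n

theorem coeff_exp (X : Γ.Torus) (n : ℕ × ℕ) : (exp X).coeff n =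
    ∑ j ∈ Finset.range (deg n + 1), ((j.factorial : K))⁻¹ * (X ^ j).coeff n := rfl

theorem coeff_zero_exp (X : Γ.Torus) : (exp X).coeff 0 = 1 := by
  simp [coeff_exp, deg, coeff_one]

/-- A series with constant term `1` is a unit. -/
theorem isUnit_of_coeff_zero {f : Γ.Torus} (hf : f.coeff 0 = 1) : IsUnit f := by
  set h : Γ.Torus := 1 - f with hh
  have hv : Van 1 h := van_one_iff.2 (by rw [hh, coeff_sub, hf, coeff_one]; simp)
  have hf' : f = 1 - h := by rw [hh]; abel
  let S : ℕ → Γ.Torus := fun N => ∑ j ∈ Finset.range N, h ^ j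
  let g : Γ.Torus := fun n => (S (deg n + 1)).coeff n
  have hgS : ∀ N, Van N (g - S N) := by
    intro N n hn
    have h1 : g.coeff n = ∑ j ∈ Finset.range (deg n + 1), (h ^ j).coeff n :=
      coeff_sum (Finset.range (deg n + 1)) (fun j => h ^ j) n
    have h2 : (S N).coeff n = ∑ j ∈ Finset.range N, (h ^ j).coeff n := coeff_sum _ _ _
    rw [coeff_sub, h1, h2, sub_eq_zero]
    refine Finset.sum_subset (fun j hj => ?_) (fun j _ hj => ?_)
    · rw [Finset.mem_range] at hj ⊢; omega
    · rw [Finset.mem_range] at hj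
      exact hv.pow j n (by omega)
  have e1 : f * g = 1 := by
    refine ext fun n => ?_
    have : f * g - 1 = f * (g - S (deg n + 1)) - h ^ (deg n + 1) := by
      have := mul_neg_geom_sum h (deg n + 1)
      rw [mul_sub, hf', this]; abel
    have hv' : Van (deg n + 1) (f * g - 1) := by
      rw [this]
      refine Van.sub ?_ (hv.pow _)
      simpa using (van_any f).mul (hgS (deg n + 1))
    exact sub_eq_zero.1 (hv' n (Nat.lt_succ_self _))
  have e2 : g * f = 1 := by
    refine ext fun n => ?_
    have : g * f - 1 = (g - S (deg n + 1)) * f - h ^ (deg n + 1) := by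
      have := geom_sum_mul_neg h (deg n + 1)
      rw [sub_mul, hf', this]; abel
    have hv' : Van (deg n + 1) (g * f - 1) := by
      rw [this]
      refine Van.sub ?_ (hv.pow _)
      simpa using (hgS (deg n + 1)).mul (van_any f)
    exact sub_eq_zero.1 (hv' n (Nat.lt_succ_self _))
  exact ⟨⟨f, g, e1, e2⟩, rfl⟩

theorem coeff_exp_of_lt {X : Γ.Torus} (hX : Van 1 X) {n : ℕ × ℕ} {N : ℕ} (hN : deg n < N) :
    (exp X).coeff n = ∑ j ∈ Finset.range N, ((j.factorial : K))⁻¹ * (X ^ j).coeff n := by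
  rw [coeff_exp]
  refine Finset.sum_subset (fun j hj => ?_) (fun j _ hj => ?_)
  · rw [Finset.mem_range] at hj ⊢; omega
  · rw [Finset.mem_range] at hj
    rw [hX.pow j n (by omega), mul_zero]

theorem van_pow_sub_pow {X Y : Γ.Torus} (hX : Van 1 X) (hY : Van 1 Y) {d : ℕ}
    (h : Van d (X - Y)) (j : ℕ) : Van (d + j) (X ^ (j + 1) - Y ^ (j + 1)) := by
  induction j with
  | zero => simpa using h
  | succ j ih =>
    have e1 : X ^ (j + 1 + 1) - Y ^ (j + 1 + 1) =
        X ^ (j + 1) * (X - Y) + (X ^ (j + 1) - Y ^ (j + 1)) * Y := by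
      rw [pow_succ X (j + 1), pow_succ Y (j + 1)]; noncomm_ring
    rw [e1]
    refine Van.add ?_ (ih.mul hY)
    exact ((hX.pow (j + 1)).mul h).mono (by omega)

/-- If `X` and `Y` agree below degree `d`, then `exp X - exp Y` agrees with `X - Y` up to
degree `d`. -/
theorem van_exp_sub_exp {X Y : Γ.Torus} (hX : Van 1 X) (hY : Van 1 Y) {d : ℕ}
    (h : Van d (X - Y)) : Van (d + 1) (exp X - exp Y - (X - Y)) := by
  intro n hn
  have hN : deg n < deg n + 1 + 1 := by omega
  rw [coeff_sub, coeff_sub, coeff_exp_of_lt hX hN, coeff_exp_of_lt hY hN,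
    ← Finset.sum_sub_distrib, Finset.sum_range_succ', Finset.sum_range_succ']
  have h0 : ∑ k ∈ Finset.range (deg n), ((((k + 1 + 1).factorial : ℕ) : K)⁻¹ *
      (X ^ (k + 1 + 1)).coeff n - (((k + 1 + 1).factorial : ℕ) : K)⁻¹ *
      (Y ^ (k + 1 + 1)).coeff n) = 0 := by
    refine Finset.sum_eq_zero fun k _ => ?_
    rw [← mul_sub, ← coeff_sub, van_pow_sub_pow hX hY h (k + 1) n (by omega), mul_zero]
  rw [h0]
  simp [coeff_sub]

/-- The homogeneous part of degree `d`. -/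
def homog (d : ℕ) (f : Γ.Torus) : Γ.Torus := fun n => if deg n = d then f.coeff n else 0

theorem coeff_homog (d : ℕ) (f : Γ.Torus) (n : ℕ × ℕ) :
    (homog d f).coeff n = if deg n = d then f.coeff n else 0 := rfl

/-- Every series with constant term `1` is the exponential of a series without constant term. -/
theorem exists_exp_eq {f : Γ.Torus} (hf : f.coeff 0 = 1) : ∃ X, Van 1 X ∧ exp X = f := by
  let F : ℕ → Γ.Torus := fun d =>
    Nat.rec (motive := fun _ => Γ.Torus) 0 (fun d Y => Y + homog (d + 1) (f - exp Y)) d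
  have F0 : F 0 = 0 := rfl
  have Fs : ∀ d, F (d + 1) = F d + homog (d + 1) (f - exp (F d)) := fun _ => rfl
  have v1 : ∀ d, Van 1 (F d) := by
    intro d
    induction d with
    | zero => rw [F0]; exact van_zero 1
    | succ d ih =>
      rw [Fs]
      refine ih.add fun n hn => ?_
      rw [coeff_homog, if_neg (by omega)]
  have hstep : ∀ d, Van (d + 1) (F (d + 1) - F d) := by
    intro d n hn
    rw [Fs, coeff_sub, coeff_add, coeff_homog, if_neg (by omega)]
    ring
  have hF : ∀ d, Van (d + 1) (f - exp (F d)) := by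
    intro d
    induction d with
    | zero =>
      rw [zero_add, van_one_iff, coeff_sub, coeff_zero_exp, hf, sub_self]
    | succ d ih =>
      have h1 := van_exp_sub_exp (v1 (d + 1)) (v1 d) (hstep d)
      intro n hn
      rcases Nat.lt_or_ge (deg n) (d + 1) with h | h
      · have h2 := h1 n (by omega)
        have h3 := ih n h
        have h4 := hstep d n h
        rw [coeff_sub, h4] at h2
        rw [coeff_sub] at h2 h3 ⊢
        linear_combination h3 - h2
      · have hd : deg n = d + 1 := by omega
        have h2 := h1 n (by omega)
        have h4 : (F (d + 1) - F d).coeff n = (f - exp (F d)).coeff n := by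
          rw [Fs, coeff_sub, coeff_add, coeff_homog, if_pos hd]; ring
        rw [coeff_sub, h4, coeff_sub, coeff_sub] at h2
        rw [coeff_sub]
        linear_combination -h2
  have hmono : ∀ d k, Van (d + 1) (F (d + k) - F d) := by
    intro d k
    induction k with
    | zero =>
      intro n _
      rw [coeff_sub, add_zero, sub_self]
    | succ k ih =>
      have h1 : F (d + (k + 1)) - F d = (F (d + k + 1) - F (d + k)) + (F (d + k) - F d) := by
        rw [← add_assoc]; abel
      rw [h1]
      exact ((hstep (d + k)).mono (by omega)).add ih
  let X : Γ.Torus := fun n => (F (deg n)).coeff n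
  have hX : ∀ d, Van (d + 1) (X - F d) := by
    intro d n hn
    have h1 := hmono (deg n) (d - deg n) n (Nat.lt_succ_self _)
    rw [Nat.add_sub_cancel' (by omega : deg n ≤ d), coeff_sub] at h1
    have h2 : X.coeff n = (F (deg n)).coeff n := rfl
    rw [coeff_sub, h2]
    linear_combination -h1
  have hX1 : Van 1 X := by
    have := (hX 0).add (v1 0)
    rwa [sub_add_cancel] at this
  refine ⟨X, hX1, ext fun n => ?_⟩
  have h1 := van_exp_sub_exp hX1 (v1 (deg n)) (hX (deg n)) n (by omega)
  have h2 := hX (deg n) n (Nat.lt_succ_self _)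
  have h3 := hF (deg n) n (Nat.lt_succ_self _)
  rw [coeff_sub, h2, coeff_sub] at h1
  rw [coeff_sub] at h3
  linear_combination h1 - h3

theorem van_of_exp {X Y : Γ.Torus} (hX : Van 1 X) (hY : Van 1 Y) {d : ℕ}
    (h : Van d (exp X - exp Y)) : Van d (X - Y) := by
  induction d with
  | zero => exact van_any _
  | succ d ih =>
    have h1 := van_exp_sub_exp hX hY (ih (h.mono (Nat.le_succ d)))
    have h2 := h.sub h1
    rwa [sub_sub_cancel] at h2

theorem exp_zero : exp (0 : Γ.Torus) = 1 := by
  refine ext fun n => ?_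
  rw [coeff_exp, Finset.sum_eq_single 0]
  · simp
  · intro j _ hj
    rw [zero_pow hj, coeff_zero, mul_zero]
  · intro h
    exact absurd (Finset.mem_range.2 (Nat.succ_pos _)) h

end Torus

/-! ### The Lie algebra and the structure group -/

/-- The completed Lie algebra `ĝ`: infinite sums `∑ cₙ Xₙ` over `n ∈ N⁺`. -/
def LieHat (_Γ : FixedData) : Type := {n : ℕ × ℕ // n ≠ 0} → K

namespace LieHat

variable {Γ : FixedData}

open Classical in
/-- The coefficient `cₙ` of `Xₙ` (and `0` for `n = 0`). -/
def coeff (n : ℕ × ℕ) (X : Γ.LieHat) : K := if h : n ≠ 0 then X ⟨n, h⟩ else 0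

theorem coeff_of_ne (X : Γ.LieHat) {n : ℕ × ℕ} (h : n ≠ 0) : X.coeff n = X ⟨n, h⟩ := dif_pos h

theorem coeff_zero (X : Γ.LieHat) : X.coeff 0 = 0 := dif_neg (by simp)

theorem ext {X Y : Γ.LieHat} (h : ∀ n, X.coeff n = Y.coeff n) : X = Y := by
  funext ⟨n, hn⟩
  have := h n
  rwa [coeff_of_ne _ hn, coeff_of_ne _ hn] at this

/-- The Lie bracket `[Xₙ, Xₙ'] = [{n, n'}]_q Xₙ₊ₙ'`, extended to infinite sums. -/
instance : Bracket Γ.LieHat Γ.LieHat where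
  bracket X Y := fun n =>
    ∑ p ∈ splits n.1, Γ.qnum (Γ.form p.1 p.2) * (X.coeff p.1 * Y.coeff p.2)

theorem coeff_bracket (X Y : Γ.LieHat) (n : ℕ × ℕ) : ⁅X, Y⁆.coeff n =
    ∑ p ∈ splits n, Γ.qnum (Γ.form p.1 p.2) * (X.coeff p.1 * Y.coeff p.2) := by
  by_cases h : n = 0
  · subst h
    rw [coeff_zero, Torus.splits_zero, Finset.sum_singleton]
    simp [coeff_zero]
  · exact coeff_of_ne _ h

/-- The embedding of `ĝ` into the completed quantum torus, `Xₙ ↦ yⁿ / (q - q⁻¹)`. -/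
def toTorus (X : Γ.LieHat) : Γ.Torus := fun n => X.coeff n / (Γ.qpow 1 - Γ.qpow (-1))

theorem coeff_toTorus (X : Γ.LieHat) (n : ℕ × ℕ) :
    X.toTorus.coeff n = X.coeff n / (Γ.qpow 1 - Γ.qpow (-1)) := rfl

theorem toTorus_injective : Function.Injective (toTorus (Γ := Γ)) := by
  intro X Y h
  refine ext fun n => ?_
  have h1 : X.toTorus.coeff n = Y.toTorus.coeff n := by rw [h]
  rw [coeff_toTorus, coeff_toTorus] at h1
  exact (div_left_inj' Γ.qpow_one_sub_ne).1 h1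

/-- The embedding turns the Lie bracket of `ĝ` into the commutator of the associative algebra. -/
theorem toTorus_bracket (X Y : Γ.LieHat) :
    ⁅X, Y⁆.toTorus = X.toTorus * Y.toTorus - Y.toTorus * X.toTorus := by
  refine Torus.ext fun n => ?_
  rw [coeff_toTorus, coeff_bracket, Torus.coeff_sub, Torus.coeff_mul, Torus.coeff_mul]
  have hswap : ∑ p ∈ splits n, Γ.qpow (Γ.form p.1 p.2) *
      (Y.toTorus.coeff p.1 * X.toTorus.coeff p.2) =
      ∑ p ∈ splits n, Γ.qpow (-Γ.form p.1 p.2) *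
      (X.toTorus.coeff p.1 * Y.toTorus.coeff p.2) := by
    refine Finset.sum_nbij' Prod.swap Prod.swap ?_ ?_ (fun _ _ => rfl) (fun _ _ => rfl) ?_
    · intro p hp
      rw [mem_splits] at hp ⊢
      simpa [add_comm] using hp
    · intro p hp
      rw [mem_splits] at hp ⊢
      simpa [add_comm] using hp
    · rintro ⟨a, b⟩ _
      simp only [Prod.fst_swap, Prod.snd_swap, Γ.form_swap a b, neg_neg]
      ring
  rw [hswap, ← Finset.sum_sub_distrib, Finset.sum_div]
  refine Finset.sum_congr rfl fun p _ => ?_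
  have hne := Γ.qpow_one_sub_ne
  rw [coeff_toTorus, coeff_toTorus, qnum]
  field_simp

theorem van_toTorus (X : Γ.LieHat) : Torus.Van 1 X.toTorus := by
  rw [Torus.van_one_iff, coeff_toTorus, coeff_zero, zero_div]

end LieHat

/-- The structure group `G = exp ĝ`.  The algebra `R_q(y)` contains `ĝ` as a Lie algebra of
topologically nilpotent elements, under the commutator bracket, via `LieHat.toTorus`; so the product
`exp X · exp Y` computed in it is the exponential of the Baker-Campbell-Hausdorff series of `X`
and `Y`.  The image of `exp` is exactly the set of series with constant term `1`, and `exp` is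
injective (see `expG_bijective`). -/
def G : Subgroup (Γ.Torus)ˣ where
  carrier := {g | (g : Γ.Torus).coeff 0 = 1}
  mul_mem' := by
    intro a b ha hb
    simp only [Set.mem_ofPred_eq] at ha hb ⊢
    rw [Units.val_mul, Torus.coeff_zero_mul, ha, hb, mul_one]
  one_mem' := by simp [Torus.coeff_one]
  inv_mem' := by
    intro a ha
    simp only [Set.mem_ofPred_eq] at ha ⊢
    have h := Torus.coeff_zero_mul (a : Γ.Torus) ((a⁻¹ : (Γ.Torus)ˣ) : Γ.Torus)
    rw [Units.mul_inv, Torus.coeff_one, if_pos rfl, ha, one_mul] at h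
    exact h.symm

variable {Γ}

/-- An element of `G` as a formal series. -/
def toSeries (g : Γ.G) : Γ.Torus := ((g : (Γ.Torus)ˣ) : Γ.Torus)

theorem toSeries_injective : Function.Injective (toSeries (Γ := Γ)) := fun _ _ h =>
  Subtype.ext (Units.ext h)

theorem toSeries_mul (g h : Γ.G) : toSeries (g * h) = toSeries g * toSeries h := rfl

theorem toSeries_one : toSeries (1 : Γ.G) = 1 := rfl

theorem coeff_zero_toSeries (g : Γ.G) : (toSeries g).coeff 0 = 1 := g.2

/-- The exponential map `ĝ → G`. -/
def expG (X : Γ.LieHat) : Γ.G :=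
  ⟨(Torus.isUnit_of_coeff_zero (Torus.coeff_zero_exp X.toTorus)).unit,
    Torus.coeff_zero_exp X.toTorus⟩

theorem toSeries_expG (X : Γ.LieHat) : toSeries (expG X) = Torus.exp X.toTorus := rfl

theorem exists_toTorus_eq {f : Γ.Torus} (hf : Torus.Van 1 f) : ∃ X : Γ.LieHat, X.toTorus = f := by
  let X : Γ.LieHat := fun n => f.coeff n.1 * (Γ.qpow 1 - Γ.qpow (-1))
  refine ⟨X, Torus.ext fun n => ?_⟩
  rw [LieHat.coeff_toTorus]
  by_cases h : n = 0
  · rw [h, LieHat.coeff_zero, zero_div, Torus.van_one_iff.1 hf]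
  · rw [LieHat.coeff_of_ne _ h]
    exact mul_div_cancel_right₀ _ Γ.qpow_one_sub_ne

theorem expG_bijective : Function.Bijective (expG (Γ := Γ)) := by
  constructor
  · intro X Y h
    refine LieHat.toTorus_injective (Torus.ext fun n => ?_)
    have h1 : Torus.exp X.toTorus = Torus.exp Y.toTorus := by
      rw [← toSeries_expG, ← toSeries_expG, h]
    have h2 : Torus.Van (deg n + 1) (Torus.exp X.toTorus - Torus.exp Y.toTorus) := by
      rw [h1, sub_self]; exact Torus.van_zero _
    exact sub_eq_zero.1 (Torus.van_of_exp X.van_toTorus Y.van_toTorus h2 n (Nat.lt_succ_self _))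
  · intro g
    obtain ⟨f, hf, he⟩ := Torus.exists_exp_eq (coeff_zero_toSeries g)
    obtain ⟨X, rfl⟩ := exists_toTorus_eq hf
    exact ⟨X, toSeries_injective he⟩

variable (Γ)

/-- The subgroup `G^{>ℓ}` (see `mem_Ggt_iff`). -/
def Ggt (ℓ : ℕ) : Subgroup Γ.G where
  carrier := {g | Torus.Van (ℓ + 1) (toSeries g - 1)}
  mul_mem' := by
    intro a b ha hb
    simp only [Set.mem_ofPred_eq] at ha hb ⊢
    have h : toSeries (a * b) - 1 = (toSeries a - 1) * toSeries b + (toSeries b - 1) := by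
      rw [toSeries_mul]; noncomm_ring
    rw [h]
    exact (ha.mul (Torus.van_any _)).add hb
  one_mem' := by
    simp only [Set.mem_ofPred_eq]
    rw [toSeries_one, sub_self]
    exact Torus.van_zero _
  inv_mem' := by
    intro a ha
    simp only [Set.mem_ofPred_eq] at ha ⊢
    have h : toSeries a⁻¹ - 1 = 0 - toSeries a⁻¹ * (toSeries a - 1) := by
      rw [mul_sub, ← toSeries_mul, inv_mul_cancel, toSeries_one]; noncomm_ring
    rw [h]
    have h2 := (Torus.van_any (toSeries a⁻¹)).mul ha
    rw [zero_add] at h2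
    exact (Torus.van_zero _).sub h2

instance Ggt_normal (ℓ : ℕ) : (Γ.Ggt ℓ).Normal where
  conj_mem := by
    intro a ha g
    change Torus.Van (ℓ + 1) (toSeries (g * a * g⁻¹) - 1)
    have h : toSeries (g * a * g⁻¹) - 1 = toSeries g * (toSeries a - 1) * toSeries g⁻¹ := by
      have h1 : toSeries g * toSeries g⁻¹ = 1 := by
        rw [← toSeries_mul, mul_inv_cancel, toSeries_one]
      rw [mul_sub, sub_mul, mul_one, h1, toSeries_mul, toSeries_mul]
    rw [h]
    have h2 := ((Torus.van_any (toSeries g)).mul ha).mul (Torus.van_any (toSeries g⁻¹))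
    simpa using h2

/-- `G^{>ℓ}` consists of the elements `exp (∑ cₙ Xₙ)` with the sum over `deg n > ℓ`. -/
theorem mem_Ggt_iff {ℓ : ℕ} {g : Γ.G} :
    g ∈ Γ.Ggt ℓ ↔ ∃ X : Γ.LieHat, (∀ n, deg n ≤ ℓ → X.coeff n = 0) ∧ expG X = g := by
  have key : ∀ X : Γ.LieHat, (∀ n, deg n ≤ ℓ → X.coeff n = 0) ↔
      Torus.Van (ℓ + 1) (X.toTorus - 0) := by
    intro X
    refine forall_congr' fun n => ?_
    rw [Torus.coeff_sub, Torus.coeff_zero, sub_zero, LieHat.coeff_toTorus, div_eq_zero_iff,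
      Nat.lt_succ_iff]
    simp [Γ.qpow_one_sub_ne]
  have hz := Torus.van_zero (Γ := Γ) 1
  constructor
  · intro hg
    obtain ⟨X, rfl⟩ := expG_bijective.2 g
    refine ⟨X, (key X).2 (Torus.van_of_exp X.van_toTorus hz ?_), rfl⟩
    rw [Torus.exp_zero]
    exact hg
  · rintro ⟨X, hX, rfl⟩
    have h1 := (key X).1 hX
    have h2 := ((Torus.van_exp_sub_exp X.van_toTorus hz h1).mono (Nat.le_succ _)).add h1
    rw [sub_add_cancel, Torus.exp_zero] at h2
    exact h2

/-- Equality of the images of `g` and `h` in `G^{≤ℓ} = G / G^{>ℓ}`. -/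
def EqUpTo (ℓ : ℕ) (g h : Γ.G) : Prop :=
  (QuotientGroup.mk g : Γ.G ⧸ Γ.Ggt ℓ) = QuotientGroup.mk h

/-- The element `∑_{j ≥ 1} c_j X_{jn}` of `ĝ`. -/
def alongRay (n : ℕ × ℕ) (c : ℕ → K) : Γ.LieHat :=
  fun m => ∑ j ∈ (Finset.Icc 1 (deg m.1)).filter (fun j => j • n = m.1), c j

/-- The abelian subgroup `G_n^∥` of elements `exp (∑_{j ≥ 1} c_j X_{jn})`, as a set. -/
def Gpar (n : ℕ × ℕ) : Set Γ.G := {g | ∃ c : ℕ → K, g = expG (Γ.alongRay n c)}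

/-- The quantum dilogarithm element `Ψ_{a,b}[n]`. -/
def Psi (a b : ℚ) (n : ℕ × ℕ) : Γ.G :=
  expG (Γ.alongRay n fun j => (-1) ^ (j + 1) / ((j : K) * Γ.qnum (j * a)) * Γ.qpow (j * b))

/-! ### Walls and scattering diagrams -/

/-- The pairing `⟨n, z⟩` of `N⁺ ⊔ {0}` with `M_ℝ`.  A point of `M_ℝ` is given by its coordinates in
the basis dual to `(e₁, e₂)`. -/
def pairing (n : ℕ × ℕ) (z : ℝ × ℝ) : ℝ := n.1 * z.1 + n.2 * z.2

/-- The vector `p*(n) = {·, n}` of `M_ℝ`. -/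
def pStar (n : ℕ × ℕ) : ℝ × ℝ := ((Γ.form (e 0) n : ℚ), (Γ.form (e 1) n : ℚ))

/-- The hyperplane `n^⊥` of `M_ℝ`. -/
def perp (n : ℕ × ℕ) : Set (ℝ × ℝ) := {z | pairing n z = 0}

end FixedData

open FixedData

/-- A wall: a primitive normal vector `n ∈ N⁺`, a cone of codimension one in `n^⊥`, and a wall
element in `G_n^∥`. -/
structure Wall (Γ : FixedData) where
  normal : ℕ × ℕ
  primitive : Nat.gcd normal.1 normal.2 = 1
  support : PointedCone ℝ (ℝ × ℝ)
  support_subset : (support : Set (ℝ × ℝ)) ⊆ perp normal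
  codim_one : Module.finrank ℝ (Submodule.span ℝ (support : Set (ℝ × ℝ))) = 1
  elt : Γ.G
  elt_mem : elt ∈ Γ.Gpar normal

/-- A wall is incoming if `p*(n)` belongs to its support. -/
def Wall.Incoming {Γ : FixedData} (w : Wall Γ) : Prop := Γ.pStar w.normal ∈ w.support

/-- A scattering diagram: a collection of walls such that for every `ℓ` only finitely many wall
elements are nontrivial in `G^{≤ℓ}`. -/
structure ScatteringDiagram (Γ : FixedData) where
  Index : Type u
  wall : Index → Wall Γ
  finite_nontrivial : ∀ ℓ : ℕ, {i | (wall i).elt ∉ Γ.Ggt ℓ}.Finite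

namespace ScatteringDiagram

variable {Γ : FixedData} (D : ScatteringDiagram.{u} Γ)

/-- The support of wall `i` as a set. -/
def cone (i : D.Index) : Set (ℝ × ℝ) := (D.wall i).support

/-- The union of the supports of the walls. -/
def supp : Set (ℝ × ℝ) := ⋃ i, D.cone i

/-- The union of the relative boundaries of the supports and of the intersections of two supports
that have codimension two (dimension `2 - 2 = 0`). -/
def sing : Set (ℝ × ℝ) :=
  (⋃ i, intrinsicFrontier ℝ (D.cone i)) ∪
    ⋃ (i) (j) (_ : Module.finrank ℝ (Submodule.span ℝ (D.cone i ∩ D.cone j)) = 0),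
      D.cone i ∩ D.cone j

/-- Admissible curves `γ : [0,1] → M_ℝ` (the values of `γ` outside `[0,1]` play no role). -/
structure Admissible (γ : ℝ → ℝ × ℝ) : Prop where
  left_end : γ 0 ∉ D.supp
  right_end : γ 1 ∉ D.supp
  smooth : ContDiffOn ℝ (⊤ : ℕ∞) γ (Set.Icc 0 1)
  transversal : ∀ t ∈ Set.Icc (0 : ℝ) 1, ∀ i, γ t ∈ D.cone i →
    pairing (D.wall i).normal (deriv γ t) ≠ 0
  avoids_sing : ∀ t ∈ Set.Icc (0 : ℝ) 1, γ t ∉ D.sing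

/-- `L` lists, without repetition and ordered by time, all the crossings `(t, i)` of `γ` with the
walls `i` that are nontrivial in `G^{≤ℓ}`.  For an admissible curve there are finitely many
crossings, and the order among simultaneous ones is immaterial, as the corresponding wall
elements commute. -/
structure IsCrossingList (γ : ℝ → ℝ × ℝ) (ℓ : ℕ) (L : List (ℝ × D.Index)) : Prop where
  nodup : L.Nodup
  mem_iff : ∀ x : ℝ × D.Index, x ∈ L ↔
    x.1 ∈ Set.Icc (0 : ℝ) 1 ∧ γ x.1 ∈ D.cone x.2 ∧ (D.wall x.2).elt ∉ Γ.Ggt ℓ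
  sorted : L.Pairwise fun x y => x.1 ≤ y.1

open Classical in
/-- The factor `g^ε` contributed by a crossing, where `ε = 1` if `⟨n, γ'⟩ < 0` and `ε = -1` if
`⟨n, γ'⟩ > 0`. -/
def crossing (γ : ℝ → ℝ × ℝ) (x : ℝ × D.Index) : Γ.G :=
  if pairing (D.wall x.2).normal (deriv γ x.1) < 0 then (D.wall x.2).elt
  else (D.wall x.2).elt⁻¹

/-- The product over the crossings, the factors of later crossings standing on the left of those
of earlier ones.  Its class in `G^{≤ℓ}` is the path-ordered product of `γ` modulo `G^{>ℓ}`. -/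
def pathProduct (γ : ℝ → ℝ × ℝ) (L : List (ℝ × D.Index)) : Γ.G :=
  ((L.map (D.crossing γ)).reverse).prod

/-- Consistency modulo `G^{>ℓ}`: the path-ordered product of every admissible loop is trivial in
`G^{≤ℓ}`. -/
def ConsistentUpTo (ℓ : ℕ) : Prop :=
  ∀ γ : ℝ → ℝ × ℝ, D.Admissible γ → γ 0 = γ 1 →
    ∀ L, D.IsCrossingList γ ℓ L → Γ.EqUpTo ℓ (D.pathProduct γ L) 1

/-- Consistency: the path-ordered product of every admissible loop is trivial in `G`, that is, in
`G^{≤ℓ}` for every `ℓ`. -/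
def Consistent : Prop := ∀ ℓ, D.ConsistentUpTo ℓ

/-- Equivalence modulo `G^{>ℓ}`: the path-ordered products agree in `G^{≤ℓ}` for all curves that
are admissible for both diagrams. -/
def EquivUpTo {Γ : FixedData} (ℓ : ℕ) (D : ScatteringDiagram.{u} Γ)
    (D' : ScatteringDiagram.{v} Γ) : Prop :=
  ∀ γ : ℝ → ℝ × ℝ, D.Admissible γ → D'.Admissible γ →
    ∀ L L', D.IsCrossingList γ ℓ L → D'.IsCrossingList γ ℓ L' →
      Γ.EqUpTo ℓ (D.pathProduct γ L) (D'.pathProduct γ L')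

/-- A quantum cluster scattering diagram: a consistent scattering diagram whose incoming walls are
precisely the two walls `(eᵢ^⊥, Ψ_{1/δᵢ}[eᵢ])`. -/
structure IsQCSD : Prop where
  consistent : D.Consistent
  incoming : ∃ w : Fin 2 → D.Index, Function.Injective w ∧
    (∀ i, (D.wall i).Incoming ↔ i ∈ Set.range w) ∧
    ∀ k, (D.wall (w k)).normal = e k ∧ D.cone (w k) = perp (e k) ∧
      (D.wall (w k)).elt = Γ.Psi (1 / (Γ.δ k : ℚ)) 0 (e k)

/-- A positive realization: every wall element has the form `Ψ_{1/δ(n),b}[n]^c` with `n ∈ N⁺`,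
`b ∈ (1/δ₀)ℤ` and a positive integer `c`. -/
def PositiveRealization : Prop :=
  ∀ i, ∃ (n : ℕ × ℕ) (b : ℚ) (c : ℕ), n ≠ 0 ∧ Γ.InLattice b ∧ 0 < c ∧
    (D.wall i).elt = Γ.Psi (1 / Γ.normFactor n) b n ^ c

/-- Positivity up to `G^{≤ℓ}`: modulo `G^{>ℓ}`, the diagram is equivalent to a consistent
scattering diagram that is a positive realization. -/
def PositiveUpTo (ℓ : ℕ) : Prop :=
  ∃ D' : ScatteringDiagram.{0} Γ,
    D'.ConsistentUpTo ℓ ∧ D'.PositiveRealization ∧ EquivUpTo ℓ D D'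

end ScatteringDiagram

/-- A factor `Ψ_{1/δ(n),b}[n]^c`. -/
structure Factor where
  n : ℕ × ℕ
  b : ℚ
  c : ℕ

/-- The factor is an admissible positive power: `n ∈ N⁺`, `b ∈ (1/δ₀)ℤ`, `c > 0`. -/
def Factor.Positive (Γ : FixedData) (x : Factor) : Prop :=
  x.n ≠ 0 ∧ Γ.InLattice x.b ∧ 0 < x.c

/-- The element `Ψ_{1/δ(n),b}[n]^c` of `G`. -/
def Factor.elt (Γ : FixedData) (x : Factor) : Γ.G :=
  Γ.Psi (1 / Γ.normFactor x.n) x.b x.n ^ x.c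

/-- A product is ordered if `{n', n} ≤ 0` whenever the factor of `n'` stands to the left of that
of `n`. -/
def Ordered (Γ : FixedData) (L : List Factor) : Prop :=
  L.Pairwise fun x y => Γ.form x.n y.n ≤ 0

end

end QCSD

/-! The problem is reduced to one ordered factorization in $G^{\le 4}$, which is then computed. A
point on a wall with normal vector $n$ that lies outside one fixed closed quadrant is a positive
multiple of $p^*(n)$ (`exists_pStar_eq`), so that the wall is incoming. Hence, modulo $G^{>4}$, the
nontrivial elements of a QCSD sit on two incoming half-axes, where they are the seed elements, and
on the outgoing rays orthogonal to the seven primitive vectors of degree at most four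
(`IsQCSD.rays`).

A loop around the origin turns consistency into the statement that the ordered product of the
elements on the outgoing rays equals the product of the two seed elements in the opposite order
(`Rays.factorizes`). Conversely, such a factorization defines a piecewise constant function on the
plane whose jumps are the wall elements, and this forces consistency (`Rays.consistentUpTo`).
Ordered factorizations are unique (`Factorizes.unique`): to leading order the difference of two
products is the sum of the differences of their factors, and these are supported on disjoint rays.
So a positive ordered factorization gives the second assertion directly. It also gives a positive
consistent diagram, which by uniqueness has the same elements as the QCSD at every nonzero point and
is therefore equivalent to it.

For the factorization, suppose that $\delta_1\mid\delta_2$ and $\omega=\{e_2,e_1\}>0$. Put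
$r=\delta_2/\delta_1$, $N=\delta_1\omega$, $u=q^{1/\delta_2}$, $w=u^r$ and $Q=q^\omega=w^N$. The
leading coefficient of $\Psi_{1/\delta(n),b}[n]$ is $q^b/(q^{1/\delta(n)}-q^{-1/\delta(n)})$.
Therefore a prescribed leading coefficient at $n$ is attained by a product of such elements as soon
as its product with $q^{1/\delta(n)}-q^{-1/\delta(n)}$ is a Laurent polynomial in $u$ with
nonnegative integer coefficients: its monomials are the $q^b$. In degree at most four, $(1,1)$ is
the only vector with two positive entries that has a further multiple, namely $(2,2)$. Comparison of
coefficients gives rational $q$-binomial coefficients at $(1,2)$, $(1,3)$, $(2,1)$, $(3,1)$, the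
quantum integer $[N]$ in $w$ at $(1,1)$, and a product of three quotients at $(2,2)$.

Their positivity (`two_mem`, `three_mem`, `two_two_mem`) is the arithmetic core: the factor
$\gcd(r,2)$ or $\gcd(r,3)$ coming from $\delta(n)$ is exactly what makes the quotients polynomial,
and product formulas for $v^k-v^{-k}$ show that they are positive. The remaining cases follow from
two anti-isomorphisms of quantum tori, the exchange of $e_1$ and $e_2$ and the reversal of the sign
of the form. -/

namespace QCSD
namespace FixedData
variable {Γ : FixedData}

/-! ### Series supported on one ray, and uniqueness of ordered products. -/

namespace Torus

/-- The series supported on the multiples of `n`. -/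
def Ray (n : ℕ × ℕ) (f : Γ.Torus) : Prop := ∀ m, f.coeff m ≠ 0 → ∃ j : ℕ, m = j • n

theorem ray_one (n : ℕ × ℕ) : Ray n (1 : Γ.Torus) := by
  intro m hm
  rw [coeff_one] at hm
  exact ⟨0, by simpa using hm⟩

theorem Ray.mul {n : ℕ × ℕ} {f g : Γ.Torus} (hf : Ray n f) (hg : Ray n g) : Ray n (f * g) := by
  intro m hm
  rw [coeff_mul] at hm
  obtain ⟨p, hp, h⟩ := Finset.exists_ne_zero_of_sum_ne_zero hm
  have h' := right_ne_zero_of_mul h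
  obtain ⟨j, hj⟩ := hf _ (left_ne_zero_of_mul h')
  obtain ⟨k, hk⟩ := hg _ (right_ne_zero_of_mul h')
  exact ⟨j + k, by rw [← mem_splits.1 hp, hj, hk, add_smul]⟩

theorem Ray.pow {n : ℕ × ℕ} {f : Γ.Torus} (hf : Ray n f) (k : ℕ) : Ray n (f ^ k) := by
  induction k with
  | zero => rw [pow_zero]; exact ray_one n
  | succ k ih => rw [pow_succ]; exact ih.mul hf

theorem Ray.exp {n : ℕ × ℕ} {f : Γ.Torus} (hf : Ray n f) : Ray n (exp f) := by
  intro m hm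
  rw [coeff_exp] at hm
  obtain ⟨k, -, h⟩ := Finset.exists_ne_zero_of_sum_ne_zero hm
  exact hf.pow k m (right_ne_zero_of_mul h)

theorem form_smul_smul (n : ℕ × ℕ) (j k : ℕ) : Γ.form (j • n) (k • n) = 0 := by
  simp only [form, Prod.smul_fst, Prod.smul_snd, smul_eq_mul]; push_cast; ring

/-- The form vanishes on pairs of multiples of one vector, so no power of $q$ arises when the
factors are exchanged. -/
theorem Ray.commute {n : ℕ × ℕ} {f g : Γ.Torus} (hf : Ray n f) (hg : Ray n g) : f * g = g * f := by
  refine ext fun m => ?_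
  rw [coeff_mul, coeff_mul]
  refine Finset.sum_nbij' Prod.swap Prod.swap ?_ ?_ (fun _ _ => rfl) (fun _ _ => rfl) ?_
  · intro p hp
    rw [mem_splits] at hp ⊢
    simpa [add_comm] using hp
  · intro p hp
    rw [mem_splits] at hp ⊢
    simpa [add_comm] using hp
  · rintro ⟨a, b⟩ _
    simp only [Prod.fst_swap, Prod.snd_swap]
    by_cases ha : f.coeff a = 0
    · simp [ha]
    by_cases hb : g.coeff b = 0
    · simp [hb]
    obtain ⟨j, rfl⟩ := hf a ha
    obtain ⟨k, rfl⟩ := hg b hb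
    rw [form_smul_smul, form_smul_smul, mul_comm (f.coeff _)]

theorem coeff_list_sum (l : List Γ.Torus) (m : ℕ × ℕ) :
    l.sum.coeff m = (l.map (coeff m)).sum := by
  induction l with
  | nil => rfl
  | cons a l ih => rw [List.sum_cons, coeff_add, ih, List.map_cons, List.sum_cons]

theorem Van.list_sum {d : ℕ} {l : List Γ.Torus} (h : ∀ f ∈ l, Van d f) : Van d l.sum := by
  intro m hm
  rw [coeff_list_sum]
  refine List.sum_eq_zero fun x hx => ?_
  obtain ⟨f, hf, rfl⟩ := List.mem_map.1 hx
  exact h f hf m hm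

theorem coeff_zero_list_prod {l : List Γ.Torus} (h : ∀ f ∈ l, f.coeff 0 = 1) :
    l.prod.coeff 0 = 1 := by
  induction l with
  | nil => simp [coeff_one]
  | cons a l ih =>
    rw [List.prod_cons, coeff_zero_mul, h a (by simp), ih fun f hf => h f (by simp [hf]), one_mul]

theorem van_sub_one {f : Γ.Torus} (hf : f.coeff 0 = 1) : Van 1 (f - 1) := by
  rw [van_one_iff, coeff_sub, hf, coeff_one, if_pos rfl, sub_self]

/-- To leading order the difference of two products is the sum of the differences of the
factors. -/
theorem van_prod_sub_prod {ι : Type*} (l : List ι) {a b : ι → Γ.Torus} {d : ℕ}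
    (ha : ∀ i ∈ l, (a i).coeff 0 = 1) (hb : ∀ i ∈ l, (b i).coeff 0 = 1)
    (h : ∀ i ∈ l, Van d (a i - b i)) :
    Van (d + 1) ((l.map a).prod - (l.map b).prod - (l.map fun i => a i - b i).sum) := by
  induction l with
  | nil => simpa using van_zero (d + 1)
  | cons i l ih =>
    have ih := ih (fun k hk => ha k (by simp [hk])) (fun k hk => hb k (by simp [hk]))
      (fun k hk => h k (by simp [hk]))
    have hs : Van d (l.map fun i => a i - b i).sum := Van.list_sum fun f hf => by
      obtain ⟨k, hk, rfl⟩ := List.mem_map.1 hf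
      exact h k (by simp [hk])
    have hA : Van 1 ((l.map a).prod - 1) := van_sub_one (coeff_zero_list_prod fun f hf => by
      obtain ⟨k, hk, rfl⟩ := List.mem_map.1 hf
      exact ha k (by simp [hk]))
    have hd : Van d ((l.map a).prod - (l.map b).prod) := by
      have := (ih.mono (Nat.le_succ d)).add hs
      rwa [sub_add_cancel] at this
    -- In the first two summands a difference that vanishes below degree $d$ is multiplied by a
    -- series without constant term, which gains one degree; the third summand is the inductive
    -- hypothesis.
    have e1 : ((i :: l).map a).prod - ((i :: l).map b).prod -
        ((i :: l).map fun i => a i - b i).sum = (a i - b i) * ((l.map a).prod - 1) +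
        (b i - 1) * ((l.map a).prod - (l.map b).prod) +
        ((l.map a).prod - (l.map b).prod - (l.map fun i => a i - b i).sum) := by
      simp only [List.map_cons, List.prod_cons, List.sum_cons]
      noncomm_ring
    rw [e1]
    refine (((h i (by simp)).mul hA).add ?_).add ih
    exact ((van_sub_one (hb i (by simp))).mul hd).mono (by omega)

/-- Factors on distinct rays are determined by their product. -/
theorem van_sub_of_van_prod_sub {l : List (ℕ × ℕ)} (hl : l.Nodup)
    (hdisj : ∀ n ∈ l, ∀ n' ∈ l, ∀ j k : ℕ, j • n = k • n' → j • n ≠ 0 → n = n')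
    {a b : ℕ × ℕ → Γ.Torus} (ha : ∀ n ∈ l, (a n).coeff 0 = 1) (hb : ∀ n ∈ l, (b n).coeff 0 = 1)
    (hra : ∀ n ∈ l, Ray n (a n)) (hrb : ∀ n ∈ l, Ray n (b n)) {d : ℕ}
    (h : Van d ((l.map a).prod - (l.map b).prod)) : ∀ n ∈ l, Van d (a n - b n) := by
  induction d with
  | zero => exact fun n _ => van_any _
  | succ d ih =>
    have ih := ih (h.mono (Nat.le_succ d))
    -- By induction the factors agree below degree $d$. In degree $d$ the sum of their differences
    -- therefore equals the difference of the products, which vanishes. The summands are supported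
    -- on rays that meet only in $0$, so they cannot cancel each other.
    have h1 := h.sub (van_prod_sub_prod l ha hb ih)
    rw [sub_sub_cancel] at h1
    have hray : ∀ n ∈ l, ∀ m, (a n - b n).coeff m ≠ 0 → ∃ j : ℕ, m = j • n := by
      intro n hn m hm
      by_cases h0 : (a n).coeff m = 0
      · refine hrb n hn m fun h2 => hm ?_
        rw [coeff_sub, h0, h2, sub_zero]
      · exact hra n hn m h0
    intro n hn m hm
    by_contra hne
    have h2 := h1 m hm
    rw [coeff_list_sum, List.map_map, ← List.sum_toFinset _ hl,
      Finset.sum_eq_single n] at h2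
    · exact hne h2
    · intro n' hn' hnn
      by_contra h3
      obtain ⟨j, hj⟩ := hray n hn m hne
      obtain ⟨k, hk⟩ := hray n' (by simpa using hn') m h3
      refine hnn (hdisj n hn n' (by simpa using hn') j k (hj.symm.trans hk) ?_).symm
      intro h0
      rw [← hj] at h0
      apply hne
      rw [h0, coeff_sub, ha n hn, hb n hn, sub_self]
    · intro h3
      exact absurd (by simpa using hn) h3

end Torus

/-! ### Congruence modulo $G^{>\ell}$ and group elements supported on a ray. -/

theorem eqUpTo_iff {ℓ : ℕ} {g h : Γ.G} :
    Γ.EqUpTo ℓ g h ↔ Torus.Van (ℓ + 1) (toSeries g - toSeries h) := by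
  unfold EqUpTo
  rw [QuotientGroup.eq]
  change Torus.Van (ℓ + 1) (toSeries (g⁻¹ * h) - 1) ↔ _
  have h1 : toSeries g * toSeries g⁻¹ = 1 := by rw [← toSeries_mul, mul_inv_cancel, toSeries_one]
  have h2 : toSeries g⁻¹ * toSeries g = 1 := by rw [← toSeries_mul, inv_mul_cancel, toSeries_one]
  constructor
  · intro h3
    have h4 := ((Torus.van_any (toSeries g)).mul h3)
    rw [mul_sub, toSeries_mul, ← mul_assoc, h1, one_mul, mul_one, zero_add] at h4
    have h5 := (Torus.van_zero _).sub h4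
    rwa [zero_sub, neg_sub] at h5
  · intro h3
    have h4 := ((Torus.van_any (toSeries g⁻¹)).mul h3)
    rw [mul_sub, h2, ← toSeries_mul, zero_add] at h4
    have h5 := (Torus.van_zero _).sub h4
    rwa [zero_sub, neg_sub] at h5

theorem toSeries_list_prod (l : List Γ.G) : toSeries l.prod = (l.map toSeries).prod := by
  induction l with
  | nil => exact toSeries_one
  | cons a l ih => rw [List.prod_cons, toSeries_mul, ih, List.map_cons, List.prod_cons]

/-- The elements of `G` supported on the multiples of `n`. -/
def rayGroup (Γ : FixedData) (n : ℕ × ℕ) : Submonoid Γ.G where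
  carrier := {g | Torus.Ray n (toSeries g)}
  mul_mem' := fun ha hb => Torus.Ray.mul ha hb
  one_mem' := Torus.ray_one n

theorem mem_rayGroup {n : ℕ × ℕ} {g : Γ.G} : g ∈ Γ.rayGroup n ↔ Torus.Ray n (toSeries g) := Iff.rfl

theorem commute_of_mem_rayGroup {n : ℕ × ℕ} {g h : Γ.G} (hg : g ∈ Γ.rayGroup n)
    (hh : h ∈ Γ.rayGroup n) : Commute g h :=
  toSeries_injective (Torus.Ray.commute hg hh)

theorem coeff_alongRay_ne {n m : ℕ × ℕ} {c : ℕ → K} (h : (Γ.alongRay n c).coeff m ≠ 0) :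
    ∃ j : ℕ, 1 ≤ j ∧ m = j • n := by
  by_cases hm : m = 0
  · rw [hm, LieHat.coeff_zero] at h
    exact absurd rfl h
  · rw [LieHat.coeff_of_ne _ hm] at h
    obtain ⟨j, hj, -⟩ := Finset.exists_ne_zero_of_sum_ne_zero h
    rw [Finset.mem_filter, Finset.mem_Icc] at hj
    exact ⟨j, hj.1.1, hj.2.symm⟩

theorem coeff_alongRay {n : ℕ × ℕ} (hn : n ≠ 0) {c : ℕ → K} {j : ℕ} (hj : 1 ≤ j) :
    (Γ.alongRay n c).coeff (j • n) = c j := by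
  have hd : 1 ≤ deg n := Nat.one_le_iff_ne_zero.2 fun h => hn (deg_eq_zero.1 h)
  have hdj : deg (j • n) = j * deg n := by
    simp only [deg, Prod.smul_fst, Prod.smul_snd, smul_eq_mul]; ring
  have hinj : ∀ i, i • n = j • n → i = j := by
    intro i hi
    have := congrArg deg hi
    rw [hdj] at this
    have h2 : deg (i • n) = i * deg n := by
      simp only [deg, Prod.smul_fst, Prod.smul_snd, smul_eq_mul]; ring
    rw [h2] at this
    exact Nat.eq_of_mul_eq_mul_right hd this
  have h0 : j • n ≠ 0 := fun h => by
    rw [← deg_eq_zero, hdj, Nat.mul_eq_zero] at h; omega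
  rw [LieHat.coeff_of_ne _ h0]
  change ∑ i ∈ (Finset.Icc 1 (deg (j • n))).filter (fun i => i • n = j • n), c i = c j
  rw [Finset.sum_eq_single j]
  · intro i hi hij
    exact absurd (hinj i (Finset.mem_filter.1 hi).2) hij
  · intro h
    refine (h (Finset.mem_filter.2 ⟨Finset.mem_Icc.2 ⟨hj, ?_⟩, rfl⟩)).elim
    rw [hdj]
    exact Nat.le_mul_of_pos_right _ hd

theorem mem_rayGroup_of_mem_Gpar {n : ℕ × ℕ} {g : Γ.G} (hg : g ∈ Γ.Gpar n) :
    g ∈ Γ.rayGroup n := by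
  obtain ⟨c, rfl⟩ := hg
  rw [mem_rayGroup, toSeries_expG]
  refine Torus.Ray.exp fun m hm => ?_
  rw [LieHat.coeff_toTorus] at hm
  obtain ⟨j, -, h⟩ := coeff_alongRay_ne (div_ne_zero_iff.1 hm).1
  exact ⟨j, h⟩

theorem mem_Ggt_of_mem_Gpar {n : ℕ × ℕ} {g : Γ.G} (hg : g ∈ Γ.Gpar n) {ℓ : ℕ} (h : ℓ < deg n) :
    g ∈ Γ.Ggt ℓ := by
  obtain ⟨c, rfl⟩ := hg
  refine Γ.mem_Ggt_iff.2 ⟨_, fun m hm => ?_, rfl⟩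
  by_contra hne
  obtain ⟨j, hj, rfl⟩ := coeff_alongRay_ne hne
  have hdj : deg (j • n) = j * deg n := by
    simp only [deg, Prod.smul_fst, Prod.smul_snd, smul_eq_mul]; ring
  rw [hdj] at hm
  nlinarith

/-- Walls have primitive normal vectors, whereas factors such as $\Psi[(2,2)]$ do not. This places a
factor on $kn$ on a wall with normal vector $n$: the coefficients at multiples of $n$ with index not
divisible by $k$ are set to zero. -/
theorem alongRay_smul_mem_Gpar {n : ℕ × ℕ} (hn : n ≠ 0) {k : ℕ} (hk : 1 ≤ k) (c : ℕ → K) :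
    expG (Γ.alongRay (k • n) c) ∈ Γ.Gpar n := by
  refine ⟨fun j => if k ∣ j then c (j / k) else 0, congrArg expG (LieHat.ext fun m => ?_)⟩
  have hkn : k • n ≠ 0 := fun h => by
    rcases smul_eq_zero.1 h with h | h
    · omega
    · exact hn h
  by_cases h : ∃ j : ℕ, 1 ≤ j ∧ m = j • n
  · obtain ⟨j, hj, rfl⟩ := h
    rw [coeff_alongRay hn hj]
    by_cases hd : k ∣ j
    · obtain ⟨i, rfl⟩ := hd
      have hi : 1 ≤ i := Nat.one_le_iff_ne_zero.2 fun h => by simp [h] at hj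
      rw [if_pos (dvd_mul_right k i), Nat.mul_div_cancel_left _ (by omega), mul_comm, mul_smul,
        coeff_alongRay hkn hi]
    · rw [if_neg hd]
      by_contra hne
      obtain ⟨i, -, hi⟩ := coeff_alongRay_ne hne
      rw [← mul_smul] at hi
      refine hd ⟨i, ?_⟩
      rw [mul_comm]
      have hd' : 1 ≤ deg n := Nat.one_le_iff_ne_zero.2 fun h => hn (deg_eq_zero.1 h)
      have := congrArg deg hi
      simp only [deg, Prod.smul_fst, Prod.smul_snd, smul_eq_mul, ← mul_add] at this
      exact Nat.eq_of_mul_eq_mul_right hd' this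
  · have h1 : (Γ.alongRay n fun j => if k ∣ j then c (j / k) else 0).coeff m = 0 := by
      by_contra hne
      exact h (coeff_alongRay_ne hne)
    have h2 : (Γ.alongRay (k • n) c).coeff m = 0 := by
      by_contra hne
      obtain ⟨i, hi, h3⟩ := coeff_alongRay_ne hne
      rw [← mul_smul] at h3
      exact h ⟨i * k, Nat.mul_pos hi hk, h3⟩
    rw [h1, h2]

end FixedData
end QCSD

/-! ### Laurent polynomials with nonnegative coefficients and positivity of rational $q$-binomials.
-/

namespace QCSD

/-- The Laurent polynomials in the variable of `K` with nonnegative integer coefficients. -/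
def Pos : Subsemiring K where
  carrier := {f | ∃ l : List ℤ, (l.map fun z => (RatFunc.X : K) ^ z).sum = f}
  zero_mem' := ⟨[], rfl⟩
  one_mem' := ⟨[0], by simp⟩
  add_mem' := by
    rintro _ _ ⟨l, rfl⟩ ⟨l', rfl⟩
    exact ⟨l ++ l', by simp⟩
  mul_mem' := by
    rintro _ _ ⟨l, rfl⟩ ⟨l', rfl⟩
    refine ⟨l.flatMap fun z => l'.map fun z' => z + z', ?_⟩
    induction l with
    | nil => simp
    | cons z l ih =>
      simp only [List.flatMap_cons, List.map_append, List.sum_append, ih, List.map_cons,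
        List.sum_cons, add_mul, List.map_map]
      congr 1
      rw [← List.sum_map_mul_left]
      congr 1
      refine List.map_congr_left fun z' _ => ?_
      simp [zpow_add₀ (RatFunc.X_ne_zero : (RatFunc.X : K) ≠ 0)]

theorem X_zpow_mem_Pos (z : ℤ) : (RatFunc.X : K) ^ z ∈ Pos := ⟨[z], by simp⟩

noncomputable section

/-- The difference `v^k - v^{-k}`. -/
def qdiff (v : K) (k : ℤ) : K := v ^ k - v ^ (-k)

theorem qdiff_zero (v : K) : qdiff v 0 = 0 := by simp [qdiff]

theorem X_pow_ne_one {k : ℕ} (hk : 0 < k) : (RatFunc.X : K) ^ k ≠ 1 := by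
  intro h1
  rw [← RatFunc.algebraMap_X, ← map_pow, ← map_one (algebraMap (Polynomial ℚ) (RatFunc ℚ))] at h1
  have h3 := congrArg Polynomial.natDegree (RatFunc.algebraMap_injective ℚ h1)
  simp at h3
  omega

theorem X_zpow_ne_one {k : ℤ} (hk : k ≠ 0) : (RatFunc.X : K) ^ k ≠ 1 := by
  rcases Int.lt_or_gt_of_ne hk with h | h
  · obtain ⟨n, hn⟩ := Int.eq_ofNat_of_zero_le (by omega : 0 ≤ -k)
    intro h1
    refine X_pow_ne_one (k := n) (by omega) ?_
    rw [← zpow_natCast]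
    erw [← hn]
    rw [zpow_neg, h1, inv_one]
  · obtain ⟨n, rfl⟩ := Int.eq_ofNat_of_zero_le h.le
    exact_mod_cast X_pow_ne_one (k := n) (by omega)

theorem qdiff_X_ne_zero {k : ℤ} (hk : k ≠ 0) : qdiff RatFunc.X k ≠ 0 := by
  rw [qdiff, sub_ne_zero, zpow_neg]
  intro h
  refine X_zpow_ne_one (k := k + k) (by omega) ?_
  rw [zpow_add₀ RatFunc.X_ne_zero]
  nth_rewrite 1 [h]
  exact inv_mul_cancel₀ (zpow_ne_zero _ RatFunc.X_ne_zero)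

/-- A monomial of positive degree. -/
structure Mono (v : K) : Prop where
  zpow_mem : ∀ z : ℤ, v ^ z ∈ Pos
  ne : v ≠ 0
  qdiff_ne : ∀ k : ℤ, k ≠ 0 → qdiff v k ≠ 0

theorem qdiff_zpow (v : K) (a b : ℤ) : qdiff (v ^ a) b = qdiff v (a * b) := by
  simp only [qdiff, ← zpow_mul, mul_neg]

theorem mono_X_zpow {r : ℤ} (hr : r ≠ 0) : Mono (RatFunc.X ^ r : K) where
  zpow_mem z := by rw [← zpow_mul]; exact X_zpow_mem_Pos _
  ne := zpow_ne_zero _ RatFunc.X_ne_zero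
  qdiff_ne k hk := by rw [qdiff_zpow]; exact qdiff_X_ne_zero (mul_ne_zero hr hk)

theorem Mono.zpow {v : K} (hv : Mono v) {a : ℤ} (ha : a ≠ 0) : Mono (v ^ a) where
  zpow_mem z := by rw [← zpow_mul]; exact hv.zpow_mem _
  ne := zpow_ne_zero _ hv.ne
  qdiff_ne k hk := by rw [qdiff_zpow]; exact hv.qdiff_ne _ (mul_ne_zero ha hk)

/-- The sum is the balanced expansion of the quantum integer $[b]$; multiplied by $v-v^{-1}$ it
telescopes. All positivity below comes from this expansion with $v$ replaced by a power of $v$. -/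
theorem sum_zpow_mul_qdiff {v : K} (hv : v ≠ 0) (b : ℕ) :
    (∑ i ∈ Finset.range b, v ^ ((b : ℤ) - 1 - 2 * i)) * qdiff v 1 = qdiff v b := by
  induction b with
  | zero => simp [qdiff]
  | succ b ih =>
    have h : ∑ i ∈ Finset.range b, v ^ (((b + 1 : ℕ) : ℤ) - 1 - 2 * i) =
        v * ∑ i ∈ Finset.range b, v ^ ((b : ℤ) - 1 - 2 * i) := by
      rw [Finset.mul_sum]
      refine Finset.sum_congr rfl fun i _ => ?_
      rw [← zpow_one_add₀ hv]
      congr 1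
      push_cast
      ring
    rw [Finset.sum_range_succ, h, add_mul, mul_assoc, ih]
    have e1 : ((b + 1 : ℕ) : ℤ) - 1 - 2 * b = -b := by push_cast; ring
    rw [e1]
    simp only [qdiff]
    push_cast
    rw [neg_add, zpow_add₀ hv, zpow_add₀ hv]
    simp only [zpow_one, zpow_neg]
    field_simp
    ring

variable {v : K}

namespace Mono

/-- Divisibility of exponents gives a positive quotient. -/
theorem div_mem (hv : Mono v) {a k : ℤ} (ha : a ≠ 0) (b : ℕ) (hk : k = a * b) :
    qdiff v k / qdiff v a ∈ Pos := by
  have h := sum_zpow_mul_qdiff (hv.zpow ha).ne b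
  rw [qdiff_zpow, qdiff_zpow, mul_one] at h
  rw [hk, ← h, mul_div_cancel_right₀ _ (hv.qdiff_ne a ha)]
  exact Subsemiring.sum_mem _ fun i _ => (hv.zpow ha).zpow_mem _

theorem div_one_mem (hv : Mono v) {k : ℤ} (hk : 0 ≤ k) : qdiff v k / qdiff v 1 ∈ Pos := by
  obtain ⟨b, rfl⟩ := Int.eq_ofNat_of_zero_le hk
  exact hv.div_mem one_ne_zero b (by simp)

/-- This product formula rewrites a numerator whose factors are not separately divisible by the
denominator as a sum of terms that are. -/
theorem add_sub (hv : Mono v) (a b : ℤ) :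
    qdiff v (a + b) + qdiff v (a - b) = qdiff v a * (v ^ b + v ^ (-b)) := by
  have := hv.ne
  simp only [qdiff, neg_add, sub_eq_add_neg, neg_neg, zpow_add₀ this]
  ring

theorem double (hv : Mono v) (b : ℤ) : qdiff v (2 * b) = qdiff v b * (v ^ b + v ^ (-b)) := by
  have h := hv.add_sub b b
  rwa [sub_self, qdiff_zero, add_zero, ← two_mul] at h

theorem triple (hv : Mono v) (b : ℤ) :
    qdiff v (3 * b) = qdiff v b * (v ^ (2 * b) + 1 + v ^ (-(2 * b))) := by
  have h1 := hv.ne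
  have h := zpow_ne_zero b h1
  simp only [qdiff, (by ring : 3 * b = b + b + b), two_mul, neg_add, zpow_add₀ h1, zpow_neg]
  field_simp
  ring

/-- Write $[k]$ for `qdiff v k`. Since $[2r]/[r]=v^r+v^{-r}$, the numerator becomes $[L+r]+[L-r]$,
and both arguments are even and nonnegative. -/
theorem double_mul_mem (hv : Mono v) {r L : ℤ} (hr : r ≠ 0) (hr2 : r % 2 = 1) (hL2 : L % 2 = 1)
    (hL0 : 0 ≤ L + r) (hL : r ≤ L) :
    qdiff v (2 * r) * qdiff v L / (qdiff v 2 * qdiff v r) ∈ Pos := by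
  have h2 := hv.qdiff_ne 2 two_ne_zero
  have h3 := hv.qdiff_ne r hr
  have e1 : qdiff v (2 * r) * qdiff v L / (qdiff v 2 * qdiff v r) =
      qdiff v (L + r) / qdiff v 2 + qdiff v (L - r) / qdiff v 2 := by
    rw [← add_div, hv.add_sub, hv.double]
    field_simp
  rw [e1]
  exact Pos.add_mem (hv.div_mem two_ne_zero ((L + r) / 2).toNat (by omega))
    (hv.div_mem two_ne_zero ((L - r) / 2).toNat (by omega))

/-- Write $[k]$ for `qdiff v k`. Since $[3r]/[r]=v^{2r}+1+v^{-2r}$, the numerator becomes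
$[L+2r]+[L]+[L-2r]$. As $r$ is prime to $3$, exactly one of $L$, $L+r$, $L-r$ is divisible by $3$.
Accordingly the sum is regrouped as $[L](v^{2r}+1+v^{-2r})$, as $[L+r](v^r+v^{-r})+[L-2r]$ or as
$[L-r](v^r+v^{-r})+[L+2r]$, in which every bracket has an argument divisible by $3$. The bound
$2r\le L$ keeps these arguments nonnegative; for $r=1$ the whole quotient is $[L]/[1]$ and no such
bound is needed. -/
theorem triple_mul_mem (hv : Mono v) {r L : ℤ} (hr : 0 < r) (hr3 : r % 3 ≠ 0)
    (hL : 2 * r ≤ L ∨ r = 1 ∧ 0 ≤ L) :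
    qdiff v (3 * r) * qdiff v L / (qdiff v 3 * qdiff v r) ∈ Pos := by
  have h3 := hv.qdiff_ne 3 three_ne_zero
  have h1 := hv.qdiff_ne r hr.ne'
  rcases hL with hL | ⟨rfl, hL⟩
  swap
  · rw [mul_one, mul_div_mul_left _ _ h3]
    exact hv.div_one_mem hL
  have hp : ∀ z : ℤ, v ^ z + v ^ (-z) ∈ Pos := fun z =>
    Pos.add_mem (hv.zpow_mem _) (hv.zpow_mem _)
  have e1 : qdiff v (3 * r) * qdiff v L / (qdiff v 3 * qdiff v r) =
      (qdiff v L * (v ^ (2 * r) + 1 + v ^ (-(2 * r)))) / qdiff v 3 := by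
    rw [hv.triple]
    field_simp
  rw [e1]
  have hs := hv.add_sub L (2 * r)
  by_cases hA : L % 3 = 0
  · rw [mul_div_right_comm]
    exact Pos.mul_mem (hv.div_mem three_ne_zero (L / 3).toNat (by omega))
      (Pos.add_mem (Pos.add_mem (hv.zpow_mem _) Pos.one_mem) (hv.zpow_mem _))
  by_cases hB : (L + r) % 3 = 0
  · have e2 : qdiff v L * (v ^ (2 * r) + 1 + v ^ (-(2 * r))) =
        qdiff v (L + r) * (v ^ r + v ^ (-r)) + qdiff v (L - 2 * r) := by
      rw [← hv.add_sub]
      rw [add_sub_cancel_right, (by ring : L + r + r = L + 2 * r)]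
      linear_combination -hs
    rw [e2, add_div, mul_div_right_comm]
    exact Pos.add_mem (Pos.mul_mem (hv.div_mem three_ne_zero ((L + r) / 3).toNat (by omega)) (hp r))
      (hv.div_mem three_ne_zero ((L - 2 * r) / 3).toNat (by omega))
  · have hC : (L - r) % 3 = 0 := by
      rcases (by omega : L % 3 = 1 ∨ L % 3 = 2) with h | h <;>
      rcases (by omega : r % 3 = 1 ∨ r % 3 = 2) with h' | h' <;> omega
    have e2 : qdiff v L * (v ^ (2 * r) + 1 + v ^ (-(2 * r))) =
        qdiff v (L - r) * (v ^ r + v ^ (-r)) + qdiff v (L + 2 * r) := by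
      rw [← hv.add_sub]
      rw [sub_add_cancel, (by ring : L - r - r = L - 2 * r)]
      linear_combination -hs
    rw [e2, add_div, mul_div_right_comm]
    exact Pos.add_mem (Pos.mul_mem (hv.div_mem three_ne_zero ((L - r) / 3).toNat (by omega)) (hp r))
      (hv.div_mem three_ne_zero ((L + 2 * r) / 3).toNat (by omega))

/-- One of $k$ and $k-1$ is even and absorbs the denominator `qdiff v 2`. -/
theorem choose_two_mem (hv : Mono v) {k : ℤ} (hk : 1 ≤ k) :
    qdiff v k * qdiff v (k - 1) / (qdiff v 1 * qdiff v 2) ∈ Pos := by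
  have h1 := hv.qdiff_ne 1 one_ne_zero
  have h2 := hv.qdiff_ne 2 two_ne_zero
  rcases Int.emod_two_eq_zero_or_one k with h | h
  · rw [mul_comm (qdiff v 1), mul_div_mul_comm]
    exact Pos.mul_mem (hv.div_mem two_ne_zero (k / 2).toNat (by omega))
      (hv.div_one_mem (by omega))
  · rw [mul_div_mul_comm]
    exact Pos.mul_mem (hv.div_one_mem (by omega))
      (hv.div_mem two_ne_zero ((k - 1) / 2).toNat (by omega))

/-- Positivity of the rational `q`-binomial coefficient of level two, odd denominator. -/
theorem two_mem_odd (hv : Mono v) {r N : ℕ} (hr2 : r % 2 = 1) :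
    qdiff v (N * r) * qdiff v (N * r - 1) / (qdiff v 2 * qdiff v r) ∈ Pos := by
  have hr : (r : ℤ) ≠ 0 := by omega
  -- For odd $N$ the number $Nr-1$ is even and the quotient splits into two positive ones. For even
  -- $N$ it is odd, so that the factor $2$ has to be taken from $Nr$: a division by $[2r]$ leaves
  -- $[2r][Nr-1]/([2][r])$, the case of `double_mul_mem`.
  rcases Nat.even_or_odd' N with ⟨n, rfl | rfl⟩
  · rcases Nat.eq_zero_or_pos n with rfl | hn
    · simp [qdiff_zero]
    have h2r := hv.qdiff_ne (2 * r) (by omega)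
    have e : qdiff v ((2 * n : ℕ) * r) * qdiff v ((2 * n : ℕ) * r - 1) / (qdiff v 2 * qdiff v r) =
        qdiff v ((2 * n : ℕ) * r) / qdiff v (2 * r) *
        (qdiff v (2 * r) * qdiff v ((2 * n : ℕ) * r - 1) / (qdiff v 2 * qdiff v r)) := by
      field_simp
    rw [e]
    have hle : (r : ℤ) ≤ n * r := by nlinarith
    have hodd : ((2 * n : ℕ) * r : ℤ) = 2 * (n * r) := by push_cast; ring
    refine Pos.mul_mem (hv.div_mem (by omega) n (by push_cast; ring)) ?_
    rw [hodd]
    exact hv.double_mul_mem hr (by omega) (by omega) (by omega) (by omega)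
  · have hle : 0 ≤ (n : ℤ) * r := by positivity
    rw [mul_comm (qdiff v 2), mul_div_mul_comm]
    refine Pos.mul_mem (hv.div_mem hr (2 * n + 1) (by ring)) ?_
    refine hv.div_mem two_ne_zero (n * r + r / 2) ?_
    have : ((2 * n + 1 : ℕ) * r : ℤ) = 2 * (n * r) + r := by push_cast; ring
    rw [this]
    push_cast
    omega

/-- The factor with $\gcd(r,2)=\delta_0/\delta(n)$ clears the denominator of
$\Psi_{1/\delta(n),b}[n]$ for $n=(1,2)$. For even $r$ it cancels `qdiff v 2`; for odd $r$ it cancels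
`qdiff v 1`. For $r=1$ the quotient is an ordinary $q$-binomial coefficient, which is what occurs at
$(2,1)$. -/
theorem two_mem (hv : Mono v) {r N : ℕ} (hr : 0 < r) (hN : 0 < N) :
    qdiff v (N * r) * qdiff v (N * r - 1) * qdiff v (Nat.gcd r 2 : ℕ) /
      (qdiff v 1 * qdiff v 2 * qdiff v r) ∈ Pos := by
  have h1 := hv.qdiff_ne 1 one_ne_zero
  have h2 := hv.qdiff_ne 2 two_ne_zero
  have hr0 : (r : ℤ) ≠ 0 := by omega
  have h3 := hv.qdiff_ne r hr0
  rcases Nat.mod_two_eq_zero_or_one r with h | h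
  · have hg : Nat.gcd r 2 = 2 := Nat.gcd_eq_right (Nat.dvd_of_mod_eq_zero h)
    have hle : (0 : ℤ) < N * r := by positivity
    have e : qdiff v (N * r) * qdiff v (N * r - 1) * qdiff v (Nat.gcd r 2 : ℕ) /
        (qdiff v 1 * qdiff v 2 * qdiff v r) = qdiff v (N * r) / qdiff v r *
        (qdiff v (N * r - 1) / qdiff v 1) := by
      rw [hg]; push_cast; field_simp
    rw [e]
    exact Pos.mul_mem (hv.div_mem hr0 N (by ring)) (hv.div_one_mem (by omega))
  · have hg : Nat.gcd r 2 = 1 :=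
      (Nat.coprime_two_right.2 (Nat.odd_iff.2 h))
    have e : qdiff v (N * r) * qdiff v (N * r - 1) * qdiff v (Nat.gcd r 2 : ℕ) /
        (qdiff v 1 * qdiff v 2 * qdiff v r) =
        qdiff v (N * r) * qdiff v (N * r - 1) / (qdiff v 2 * qdiff v r) := by
      rw [hg]; push_cast; field_simp
    rw [e]
    exact hv.two_mem_odd h

/-- Positivity of the rational `q`-binomial coefficient of level three, denominator prime to
three. -/
theorem three_mem_coprime (hv : Mono v) {r N : ℕ} (hr3 : r % 3 ≠ 0) (hN : 0 < N) :
    qdiff v (N * r) * qdiff v (N * r - 1) * qdiff v (N * r - 2) /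
      (qdiff v 2 * qdiff v 3 * qdiff v r) ∈ Pos := by
  have hr : 0 < r := by omega
  have hr0 : (r : ℤ) ≠ 0 := by omega
  have h2 := hv.qdiff_ne 2 two_ne_zero
  have h3 := hv.qdiff_ne 3 three_ne_zero
  have h6 := hv.qdiff_ne (2 * 3) (by norm_num)
  have hrr := hv.qdiff_ne r hr0
  have h3r := hv.qdiff_ne (3 * r) (by omega)
  -- The denominator $[3]$ is absorbed by the numerator factor whose argument is divisible by $3$.
  -- If $3\mid N$ this is $[Nr]$, which is divided by $[3r]$; otherwise $Nr$ is prime to $3$ and one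
  -- of $Nr-1$, $Nr-2$ is used.
  by_cases hN3 : 3 ∣ N
  · obtain ⟨n, rfl⟩ := hN3
    have hle : (r : ℤ) ≤ n * r := by
      have : 1 ≤ n := by omega
      nlinarith
    have hM : (((3 * n : ℕ) : ℤ) * r) = 3 * (n * r) := by push_cast; ring
    rw [hM]
    generalize hm : (n : ℤ) * r = m at *
    have hdiv : qdiff v (3 * m) / qdiff v (3 * r) ∈ Pos :=
      hv.div_mem (by omega) n (by rw [← hm]; ring)
    -- Exactly one of $3m-1$ and $3m-2$ is even and absorbs $[2]$; the other one is the $L$ of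
    -- `triple_mul_mem`. The case $L=3m-2$ with $m=r=1$, in which $L<2r$, is the reason for the
    -- exceptional clause there.
    rcases Int.emod_two_eq_zero_or_one m with h | h
    · have e : qdiff v (3 * m) * qdiff v (3 * m - 1) * qdiff v (3 * m - 2) /
          (qdiff v 2 * qdiff v 3 * qdiff v r) = qdiff v (3 * m) / qdiff v (3 * r) *
          (qdiff v (3 * r) * qdiff v (3 * m - 1) / (qdiff v 3 * qdiff v r)) *
          (qdiff v (3 * m - 2) / qdiff v 2) := by
        field_simp
      rw [e]
      exact Pos.mul_mem (Pos.mul_mem hdiv (hv.triple_mul_mem (by omega) (by omega)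
        (Or.inl (by omega)))) (hv.div_mem two_ne_zero ((3 * m - 2) / 2).toNat (by omega))
    · have e : qdiff v (3 * m) * qdiff v (3 * m - 1) * qdiff v (3 * m - 2) /
          (qdiff v 2 * qdiff v 3 * qdiff v r) = qdiff v (3 * m) / qdiff v (3 * r) *
          (qdiff v (3 * r) * qdiff v (3 * m - 2) / (qdiff v 3 * qdiff v r)) *
          (qdiff v (3 * m - 1) / qdiff v 2) := by
        field_simp
      rw [e]
      exact Pos.mul_mem (Pos.mul_mem hdiv (hv.triple_mul_mem (by omega) (by omega)
        (by omega))) (hv.div_mem two_ne_zero ((3 * m - 1) / 2).toNat (by omega))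
  · have hM3 : ¬ 3 ∣ N * r := fun h => by
      rcases (Nat.Prime.dvd_mul Nat.prime_three).1 h with h | h
      · exact hN3 h
      · omega
    have hM0 : 0 < N * r := Nat.mul_pos hN hr
    have e : qdiff v (N * r) * qdiff v (N * r - 1) * qdiff v (N * r - 2) /
        (qdiff v 2 * qdiff v 3 * qdiff v r) = qdiff v (N * r) / qdiff v r *
        (qdiff v (N * r - 1) * qdiff v (N * r - 2) / (qdiff v 2 * qdiff v 3)) := by
      field_simp
    rw [e]
    refine Pos.mul_mem (hv.div_mem hr0 N (by ring)) ?_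
    rw [← Nat.cast_mul]
    generalize N * r = M at hM3 hM0
    -- If $3\mid M-1$, this is the level two quotient with denominator $3$. If $3\mid M-2$, the
    -- parity decides whether $2$ and $3$ divide different factors or whether both have to be taken
    -- from $M-2=6k$.
    by_cases h : M % 3 = 1
    · obtain ⟨n, hn⟩ : ∃ n, M = n * 3 + 1 := ⟨M / 3, by omega⟩
      have := hv.two_mem_odd (r := 3) (N := n) (by norm_num)
      convert this using 4
      · push_cast [hn]; ring
      · push_cast [hn]; ring
      · norm_num
    · obtain ⟨n, hn⟩ : ∃ n, M = 3 * n + 2 := ⟨M / 3, by omega⟩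
      rcases Nat.even_or_odd' n with ⟨k, rfl | rfl⟩
      · rcases Nat.eq_zero_or_pos k with rfl | hk
        · simp [hn, qdiff_zero]
        have e : qdiff v (M - 1) * qdiff v (M - 2) / (qdiff v 2 * qdiff v 3) =
            qdiff v (M - 2) / qdiff v (2 * 3) *
            (qdiff v (2 * 3) * qdiff v (M - 1) / (qdiff v 2 * qdiff v 3)) := by
          field_simp
        rw [e]
        exact Pos.mul_mem (hv.div_mem (by norm_num) k (by rw [hn]; push_cast; ring))
          (hv.double_mul_mem (by norm_num) (by norm_num) (by omega) (by omega) (by omega))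
      · rw [mul_div_mul_comm]
        exact Pos.mul_mem (hv.div_mem two_ne_zero (3 * k + 2) (by rw [hn]; push_cast; ring))
          (hv.div_mem three_ne_zero (2 * k + 1) (by rw [hn]; push_cast; ring))

/-- Here $\gcd(r,3)=\delta_0/\delta(n)$ for $n=(1,3)$. If $3\mid r$, its factor cancels `qdiff v 3`
and leaves a quotient by `qdiff v r` times an ordinary binomial coefficient; otherwise it cancels
`qdiff v 1`. The case $r=1$ serves for $(3,1)$. -/
theorem three_mem (hv : Mono v) {r N : ℕ} (hr : 0 < r) (hN : 0 < N) :
    qdiff v (N * r) * qdiff v (N * r - 1) * qdiff v (N * r - 2) * qdiff v (Nat.gcd r 3 : ℕ) /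
      (qdiff v 1 * qdiff v 2 * qdiff v 3 * qdiff v r) ∈ Pos := by
  have h1 := hv.qdiff_ne 1 one_ne_zero
  have h2 := hv.qdiff_ne 2 two_ne_zero
  have h3 := hv.qdiff_ne 3 three_ne_zero
  have hr0 : (r : ℤ) ≠ 0 := by omega
  have hrr := hv.qdiff_ne r hr0
  by_cases h : r % 3 = 0
  · have hg : Nat.gcd r 3 = 3 := Nat.gcd_eq_right (Nat.dvd_of_mod_eq_zero h)
    have hle : (3 : ℤ) ≤ N * r := by
      have : 3 ≤ r := by omega
      exact_mod_cast (by nlinarith : 3 ≤ N * r)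
    have e : qdiff v (N * r) * qdiff v (N * r - 1) * qdiff v (N * r - 2) *
        qdiff v (Nat.gcd r 3 : ℕ) / (qdiff v 1 * qdiff v 2 * qdiff v 3 * qdiff v r) =
        qdiff v (N * r) / qdiff v r *
        (qdiff v (N * r - 1) * qdiff v (N * r - 1 - 1) / (qdiff v 1 * qdiff v 2)) := by
      rw [hg, sub_sub, one_add_one_eq_two]; push_cast; field_simp
    rw [e]
    exact Pos.mul_mem (hv.div_mem hr0 N (by ring)) (hv.choose_two_mem (by omega))
  · have hg : Nat.gcd r 3 = 1 :=
      Nat.Coprime.symm ((Nat.Prime.coprime_iff_not_dvd Nat.prime_three).2 (by omega))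
    have e : qdiff v (N * r) * qdiff v (N * r - 1) * qdiff v (N * r - 2) *
        qdiff v (Nat.gcd r 3 : ℕ) / (qdiff v 1 * qdiff v 2 * qdiff v 3 * qdiff v r) =
        qdiff v (N * r) * qdiff v (N * r - 1) * qdiff v (N * r - 2) /
        (qdiff v 2 * qdiff v 3 * qdiff v r) := by
      rw [hg]; push_cast; field_simp
    rw [e]
    exact hv.three_mem_coprime h hN

/-- This is the generating sum of the factors on $(2,2)$. Each of the three numerator factors is
divisible by one of the denominator factors. For $N=1$ the expression vanishes. -/
theorem two_two_mem (hv : Mono v) {r N : ℕ} (hr : 0 < r) (hN : 0 < N) :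
    qdiff v (2 * (N * r)) * qdiff v (N * r - 1) * qdiff v (N * r - r) /
      (qdiff v 1 * qdiff v r * qdiff v (2 * r)) ∈ Pos := by
  have h1 := hv.qdiff_ne 1 one_ne_zero
  have hr0 : (r : ℤ) ≠ 0 := by omega
  have hrr := hv.qdiff_ne r hr0
  have h2r := hv.qdiff_ne (2 * r) (by omega)
  have hle : (0 : ℤ) < N * r := by positivity
  have e : qdiff v (2 * (N * r)) * qdiff v (N * r - 1) * qdiff v (N * r - r) /
      (qdiff v 1 * qdiff v r * qdiff v (2 * r)) = qdiff v (2 * (N * r)) / qdiff v (2 * r) *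
      (qdiff v (N * r - 1) / qdiff v 1) * (qdiff v (N * r - r) / qdiff v r) := by
    field_simp
  rw [e]
  refine Pos.mul_mem (Pos.mul_mem (hv.div_mem (by omega) N (by ring))
    (hv.div_one_mem (by omega))) (hv.div_mem hr0 (N - 1) ?_)
  push_cast [Nat.cast_sub (show 1 ≤ N by omega)]
  ring

end Mono
end
end QCSD

/-! ### Coefficients of quantum dilogarithms along a ray. -/

namespace QCSD
namespace FixedData
noncomputable section
variable {Γ : FixedData}

namespace Torus

/-- The series `∑_{j ≥ 1} c_j y^{jn}`. -/
def ray (n : ℕ × ℕ) (c : ℕ → K) : Γ.Torus :=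
  fun m => ∑ j ∈ (Finset.Icc 1 (deg m)).filter (fun j => j • n = m), c j

theorem coeff_ray (n m : ℕ × ℕ) (c : ℕ → K) : (ray n c : Γ.Torus).coeff m =
    ∑ j ∈ (Finset.Icc 1 (deg m)).filter (fun j => j • n = m), c j := rfl

theorem ray_eq_toTorus (n : ℕ × ℕ) (c : ℕ → K) :
    (ray n fun j => c j / (Γ.qpow 1 - Γ.qpow (-1)) : Γ.Torus) = (Γ.alongRay n c).toTorus := by
  refine ext fun m => ?_
  rw [LieHat.coeff_toTorus]
  by_cases h : m = 0
  · subst h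
    rw [LieHat.coeff_zero, zero_div]
    rfl
  · rw [LieHat.coeff_of_ne _ h]
    rw [coeff_ray, ← Finset.sum_div]
    rfl

theorem ray_coeff {n : ℕ × ℕ} (hn : n ≠ 0) {c : ℕ → K} {j : ℕ} (hj : 1 ≤ j) :
    (ray n c : Γ.Torus).coeff (j • n) = c j := by
  have hne := Γ.qpow_one_sub_ne
  have h := ray_eq_toTorus (Γ := Γ) n fun j => c j * (Γ.qpow 1 - Γ.qpow (-1))
  simp only [mul_div_cancel_right₀ _ hne] at h
  rw [h, LieHat.coeff_toTorus, coeff_alongRay hn hj, mul_div_cancel_right₀ _ hne]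

theorem ray_coeff_zero (n : ℕ × ℕ) (c : ℕ → K) : (ray n c : Γ.Torus).coeff 0 = 0 := rfl

theorem ray_ray (n : ℕ × ℕ) (c : ℕ → K) : Ray n (ray n c : Γ.Torus) := by
  intro m hm
  rw [coeff_ray] at hm
  obtain ⟨j, hj, -⟩ := Finset.exists_ne_zero_of_sum_ne_zero hm
  exact ⟨j, (Finset.mem_filter.1 hj).2.symm⟩

theorem smul_left_inj_of_ne {n : ℕ × ℕ} (hn : n ≠ 0) {i j : ℕ} (h : i • n = j • n) : i = j := by
  have hd : 0 < deg n := Nat.pos_of_ne_zero fun h => hn (deg_eq_zero.1 h)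
  have := congrArg deg h
  simp only [deg, Prod.smul_fst, Prod.smul_snd, smul_eq_mul, ← mul_add] at this
  exact Nat.eq_of_mul_eq_mul_right hd this

/-- Along one ray the form vanishes, so series multiply like commutative power series in one
variable. -/
theorem Ray.coeff_mul {n : ℕ × ℕ} (hn : n ≠ 0) {f g : Γ.Torus} (hf : Ray n f) (hg : Ray n g)
    (j : ℕ) : (f * g).coeff (j • n) =
      ∑ p ∈ Finset.HasAntidiagonal.antidiagonal j, f.coeff (p.1 • n) * g.coeff (p.2 • n) := by
  rw [Torus.coeff_mul]
  symm
  refine Finset.sum_of_injOn (fun p => (p.1 • n, p.2 • n)) ?_ ?_ ?_ ?_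
  · rintro ⟨a, b⟩ _ ⟨c, d⟩ _ h
    simp only [Prod.mk.injEq] at h
    exact Prod.ext (smul_left_inj_of_ne hn h.1) (smul_left_inj_of_ne hn h.2)
  · rintro ⟨a, b⟩ h
    have h : a + b = j := by simpa using h
    simp only [Finset.mem_coe, mem_splits, ← add_smul, h]
  · rintro ⟨a, b⟩ h hni
    rw [mem_splits] at h
    by_contra hne
    have h' := right_ne_zero_of_mul hne
    obtain ⟨i, rfl⟩ := hf _ (left_ne_zero_of_mul h')
    obtain ⟨k, rfl⟩ := hg _ (right_ne_zero_of_mul h')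
    refine hni ⟨(i, k), ?_, rfl⟩
    rw [← add_smul] at h
    simpa using smul_left_inj_of_ne hn h
  · rintro ⟨a, b⟩ _
    rw [form_smul_smul, qpow_zero, one_mul]

theorem Ray.coeff_pow_eq_zero {n : ℕ × ℕ} (hn : n ≠ 0) {f : Γ.Torus} (hf : Ray n f)
    (h0 : f.coeff 0 = 0) {k j : ℕ} (h : j < k) : (f ^ k).coeff (j • n) = 0 := by
  induction k generalizing j with
  | zero => omega
  | succ k ih =>
    rw [pow_succ, (hf.pow k).coeff_mul hn hf]
    refine Finset.sum_eq_zero fun p hp => ?_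
    rw [Finset.HasAntidiagonal.mem_antidiagonal] at hp
    rcases Nat.eq_zero_or_pos p.2 with h2 | h2
    · rw [h2, zero_smul, h0, mul_zero]
    · rw [ih (by omega), zero_mul]

theorem Ray.coeff_exp {n : ℕ × ℕ} (hn : n ≠ 0) {f : Γ.Torus} (hf : Ray n f)
    (h0 : f.coeff 0 = 0) (j : ℕ) : (Torus.exp f).coeff (j • n) =
      ∑ k ∈ Finset.range (j + 1), ((k.factorial : K))⁻¹ * (f ^ k).coeff (j • n) := by
  rw [Torus.coeff_exp]
  symm
  refine Finset.sum_subset (fun k hk => ?_) (fun k _ hk => ?_)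
  · have hd : 0 < deg n := Nat.pos_of_ne_zero fun h => hn (deg_eq_zero.1 h)
    have : j ≤ deg (j • n) := by
      simp only [deg, Prod.smul_fst, Prod.smul_snd, smul_eq_mul, ← mul_add]
      exact Nat.le_mul_of_pos_right j hd
    rw [Finset.mem_range] at hk ⊢
    omega
  · rw [Finset.mem_range] at hk
    rw [hf.coeff_pow_eq_zero hn h0 (by omega), mul_zero]

/-- The series of `Ψ_{a,b}[n]`, with `A = δ₀a` and `B = δ₀b`. -/
def dilog (A B : ℤ) (n : ℕ × ℕ) : Γ.Torus :=
  exp (ray n fun j => (-1) ^ (j + 1) / ((j : K) * qdiff RatFunc.X (j * A)) * RatFunc.X ^ (j * B))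

theorem ray_dilog (A B : ℤ) (n : ℕ × ℕ) : Ray n (dilog A B n : Γ.Torus) := (ray_ray n _).exp

theorem coeff_zero_dilog (A B : ℤ) (n : ℕ × ℕ) : (dilog A B n : Γ.Torus).coeff 0 = 1 :=
  coeff_zero_exp _

theorem coeff_exp_ray_one {n : ℕ × ℕ} (hn : n ≠ 0) (c : ℕ → K) :
    (exp (ray n c) : Γ.Torus).coeff n = c 1 := by
  have h := (ray_ray (Γ := Γ) n c).coeff_exp hn (ray_coeff_zero n c) 1
  rw [one_smul] at h
  have h1 := ray_coeff (Γ := Γ) hn (c := c) le_rfl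
  rw [one_smul] at h1
  rw [h]
  simp [Finset.sum_range_succ, h1, coeff_one, hn]

theorem coeff_exp_ray_two {n : ℕ × ℕ} (hn : n ≠ 0) (c : ℕ → K) :
    (exp (ray n c) : Γ.Torus).coeff (2 • n) = c 2 + c 1 ^ 2 / 2 := by
  rw [(ray_ray (Γ := Γ) n c).coeff_exp hn (ray_coeff_zero n c) 2]
  have h1 := ray_coeff (Γ := Γ) hn (c := c) le_rfl
  have h2 := ray_coeff (Γ := Γ) hn (c := c) one_le_two
  have h0 := ray_coeff_zero (Γ := Γ) n c
  have hr := ray_ray (Γ := Γ) n c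
  simp only [Finset.sum_range_succ, Finset.sum_range_zero, pow_zero, pow_one, pow_two,
    hr.coeff_mul hn hr, Finset.Nat.antidiagonal_succ, h2, coeff_one]
  rw [one_smul] at h1
  simp [h0, h1, h2, hn, -nsmul_eq_mul, -smul_eq_mul]
  ring

theorem coeff_exp_ray_three {n : ℕ × ℕ} (hn : n ≠ 0) (c : ℕ → K) :
    (exp (ray n c) : Γ.Torus).coeff (3 • n) =
    c 3 + c 1 * c 2 + c 1 ^ 3 / 6 := by
  rw [(ray_ray (Γ := Γ) n c).coeff_exp hn (ray_coeff_zero n c) 3]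
  have h1 := ray_coeff (Γ := Γ) hn (c := c) le_rfl
  have h2 := ray_coeff (Γ := Γ) hn (c := c) one_le_two
  have h3 := ray_coeff (Γ := Γ) hn (c := c) (j := 3) (by norm_num)
  have h0 := ray_coeff_zero (Γ := Γ) n c
  have hr := ray_ray (Γ := Γ) n c
  simp only [Finset.sum_range_succ, Finset.sum_range_zero, pow_succ, pow_zero, one_mul,
    hr.coeff_mul hn hr, (hr.mul hr).coeff_mul hn hr, Finset.Nat.antidiagonal_succ, h3, coeff_one]
  rw [one_smul] at h1
  simp [h0, h1, h2, h3, hn, Nat.factorial, Finset.Nat.antidiagonal_succ, -nsmul_eq_mul,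
    -smul_eq_mul]
  ring

theorem coeff_dilog_one {n : ℕ × ℕ} (hn : n ≠ 0) (A B : ℤ) :
    (dilog A B n : Γ.Torus).coeff n = RatFunc.X ^ B / qdiff RatFunc.X A := by
  rw [dilog, coeff_exp_ray_one hn]
  simp [div_eq_inv_mul]

theorem coeff_dilog_two {n : ℕ × ℕ} (hn : n ≠ 0) (A B : ℤ) :
    (dilog A B n : Γ.Torus).coeff (2 • n) = (RatFunc.X ^ B / qdiff RatFunc.X A) ^ 2 / 2 -
      RatFunc.X ^ (2 * B) / qdiff RatFunc.X (2 * A) / 2 := by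
  rw [dilog, coeff_exp_ray_two hn]
  simp [div_eq_inv_mul]
  ring

theorem coeff_dilog_three {n : ℕ × ℕ} (hn : n ≠ 0) (A : ℤ) :
    (dilog A 0 n : Γ.Torus).coeff (3 • n) = 1 / qdiff RatFunc.X (3 * A) / 3 -
      1 / (qdiff RatFunc.X A * qdiff RatFunc.X (2 * A)) / 2 +
      1 / qdiff RatFunc.X A ^ 3 / 6 := by
  rw [dilog, coeff_exp_ray_three hn]
  simp [div_eq_inv_mul]
  ring

end Torus
end
end FixedData
end QCSD

/-! ### The identities between coefficients in degrees two to four. -/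

namespace QCSD

section Identities

variable {F : Type*} [Field F] {u w Q : F}

theorem sub_inv_ne {u : F} (hu : u ≠ 0) (h : u ^ 2 - 1 ≠ 0) : u - u⁻¹ ≠ 0 := by
  intro h'
  apply h
  have h2 := congrArg (u * ·) h'
  simpa [mul_sub, hu, ← pow_two] using h2

/-- In this and the following identities the left side is the coefficient of $y^{(a,b)}$ in
$\Psi[e_2]\Psi[e_1]$, and the right side is the one in the ordered product. Here $w$ belongs to
$e_1$, $u$ to $e_2$, and $Q=q^{\{e_2,e_1\}}$. The last summand, up to rearrangement, is the new
contribution at $(a,b)$, for which the identity can be solved. -/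
theorem coeff_identity_one_one (hu : u ≠ 0) (hw : w ≠ 0) (hQ : Q ≠ 0) (hu1 : u ^ 2 - 1 ≠ 0)
    (hw1 : w ^ 2 - 1 ≠ 0) :
    1 / (w - w⁻¹) * (1 / (u - u⁻¹)) * Q = 1 / (w - w⁻¹) * (1 / (u - u⁻¹)) * Q⁻¹ +
      (Q - Q⁻¹) / ((u - u⁻¹) * (w - w⁻¹)) := by
  have h1 := sub_inv_ne hu hu1
  have h2 := sub_inv_ne hw hw1
  field_simp
  ring

theorem coeff_identity_two_one (hu : u ≠ 0) (hw : w ≠ 0) (hQ : Q ≠ 0) (hu1 : u ^ 2 - 1 ≠ 0)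
    (hw1 : w ^ 2 - 1 ≠ 0) (hw2 : w ^ 2 + 1 ≠ 0) :
    w⁻¹ / ((w - w⁻¹) * (w ^ 2 - (w ^ 2)⁻¹)) * (1 / (u - u⁻¹)) * Q ^ 2 =
      w⁻¹ / ((w - w⁻¹) * (w ^ 2 - (w ^ 2)⁻¹)) * (1 / (u - u⁻¹)) * (Q ^ 2)⁻¹ +
      1 / (w - w⁻¹) * Q⁻¹ * ((Q - Q⁻¹) / ((u - u⁻¹) * (w - w⁻¹))) +
      (Q - Q⁻¹) * (Q / w - w / Q) / ((w - w⁻¹) * (w ^ 2 - (w ^ 2)⁻¹) * (u - u⁻¹)) := by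
  have h1 : u - u⁻¹ = (u ^ 2 - 1) / u := by field_simp
  have h2 : w - w⁻¹ = (w ^ 2 - 1) / w := by field_simp
  have h3 : w ^ 2 - (w ^ 2)⁻¹ = (w ^ 2 - 1) * (w ^ 2 + 1) / w ^ 2 := by field_simp; ring
  rw [h1, h2, h3]
  field_simp
  ring

theorem coeff_identity_three_one (hu : u ≠ 0) (hw : w ≠ 0) (hQ : Q ≠ 0) (hu1 : u ^ 2 - 1 ≠ 0)
    (hw1 : w ^ 2 - 1 ≠ 0) (hw2 : w ^ 2 + 1 ≠ 0) (hw3 : w ^ 4 + w ^ 2 + 1 ≠ 0) :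
    (w ^ 3)⁻¹ / ((w - w⁻¹) * (w ^ 2 - (w ^ 2)⁻¹) * (w ^ 3 - (w ^ 3)⁻¹)) * (1 / (u - u⁻¹)) * Q ^ 3 =
      (w ^ 3)⁻¹ / ((w - w⁻¹) * (w ^ 2 - (w ^ 2)⁻¹) * (w ^ 3 - (w ^ 3)⁻¹)) * (1 / (u - u⁻¹)) *
        (Q ^ 3)⁻¹ +
      w⁻¹ / ((w - w⁻¹) * (w ^ 2 - (w ^ 2)⁻¹)) * (Q ^ 2)⁻¹ *
        ((Q - Q⁻¹) / ((u - u⁻¹) * (w - w⁻¹))) +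
      1 / (w - w⁻¹) * Q⁻¹ *
        ((Q - Q⁻¹) * (Q / w - w / Q) / ((w - w⁻¹) * (w ^ 2 - (w ^ 2)⁻¹) * (u - u⁻¹))) +
      (Q - Q⁻¹) * (Q / w - w / Q) * (Q / w ^ 2 - w ^ 2 / Q) /
        ((w - w⁻¹) * (w ^ 2 - (w ^ 2)⁻¹) * (w ^ 3 - (w ^ 3)⁻¹) * (u - u⁻¹)) := by
  have h1 : u - u⁻¹ = (u ^ 2 - 1) / u := by field_simp
  have h2 : w - w⁻¹ = (w ^ 2 - 1) / w := by field_simp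
  have h3 : w ^ 2 - (w ^ 2)⁻¹ = (w ^ 2 - 1) * (w ^ 2 + 1) / w ^ 2 := by field_simp; ring
  -- The factor $w^4+w^2+1$ is named so that it cancels as a whole when denominators are cleared;
  -- its value is needed only in the final polynomial identity.
  obtain ⟨p, hp⟩ : ∃ p, p = w ^ 4 + w ^ 2 + 1 := ⟨_, rfl⟩
  have h4 : w ^ 3 - (w ^ 3)⁻¹ = (w ^ 2 - 1) * p / w ^ 3 := by rw [hp]; field_simp; ring
  rw [← hp] at hw3
  rw [h1, h2, h3, h4]
  field_simp
  rw [hp]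
  ring

/-- At $(2,2)$ two factors contribute directly: the one on $(2,2)$, and the one on $(1,1)$ through
its second coefficient, which is the difference of two halves. The other summands combine lower
vectors with the two dilogarithms at the ends. -/
theorem coeff_identity_two_two [CharZero F] (hu : u ≠ 0) (hw : w ≠ 0) (hQ : Q ≠ 0)
    (hu1 : u ^ 2 - 1 ≠ 0) (hu2 : u ^ 2 + 1 ≠ 0) (hw1 : w ^ 2 - 1 ≠ 0) (hw2 : w ^ 2 + 1 ≠ 0) :
    w⁻¹ / ((w - w⁻¹) * (w ^ 2 - (w ^ 2)⁻¹)) * (u⁻¹ / ((u - u⁻¹) * (u ^ 2 - (u ^ 2)⁻¹))) * Q ^ 4 =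
      w⁻¹ / ((w - w⁻¹) * (w ^ 2 - (w ^ 2)⁻¹)) * (u⁻¹ / ((u - u⁻¹) * (u ^ 2 - (u ^ 2)⁻¹))) *
        (Q ^ 4)⁻¹ +
      1 / (w - w⁻¹) * (Q ^ 2)⁻¹ *
        ((Q - Q⁻¹) * (Q / u - u / Q) / ((u - u⁻¹) * (u ^ 2 - (u ^ 2)⁻¹) * (w - w⁻¹)) +
          (Q - Q⁻¹) / ((u - u⁻¹) * (w - w⁻¹)) * (1 / (u - u⁻¹)) * Q⁻¹) +
      ((Q ^ 2 - (Q ^ 2)⁻¹) * (Q / u - u / Q) * (Q / w - w / Q) /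
        ((u - u⁻¹) * (u ^ 2 - (u ^ 2)⁻¹) * (w - w⁻¹) * (w ^ 2 - (w ^ 2)⁻¹)) +
        ((Q - Q⁻¹) / ((u - u⁻¹) * (w - w⁻¹))) ^ 2 / 2 -
        (Q ^ 2 - (Q ^ 2)⁻¹) / ((u ^ 2 - (u ^ 2)⁻¹) * (w ^ 2 - (w ^ 2)⁻¹)) / 2) +
      (Q - Q⁻¹) * (Q / w - w / Q) / ((w - w⁻¹) * (w ^ 2 - (w ^ 2)⁻¹) * (u - u⁻¹)) *
        (1 / (u - u⁻¹)) * (Q ^ 2)⁻¹ := by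
  have h1 : u - u⁻¹ = (u ^ 2 - 1) / u := by field_simp
  have h2 : w - w⁻¹ = (w ^ 2 - 1) / w := by field_simp
  have h3 : w ^ 2 - (w ^ 2)⁻¹ = (w ^ 2 - 1) * (w ^ 2 + 1) / w ^ 2 := by field_simp; ring
  have h4 : u ^ 2 - (u ^ 2)⁻¹ = (u ^ 2 - 1) * (u ^ 2 + 1) / u ^ 2 := by field_simp; ring
  rw [h1, h2, h3, h4]
  field_simp
  ring

/-- The coefficients of the `q`-exponential. -/
theorem qexp_coeff_two [CharZero F] (hw : w ≠ 0) (hw1 : w ^ 2 - 1 ≠ 0) (hw2 : w ^ 2 + 1 ≠ 0) :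
    (1 / (w - w⁻¹)) ^ 2 / 2 - 1 / (w ^ 2 - (w ^ 2)⁻¹) / 2 =
      w⁻¹ / ((w - w⁻¹) * (w ^ 2 - (w ^ 2)⁻¹)) := by
  have h2 : w - w⁻¹ = (w ^ 2 - 1) / w := by field_simp
  have h3 : w ^ 2 - (w ^ 2)⁻¹ = (w ^ 2 - 1) * (w ^ 2 + 1) / w ^ 2 := by field_simp; ring
  rw [h2, h3]
  field_simp
  ring

theorem qexp_coeff_three [CharZero F] (hw : w ≠ 0) (hw1 : w ^ 2 - 1 ≠ 0) (hw2 : w ^ 2 + 1 ≠ 0)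
    (hw3 : w ^ 4 + w ^ 2 + 1 ≠ 0) :
    1 / (w ^ 3 - (w ^ 3)⁻¹) / 3 - 1 / ((w - w⁻¹) * (w ^ 2 - (w ^ 2)⁻¹)) / 2 +
      1 / (w - w⁻¹) ^ 3 / 6 =
      (w ^ 3)⁻¹ / ((w - w⁻¹) * (w ^ 2 - (w ^ 2)⁻¹) * (w ^ 3 - (w ^ 3)⁻¹)) := by
  have h2 : w - w⁻¹ = (w ^ 2 - 1) / w := by field_simp
  have h3 : w ^ 2 - (w ^ 2)⁻¹ = (w ^ 2 - 1) * (w ^ 2 + 1) / w ^ 2 := by field_simp; ring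
  obtain ⟨p, hp⟩ : ∃ p, p = w ^ 4 + w ^ 2 + 1 := ⟨_, rfl⟩
  have h4 : w ^ 3 - (w ^ 3)⁻¹ = (w ^ 2 - 1) * p / w ^ 3 := by rw [hp]; field_simp; ring
  rw [← hp] at hw3
  rw [h2, h3, h4]
  field_simp
  rw [hp]
  ring

end Identities
end QCSD

/-! ### Products of dilogarithms and products over several rays in low degree. -/

namespace QCSD
namespace FixedData
noncomputable section
variable {Γ : FixedData}

namespace Torus

/-- Every value of the form on integral vectors is an integral multiple of $\omega$, so only powers
of the single monomial $X^M=q^\omega$ arise. -/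
theorem coeff_mul_pair {M : ℤ} (hM : (Γ.δ₀ : ℚ) * Γ.ω = M) (f g : Γ.Torus) (a b : ℕ) :
    (f * g).coeff (a, b) = ∑ i ∈ Finset.range (a + 1), ∑ j ∈ Finset.range (b + 1),
      (RatFunc.X ^ M : K) ^ (((b - j : ℕ) : ℤ) * i - ((a - i : ℕ) : ℤ) * j) *
        (f.coeff (a - i, b - j) * g.coeff (i, j)) := by
  rw [coeff_mul, ← Finset.sum_product']
  symm
  refine Finset.sum_nbij' (fun p => ((a - p.1, b - p.2), p)) Prod.snd ?_ ?_ (fun _ _ => rfl) ?_ ?_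
  · rintro ⟨i, j⟩ h
    simp only [Finset.mem_product, Finset.mem_range] at h
    simp only [mem_splits, Prod.mk_add_mk, Prod.mk.injEq]
    omega
  · rintro ⟨⟨c, d⟩, i, j⟩ h
    simp only [mem_splits, Prod.mk_add_mk, Prod.mk.injEq] at h
    simp only [Finset.mem_product, Finset.mem_range]
    omega
  · rintro ⟨⟨c, d⟩, i, j⟩ h
    simp only [mem_splits, Prod.mk_add_mk, Prod.mk.injEq] at h
    simp only [Prod.mk.injEq, and_true]
    omega
  · rintro ⟨i, j⟩ _
    simp only
    rw [← zpow_mul, Γ.qpow_of_eq (z := M * (((b - j : ℕ) : ℤ) * i - ((a - i : ℕ) : ℤ) * j))]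
    rw [form, ← mul_assoc, hM]
    push_cast
    ring

theorem Ray.list_prod {n : ℕ × ℕ} {l : List Γ.Torus} (h : ∀ f ∈ l, Ray n f) : Ray n l.prod := by
  induction l with
  | nil => exact ray_one n
  | cons f l ih =>
    rw [List.prod_cons]
    exact (h f (by simp)).mul (ih fun g hg => h g (by simp [hg]))

theorem Ray.coeff_eq_zero {n m : ℕ × ℕ} {f : Γ.Torus} (hf : Ray n f)
    (h : m.1 * n.2 ≠ m.2 * n.1) : f.coeff m = 0 := by
  by_contra hne
  obtain ⟨j, rfl⟩ := hf m hne
  apply h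
  simp only [Prod.smul_fst, Prod.smul_snd, smul_eq_mul]
  ring

theorem ray_prod_dilog (n : ℕ × ℕ) (A : ℤ) (l : List ℤ) :
    Ray n (l.map fun B => (dilog A B n : Γ.Torus)).prod := by
  refine Ray.list_prod fun f hf => ?_
  obtain ⟨B, -, rfl⟩ := List.mem_map.1 hf
  exact ray_dilog A B n

theorem coeff_zero_prod_dilog (n : ℕ × ℕ) (A : ℤ) (l : List ℤ) :
    (l.map fun B => (dilog A B n : Γ.Torus)).prod.coeff 0 = 1 := by
  refine coeff_zero_list_prod fun f hf => ?_
  obtain ⟨B, -, rfl⟩ := List.mem_map.1 hf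
  exact coeff_zero_dilog A B n

theorem coeff_prod_dilog_one {n : ℕ × ℕ} (hn : n ≠ 0) (A : ℤ) (l : List ℤ) :
    (l.map fun B => (dilog A B n : Γ.Torus)).prod.coeff n =
      (l.map fun z => (RatFunc.X : K) ^ z).sum / qdiff RatFunc.X A := by
  induction l with
  | nil => simp [coeff_one, hn]
  | cons B l ih =>
    have h := (ray_dilog (Γ := Γ) A B n).coeff_mul hn (ray_prod_dilog n A l) 1
    simp only [Finset.Nat.antidiagonal_succ, Finset.Nat.antidiagonal_zero, Finset.map_singleton,
      Finset.sum_cons, Finset.sum_singleton] at h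
    simp only [one_smul, zero_smul, coeff_zero_dilog, coeff_zero_prod_dilog, zero_add, one_mul,
      mul_one, Function.Embedding.prodMap, Function.Embedding.coeFn_mk, Prod.map,
      Nat.succ_eq_add_one, Function.Embedding.refl_apply, ih, coeff_dilog_one hn] at h
    rw [List.map_cons, List.prod_cons, h, List.map_cons, List.sum_cons, add_div, add_comm]

/-- Exponents add along a ray, so the coefficients of the logarithm are power sums of the monomials
$X^B$. The second coefficient of the product thus depends only on the first two power sums. -/
theorem coeff_prod_dilog_two {n : ℕ × ℕ} (hn : n ≠ 0) (A : ℤ) (l : List ℤ) :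
    (l.map fun B => (dilog A B n : Γ.Torus)).prod.coeff (2 • n) =
      ((l.map fun z => (RatFunc.X : K) ^ z).sum / qdiff RatFunc.X A) ^ 2 / 2 -
      (l.map fun z => (RatFunc.X : K) ^ (2 * z)).sum / qdiff RatFunc.X (2 * A) / 2 := by
  induction l with
  | nil =>
    have : 2 • n ≠ 0 := fun h => hn ((smul_eq_zero.1 h).resolve_left two_ne_zero)
    rw [List.map_nil, List.prod_nil, coeff_one, if_neg this]
    simp
  | cons B l ih =>
    have h := (ray_dilog (Γ := Γ) A B n).coeff_mul hn (ray_prod_dilog n A l) 2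
    simp only [Finset.Nat.antidiagonal_succ, Finset.Nat.antidiagonal_zero, Finset.map_singleton,
      Finset.sum_cons, Finset.sum_singleton, Finset.map_cons] at h
    simp only [one_smul, zero_smul, coeff_zero_dilog, coeff_zero_prod_dilog, zero_add, one_mul,
      mul_one, Function.Embedding.prodMap, Function.Embedding.coeFn_mk, Prod.map,
      Nat.succ_eq_add_one, Function.Embedding.refl_apply, ih, coeff_dilog_one hn,
      coeff_prod_dilog_one hn, coeff_dilog_two hn, one_add_one_eq_two] at h
    rw [List.map_cons, List.prod_cons, h]
    simp only [List.map_cons, List.sum_cons]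
    ring

theorem van_mul_sub {p q d : ℕ} {f g : Γ.Torus} (hf : Van p (f - 1)) (hg : Van q (g - 1))
    (h : d ≤ p + q) : Van d (f * g - (f + g - 1)) := by
  have e : f * g - (f + g - 1) = (f - 1) * (g - 1) := by noncomm_ring
  rw [e]
  exact (hf.mul hg).mono h

theorem Ray.van_sub_one {n : ℕ × ℕ} {f : Γ.Torus} (hf : Ray n f) (h0 : f.coeff 0 = 1) :
    Van (deg n) (f - 1) := by
  intro m hm
  rw [coeff_sub, coeff_one]
  split_ifs with h
  · rw [h, h0, sub_self]
  · rw [sub_zero]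
    by_contra hne
    obtain ⟨j, rfl⟩ := hf m hne
    have hj : 1 ≤ j := Nat.one_le_iff_ne_zero.2 fun hj => h (by rw [hj, zero_smul])
    have : deg (j • n) = j * deg n := by
      simp only [deg, Prod.smul_fst, Prod.smul_snd, smul_eq_mul]; ring
    rw [this] at hm
    nlinarith

theorem Van.coeff_eq {d : ℕ} {f g : Γ.Torus} (h : Van d (f - g)) {m : ℕ × ℕ} (hm : deg m < d) :
    f.coeff m = g.coeff m := sub_eq_zero.1 (h m hm)

/-- The low degree coefficients of a product of series on the rays of `(3,1)`, `(2,1)`, `(1,1)`,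
`(1,2)` and `(1,3)`. -/
theorem coeff_prod_five {f₃₁ f₂₁ f₁₁ f₁₂ f₁₃ : Γ.Torus} (h₃₁ : Ray (3, 1) f₃₁)
    (h₂₁ : Ray (2, 1) f₂₁) (h₁₁ : Ray (1, 1) f₁₁) (h₁₂ : Ray (1, 2) f₁₂) (h₁₃ : Ray (1, 3) f₁₃)
    (z₃₁ : f₃₁.coeff 0 = 1) (z₂₁ : f₂₁.coeff 0 = 1) (z₁₁ : f₁₁.coeff 0 = 1)
    (z₁₂ : f₁₂.coeff 0 = 1) (z₁₃ : f₁₃.coeff 0 = 1) {m : ℕ × ℕ} (hm : deg m < 5) (h0 : m ≠ 0) :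
    (f₃₁ * (f₂₁ * (f₁₁ * (f₁₂ * f₁₃)))).coeff m = f₃₁.coeff m + f₂₁.coeff m + f₁₁.coeff m +
      f₁₂.coeff m + f₁₃.coeff m := by
  have v₃₁ := h₃₁.van_sub_one z₃₁
  have v₂₁ := h₂₁.van_sub_one z₂₁
  have v₁₁ := h₁₁.van_sub_one z₁₁
  have v₁₂ := h₁₂.van_sub_one z₁₂
  have v₁₃ := h₁₃.van_sub_one z₁₃
  simp only [deg] at v₃₁ v₂₁ v₁₁ v₁₂ v₁₃
  have step : ∀ {p q r : ℕ} {f g : Γ.Torus}, Van p (f - 1) → Van q (g - 1) → r ≤ p → r ≤ q →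
      Van r (f * g - 1) := by
    intro p q r f g hf hg hp hq
    have e : f * g - 1 = (f - 1) * g + (g - 1) := by noncomm_ring
    rw [e]
    exact ((hf.mul (van_any g)).mono hp).add (hg.mono hq)
  have w₁ := step (r := 3) v₁₂ v₁₃ (by norm_num) (by norm_num)
  have w₂ := step (r := 2) v₁₁ w₁ (by norm_num) (by norm_num)
  have w₃ := step (r := 2) v₂₁ w₂ (by norm_num) (by norm_num)
  -- The vectors have degree two or three or more, and only $(1,1)$ has degree two. A cross term of
  -- two factors therefore starts in degree at least $2+3=5$, and below that degree the product is
  -- additive.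
  have c₁ := (van_mul_sub (d := 5) v₁₂ v₁₃ (by norm_num)).coeff_eq hm
  have c₂ := (van_mul_sub (d := 5) v₁₁ w₁ (by norm_num)).coeff_eq hm
  have c₃ := (van_mul_sub (d := 5) v₂₁ w₂ (by norm_num)).coeff_eq hm
  have c₄ := (van_mul_sub (d := 5) v₃₁ w₃ (by norm_num)).coeff_eq hm
  simp only [coeff_sub, coeff_add, coeff_one, if_neg h0, sub_zero] at c₁ c₂ c₃ c₄
  rw [c₄, c₃, c₂, c₁]
  ring

end Torus
end
end FixedData
end QCSD

/-! ### The ordered factorization for $\delta_1\mid\delta_2$ and positive form. -/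

namespace QCSD

/-- The primitive vectors of `N⁺` of degree at most four, ordered by slope. -/
def slopes : List (ℕ × ℕ) := [(1, 0), (3, 1), (2, 1), (1, 1), (1, 2), (1, 3), (0, 1)]

namespace FixedData
noncomputable section
variable {Γ : FixedData}

/-- The quotient `δ₀ / δ(n)` for `δ₁ = 1`, `δ₂ = r`. -/
def level (r : ℕ) (n : ℕ × ℕ) : ℕ := Nat.gcd (r * n.1) n.2

namespace Torus

theorem coeff_mul_vertical {M : ℤ} (hM : (Γ.δ₀ : ℚ) * Γ.ω = M) (f : Γ.Torus) {β : Γ.Torus}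
    (rβ : Ray (0, 1) β) (a b : ℕ) : (f * β).coeff (a, b) = ∑ j ∈ Finset.range (b + 1),
      (RatFunc.X ^ M : K) ^ (-((a : ℤ) * j)) * (f.coeff (a, b - j) * β.coeff (0, j)) := by
  rw [coeff_mul_pair hM, Finset.sum_eq_single 0]
  · simp
  · intro i _ hi
    refine Finset.sum_eq_zero fun j _ => ?_
    rw [rβ.coeff_eq_zero (m := (i, j)) (by simpa using hi), mul_zero, mul_zero]
  · simp

theorem coeff_horizontal_mul {M : ℤ} (hM : (Γ.δ₀ : ℚ) * Γ.ω = M) {α : Γ.Torus}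
    (rα : Ray (1, 0) α) (f : Γ.Torus) (a b : ℕ) : (α * f).coeff (a, b) =
      ∑ i ∈ Finset.range (a + 1), (RatFunc.X ^ M : K) ^ (-(((a - i : ℕ) : ℤ) * b)) *
        (α.coeff (a - i, 0) * f.coeff (i, b)) := by
  rw [coeff_mul_pair hM]
  refine Finset.sum_congr rfl fun i _ => ?_
  rw [Finset.sum_eq_single b]
  · simp
  · intro j hj hjb
    rw [Finset.mem_range] at hj
    rw [rα.coeff_eq_zero (m := (a - i, b - j)) (by simp; omega), zero_mul, mul_zero]
  · simp

theorem coeff_vertical_mul_horizontal {M : ℤ} (hM : (Γ.δ₀ : ℚ) * Γ.ω = M) {α β : Γ.Torus}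
    (rα : Ray (1, 0) α) (rβ : Ray (0, 1) β) (a b : ℕ) : (β * α).coeff (a, b) =
      (RatFunc.X ^ M : K) ^ ((b : ℤ) * a) * (β.coeff (0, b) * α.coeff (a, 0)) := by
  rw [coeff_mul_pair hM, Finset.sum_eq_single a, Finset.sum_eq_single 0]
  · simp
  · intro j _ hj
    rw [rα.coeff_eq_zero (m := (a, j)) (by simpa [eq_comm] using hj), mul_zero, mul_zero]
  · simp
  · intro i hi hia
    rw [Finset.mem_range] at hi
    refine Finset.sum_eq_zero fun j _ => ?_
    rw [rβ.coeff_eq_zero (m := (a - i, b - j)) (by simp; omega), zero_mul, mul_zero]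
  · simp

end Torus

/-- The hypotheses on the $f$'s fix precisely those coefficients that comparison forces. Since the
interior product is additive below degree five, each coefficient of the ordered product is a short
sum over what the outer factors $\alpha$ and $\beta$ contribute. The identities for $(1,2)$ and
$(1,3)$ are those for $(2,1)$ and $(3,1)$ with $u$ and $w$ exchanged. -/
theorem van_ordered_product {M : ℤ} (hM : (Γ.δ₀ : ℚ) * Γ.ω = M) {u w Q : K}
    (hQ : Q = RatFunc.X ^ M) (hu : u ≠ 0) (hw : w ≠ 0)
    (hu1 : u ^ 2 - 1 ≠ 0) (hu2 : u ^ 2 + 1 ≠ 0) (hu3 : u ^ 4 + u ^ 2 + 1 ≠ 0)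
    (hw1 : w ^ 2 - 1 ≠ 0) (hw2 : w ^ 2 + 1 ≠ 0) (hw3 : w ^ 4 + w ^ 2 + 1 ≠ 0)
    {α β f₃₁ f₂₁ f₁₁ f₂₂ f₁₂ f₁₃ : Γ.Torus}
    (rα : Torus.Ray (1, 0) α) (rβ : Torus.Ray (0, 1) β)
    (r₃₁ : Torus.Ray (3, 1) f₃₁) (r₂₁ : Torus.Ray (2, 1) f₂₁) (r₁₁ : Torus.Ray (1, 1) f₁₁)
    (r₂₂ : Torus.Ray (2, 2) f₂₂) (r₁₂ : Torus.Ray (1, 2) f₁₂) (r₁₃ : Torus.Ray (1, 3) f₁₃)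
    (zα : α.coeff 0 = 1) (zβ : β.coeff 0 = 1) (z₃₁ : f₃₁.coeff 0 = 1) (z₂₁ : f₂₁.coeff 0 = 1)
    (z₁₁ : f₁₁.coeff 0 = 1) (z₂₂ : f₂₂.coeff 0 = 1) (z₁₂ : f₁₂.coeff 0 = 1)
    (z₁₃ : f₁₃.coeff 0 = 1)
    (α₁ : α.coeff (1, 0) = 1 / (w - w⁻¹))
    (α₂ : α.coeff (2, 0) = w⁻¹ / ((w - w⁻¹) * (w ^ 2 - (w ^ 2)⁻¹)))
    (α₃ : α.coeff (3, 0) = (w ^ 3)⁻¹ / ((w - w⁻¹) * (w ^ 2 - (w ^ 2)⁻¹) * (w ^ 3 - (w ^ 3)⁻¹)))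
    (β₁ : β.coeff (0, 1) = 1 / (u - u⁻¹))
    (β₂ : β.coeff (0, 2) = u⁻¹ / ((u - u⁻¹) * (u ^ 2 - (u ^ 2)⁻¹)))
    (β₃ : β.coeff (0, 3) = (u ^ 3)⁻¹ / ((u - u⁻¹) * (u ^ 2 - (u ^ 2)⁻¹) * (u ^ 3 - (u ^ 3)⁻¹)))
    (c₁₁ : f₁₁.coeff (1, 1) = (Q - Q⁻¹) / ((u - u⁻¹) * (w - w⁻¹)))
    (c₁₁' : f₁₁.coeff (2, 2) = ((Q - Q⁻¹) / ((u - u⁻¹) * (w - w⁻¹))) ^ 2 / 2 -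
      (Q ^ 2 - (Q ^ 2)⁻¹) / ((u ^ 2 - (u ^ 2)⁻¹) * (w ^ 2 - (w ^ 2)⁻¹)) / 2)
    (c₂₂ : f₂₂.coeff (2, 2) = (Q ^ 2 - (Q ^ 2)⁻¹) * (Q / u - u / Q) * (Q / w - w / Q) /
      ((u - u⁻¹) * (u ^ 2 - (u ^ 2)⁻¹) * (w - w⁻¹) * (w ^ 2 - (w ^ 2)⁻¹)))
    (c₁₂ : f₁₂.coeff (1, 2) = (Q - Q⁻¹) * (Q / u - u / Q) /
      ((u - u⁻¹) * (u ^ 2 - (u ^ 2)⁻¹) * (w - w⁻¹)))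
    (c₁₃ : f₁₃.coeff (1, 3) = (Q - Q⁻¹) * (Q / u - u / Q) * (Q / u ^ 2 - u ^ 2 / Q) /
      ((u - u⁻¹) * (u ^ 2 - (u ^ 2)⁻¹) * (u ^ 3 - (u ^ 3)⁻¹) * (w - w⁻¹)))
    (c₂₁ : f₂₁.coeff (2, 1) = (Q - Q⁻¹) * (Q / w - w / Q) /
      ((w - w⁻¹) * (w ^ 2 - (w ^ 2)⁻¹) * (u - u⁻¹)))
    (c₃₁ : f₃₁.coeff (3, 1) = (Q - Q⁻¹) * (Q / w - w / Q) * (Q / w ^ 2 - w ^ 2 / Q) /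
      ((w - w⁻¹) * (w ^ 2 - (w ^ 2)⁻¹) * (w ^ 3 - (w ^ 3)⁻¹) * (u - u⁻¹))) :
    Torus.Van 5 (β * α - α * ((f₃₁ * (f₂₁ * ((f₁₁ * f₂₂) * (f₁₂ * f₁₃)))) * β)) := by
  have hQ0 : Q ≠ 0 := hQ ▸ zpow_ne_zero _ RatFunc.X_ne_zero
  -- Regarded on the ray of $(1,1)$, this factor merges with $f_{11}$, and the interior becomes a
  -- product over five distinct rays.
  have r₂₂' : Torus.Ray (1, 1) f₂₂ := by
    intro m hm
    obtain ⟨j, rfl⟩ := r₂₂ m hm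
    exact ⟨j * 2, by simp⟩
  have z : (f₁₁ * f₂₂).coeff 0 = 1 := by rw [Torus.coeff_zero_mul, z₁₁, z₂₂, mul_one]
  have v₁₁ := r₁₁.van_sub_one z₁₁
  have v₂₂ := r₂₂.van_sub_one z₂₂
  simp only [deg] at v₁₁ v₂₂
  have hv := Torus.van_mul_sub (d := 5) v₁₁ v₂₂ (by norm_num)
  have hI : ∀ a b, a + b < 5 → 0 < a + b →
      (f₃₁ * (f₂₁ * ((f₁₁ * f₂₂) * (f₁₂ * f₁₃)))).coeff (a, b) =
      f₃₁.coeff (a, b) + f₂₁.coeff (a, b) + (f₁₁.coeff (a, b) + f₂₂.coeff (a, b)) +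
      f₁₂.coeff (a, b) + f₁₃.coeff (a, b) := by
    intro a b h1 h2
    have h0 : (a, b) ≠ (0 : ℕ × ℕ) := by
      rw [Ne, Prod.mk_eq_zero]; omega
    rw [Torus.coeff_prod_five r₃₁ r₂₁ (r₁₁.mul r₂₂') r₁₂ r₁₃ z₃₁ z₂₁ z z₁₂ z₁₃
      (by simpa [deg] using h1) h0, hv.coeff_eq (by simpa [deg] using h1)]
    simp [Torus.coeff_sub, Torus.coeff_add, Torus.coeff_one, h0]
  have hI0 : (f₃₁ * (f₂₁ * ((f₁₁ * f₂₂) * (f₁₂ * f₁₃)))).coeff (0, 0) = 1 := by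
    change Torus.coeff 0 _ = 1
    simp only [Torus.coeff_zero_mul, z₃₁, z₂₁, z₁₁, z₂₂, z₁₂, z₁₃, mul_one]
  have n₂₂ : f₂₂.coeff (1, 1) = 0 := by
    by_contra hne
    obtain ⟨j, hj⟩ := r₂₂ _ hne
    simp only [Prod.smul_mk, smul_eq_mul, Prod.mk.injEq] at hj
    omega
  have oα : ∀ a b, 0 < b → α.coeff (a, b) = 0 := fun a b hb =>
    rα.coeff_eq_zero (by simp; omega)
  have oβ : ∀ a b, 0 < a → β.coeff (a, b) = 0 := fun a b ha =>
    rβ.coeff_eq_zero (by simp; omega)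
  have o₃₁ : ∀ a b, a ≠ b * 3 → f₃₁.coeff (a, b) = 0 := fun a b h =>
    r₃₁.coeff_eq_zero (by simpa using h)
  have o₂₁ : ∀ a b, a ≠ b * 2 → f₂₁.coeff (a, b) = 0 := fun a b h =>
    r₂₁.coeff_eq_zero (by simpa using h)
  have o₁₁ : ∀ a b, a ≠ b → f₁₁.coeff (a, b) = 0 := fun a b h =>
    r₁₁.coeff_eq_zero (by simpa using h)
  have o₂₂ : ∀ a b, a ≠ b → f₂₂.coeff (a, b) = 0 := fun a b h =>
    r₂₂'.coeff_eq_zero (by simpa using h)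
  have o₁₂ : ∀ a b, a * 2 ≠ b → f₁₂.coeff (a, b) = 0 := fun a b h =>
    r₁₂.coeff_eq_zero (by simpa using h)
  have o₁₃ : ∀ a b, a * 3 ≠ b → f₁₃.coeff (a, b) = 0 := fun a b h =>
    r₁₃.coeff_eq_zero (by simpa using h)
  have hα0 : α.coeff (0, 0) = 1 := zα
  have hβ0 : β.coeff (0, 0) = 1 := zβ
  generalize f₃₁ * (f₂₁ * ((f₁₁ * f₂₂) * (f₁₂ * f₁₃))) = I at *
  have i₁₁ : I.coeff (1, 1) = f₁₁.coeff (1, 1) := by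
    rw [hI _ _ (by norm_num) (by norm_num), o₃₁ _ _ (by norm_num), o₂₁ _ _ (by norm_num), n₂₂,
      o₁₂ _ _ (by norm_num), o₁₃ _ _ (by norm_num)]
    ring
  have i₂₁ : I.coeff (2, 1) = f₂₁.coeff (2, 1) := by
    rw [hI _ _ (by norm_num) (by norm_num), o₃₁ _ _ (by norm_num), o₁₁ _ _ (by norm_num),
      o₂₂ _ _ (by norm_num), o₁₂ _ _ (by norm_num), o₁₃ _ _ (by norm_num)]
    ring
  have i₃₁ : I.coeff (3, 1) = f₃₁.coeff (3, 1) := by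
    rw [hI _ _ (by norm_num) (by norm_num), o₂₁ _ _ (by norm_num), o₁₁ _ _ (by norm_num),
      o₂₂ _ _ (by norm_num), o₁₂ _ _ (by norm_num), o₁₃ _ _ (by norm_num)]
    ring
  have i₁₂ : I.coeff (1, 2) = f₁₂.coeff (1, 2) := by
    rw [hI _ _ (by norm_num) (by norm_num), o₃₁ _ _ (by norm_num), o₂₁ _ _ (by norm_num),
      o₁₁ _ _ (by norm_num), o₂₂ _ _ (by norm_num), o₁₃ _ _ (by norm_num)]
    ring
  have i₁₃ : I.coeff (1, 3) = f₁₃.coeff (1, 3) := by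
    rw [hI _ _ (by norm_num) (by norm_num), o₃₁ _ _ (by norm_num), o₂₁ _ _ (by norm_num),
      o₁₁ _ _ (by norm_num), o₂₂ _ _ (by norm_num), o₁₂ _ _ (by norm_num)]
    ring
  have i₂₂ : I.coeff (2, 2) = f₁₁.coeff (2, 2) + f₂₂.coeff (2, 2) := by
    rw [hI _ _ (by norm_num) (by norm_num), o₃₁ _ _ (by norm_num), o₂₁ _ _ (by norm_num),
      o₁₂ _ _ (by norm_num), o₁₃ _ _ (by norm_num)]
    ring
  have ia : ∀ a, 0 < a → a < 5 → I.coeff (a, 0) = 0 := by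
    intro a h1 h2
    rw [hI _ _ (by omega) (by omega), o₃₁ _ _ (by omega), o₂₁ _ _ (by omega),
      o₁₁ _ _ (by omega), o₂₂ _ _ (by omega), o₁₂ _ _ (by omega), o₁₃ _ _ (by omega)]
    ring
  have ib : ∀ b, 0 < b → b < 5 → I.coeff (0, b) = 0 := by
    intro a h1 h2
    rw [hI _ _ (by omega) (by omega), o₃₁ _ _ (by omega), o₂₁ _ _ (by omega),
      o₁₁ _ _ (by omega), o₂₂ _ _ (by omega), o₁₂ _ _ (by omega), o₁₃ _ _ (by omega)]
    ring
  rintro ⟨a, b⟩ hab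
  have hab : a + b < 5 := hab
  have ha : a < 5 := by omega
  have hb : b < 5 := by omega
  have e₁ := coeff_identity_one_one hu hw hQ0 hu1 hw1
  have e₂ := coeff_identity_two_one hu hw hQ0 hu1 hw1 hw2
  have e₃ := coeff_identity_two_one hw hu hQ0 hw1 hu1 hu2
  have e₄ := coeff_identity_three_one hu hw hQ0 hu1 hw1 hw2 hw3
  have e₅ := coeff_identity_three_one hw hu hQ0 hw1 hu1 hu2 hu3
  have e₆ := coeff_identity_two_two hu hw hQ0 hu1 hu2 hw1 hw2
  rw [Torus.coeff_sub, Torus.coeff_vertical_mul_horizontal hM rα rβ,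
    Torus.coeff_horizontal_mul hM rα]
  simp only [Torus.coeff_mul_vertical hM _ rβ, ← hQ]
  have p₁ : Q ^ (1 : ℤ) = Q := zpow_one Q
  have p₂ : Q ^ (2 : ℤ) = Q ^ 2 := by norm_cast
  have p₃ : Q ^ (3 : ℤ) = Q ^ 3 := by norm_cast
  have p₄ : Q ^ (2 * 2 : ℤ) = Q ^ 4 := by norm_cast
  -- On the axes both sides agree at once, because the interior product contributes nothing there.
  -- The six vectors left are $(1,1)$, $(1,2)$, $(1,3)$, $(2,1)$, $(2,2)$, $(3,1)$, in this order.
  interval_cases a <;> interval_cases b <;> (try omega) <;>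
    simp only [Finset.sum_range_succ, Finset.sum_range_zero, zero_add, tsub_zero, Nat.sub_self,
      Nat.reduceSub, hα0, hβ0, hI0, ia, ib, i₁₁, i₂₁, i₃₁, i₁₂, i₁₃, i₂₂, Nat.one_pos, Nat.ofNat_pos,
      Nat.reduceLT, mul_zero, zero_mul, add_zero, mul_one, one_mul, Nat.cast_zero, Nat.cast_one,
      Nat.cast_ofNat, neg_zero, zpow_zero, sub_self]
  · rw [zpow_neg, p₁, α₁, β₁, c₁₁]
    linear_combination e₁
  · rw [zpow_neg, zpow_neg, p₁, p₂, α₁, β₁, β₂, c₁₁, c₁₂]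
    linear_combination e₃
  · rw [zpow_neg, zpow_neg, zpow_neg, p₁, p₂, p₃, α₁, β₁, β₂, β₃, c₁₁, c₁₂, c₁₃]
    linear_combination e₅
  · rw [zpow_neg, zpow_neg, p₁, p₂, α₁, α₂, β₁, c₁₁, c₂₁]
    linear_combination e₂
  · rw [zpow_neg, zpow_neg, zpow_neg, p₁, p₂, p₄, α₁, α₂, β₁, β₂, c₁₁, c₁₁', c₂₂, c₁₂, c₂₁]
    linear_combination e₆
  · rw [zpow_neg, zpow_neg, zpow_neg, p₁, p₂, p₃, α₁, α₂, α₃, β₁, c₁₁, c₂₁, c₃₁]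
    linear_combination e₄
theorem exists_sum_eq {f : K} (h : f ∈ Pos) :
    ∃ l : List ℤ, (l.map fun z => (RatFunc.X : K) ^ z).sum = f := h

theorem X_pow_sub_one_ne {k : ℕ} (hk : 0 < k) : (RatFunc.X : K) ^ k - 1 ≠ 0 :=
  sub_ne_zero.2 (X_pow_ne_one hk)

theorem pow_two_add_one_ne {w : K} (h : w ^ 4 - 1 ≠ 0) : w ^ 2 + 1 ≠ 0 := fun h' =>
  h (by linear_combination (w ^ 2 - 1) * h')

theorem pow_four_add_ne {w : K} (h : w ^ 6 - 1 ≠ 0) : w ^ 4 + w ^ 2 + 1 ≠ 0 := fun h' =>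
  h (by linear_combination (w ^ 2 - 1) * h')

/-- The exponents are $r(N-1-2i)$, those of the quantum integer $[N]$ in $w=X^r$. The second power
sum is again a quantum integer, in $w^2$; it is needed because the factors on $(1,1)$ also
contribute at $(2,2)$. -/
theorem exists_sum_eq_qdiff (r N : ℕ) (hr : 0 < r) : ∃ l : List ℤ,
    (l.map fun z => (RatFunc.X : K) ^ z).sum = qdiff RatFunc.X (N * r) / qdiff RatFunc.X r ∧
    (l.map fun z => (RatFunc.X : K) ^ (2 * z)).sum =
      qdiff RatFunc.X (2 * (N * r)) / qdiff RatFunc.X (2 * r) := by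
  have key : ∀ s : ℕ, 0 < s → (((List.range N).map fun i : ℕ => (r : ℤ) * ((N : ℤ) - 1 - 2 * i)).map
      fun z : ℤ => (RatFunc.X : K) ^ ((s : ℤ) * z)).sum =
      qdiff RatFunc.X (s * (N * r)) / qdiff RatFunc.X (s * r) := by
    intro s hs
    have hsr : (s * r : ℤ) ≠ 0 := by positivity
    have h := sum_zpow_mul_qdiff (mono_X_zpow hsr).ne N
    rw [qdiff_zpow, qdiff_zpow, mul_one] at h
    rw [eq_div_iff (qdiff_X_ne_zero hsr)]
    have e : (s : ℤ) * (N * r) = s * r * N := by ring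
    rw [e, ← h, List.map_map, ← List.sum_toFinset _ List.nodup_range, List.toFinset_range]
    congr 1
    refine Finset.sum_congr rfl fun i _ => ?_
    rw [← zpow_mul, Function.comp_apply]
    congr 1
    ring
  refine ⟨_, ?_, key 2 two_pos⟩
  simpa using key 1 one_pos

/-- The ordered factorization of `Ψ[e₂]Ψ[e₁]` up to degree four. -/
theorem exists_ordered_factorization {r N : ℕ} (hr : 0 < r) (hN : 0 < N)
    (hM : (Γ.δ₀ : ℚ) * Γ.ω = ((N * r : ℤ) : ℤ)) :
    ∃ g : ℕ × ℕ → List ((ℕ × ℕ) × ℤ),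
      (∀ n ∈ slopes, ∀ x ∈ g n, ∃ k : ℕ, 1 ≤ k ∧ x.1 = k • n) ∧
      Torus.Van 5 ((Torus.dilog 1 0 (0, 1) * Torus.dilog r 0 (1, 0) : Γ.Torus) -
        (slopes.map fun n => ((g n).map fun x => Torus.dilog (level r x.1) x.2 x.1).prod).prod) := by
  have hr0 : (r : ℤ) ≠ 0 := by omega
  have mX : Mono (RatFunc.X : K) := by simpa using mono_X_zpow one_ne_zero
  have mW : Mono (RatFunc.X ^ (r : ℤ) : K) := mono_X_zpow hr0
  -- Each list collects the exponents $B$ of the factors on one vector $n$: its sum is the required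
  -- leading coefficient times the denominator `qdiff X (level r n)`. At $(2,1)$ and $(3,1)$ the
  -- level is $1$ and the sums are ordinary $q$-binomials in $X^r$.
  obtain ⟨l₁₁, h₁₁, h₁₁'⟩ := exists_sum_eq_qdiff r N hr
  obtain ⟨l₂₂, h₂₂⟩ := exists_sum_eq (mX.two_two_mem hr hN)
  obtain ⟨l₁₂, h₁₂⟩ := exists_sum_eq (mX.two_mem hr hN)
  obtain ⟨l₁₃, h₁₃⟩ := exists_sum_eq (mX.three_mem hr hN)
  obtain ⟨l₂₁, h₂₁⟩ := exists_sum_eq (mW.two_mem (r := 1) one_pos hN)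
  obtain ⟨l₃₁, h₃₁⟩ := exists_sum_eq (mW.three_mem (r := 1) one_pos hN)
  let g : ℕ × ℕ → List ((ℕ × ℕ) × ℤ) := fun n =>
    if n = (1, 0) then [((1, 0), 0)] else
    if n = (3, 1) then l₃₁.map fun B => ((3, 1), B) else
    if n = (2, 1) then l₂₁.map fun B => ((2, 1), B) else
    if n = (1, 1) then (l₁₁.map fun B => ((1, 1), B)) ++ l₂₂.map fun B => ((2, 2), B) else
    if n = (1, 2) then l₁₂.map fun B => ((1, 2), B) else
    if n = (1, 3) then l₁₃.map fun B => ((1, 3), B) else [((0, 1), 0)]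
  refine ⟨g, ?_, ?_⟩
  · intro n hn x hx
    simp only [slopes, List.mem_cons, List.not_mem_nil, or_false] at hn
    rcases hn with rfl | rfl | rfl | rfl | rfl | rfl | rfl
    · simp [g] at hx; exact ⟨1, le_rfl, by simp [hx]⟩
    · simp [g] at hx; obtain ⟨B, -, rfl⟩ := hx; exact ⟨1, le_rfl, rfl⟩
    · simp [g] at hx; obtain ⟨B, -, rfl⟩ := hx; exact ⟨1, le_rfl, rfl⟩
    · simp [g] at hx
      rcases hx with ⟨B, -, rfl⟩ | ⟨B, -, rfl⟩
      · exact ⟨1, le_rfl, rfl⟩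
      · exact ⟨2, one_le_two, rfl⟩
    · simp [g] at hx; obtain ⟨B, -, rfl⟩ := hx; exact ⟨1, le_rfl, rfl⟩
    · simp [g] at hx; obtain ⟨B, -, rfl⟩ := hx; exact ⟨1, le_rfl, rfl⟩
    · simp [g] at hx; exact ⟨1, le_rfl, by simp [hx]⟩
  · have e₃₁ : level r (3, 1) = 1 := by simp [level]
    have e₂₁ : level r (2, 1) = 1 := by simp [level]
    have e₁₁ : level r (1, 1) = 1 := by simp [level]
    have e₁₀ : level r (1, 0) = r := by simp [level]
    have e₀₁ : level r (0, 1) = 1 := by simp [level]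
    have e₂₂ : level r (2, 2) = 2 := by simp [level]
    have e₁₂ : level r (1, 2) = Nat.gcd r 2 := by simp [level]
    have e₁₃ : level r (1, 3) = Nat.gcd r 3 := by simp [level]
    have hprod : (slopes.map fun n => ((g n).map fun x =>
        (Torus.dilog (level r x.1) x.2 x.1 : Γ.Torus)).prod).prod =
        Torus.dilog r 0 (1, 0) * (((l₃₁.map fun B => Torus.dilog 1 B (3, 1)).prod *
        ((l₂₁.map fun B => Torus.dilog 1 B (2, 1)).prod *
        (((l₁₁.map fun B => Torus.dilog 1 B (1, 1)).prod *
          (l₂₂.map fun B => Torus.dilog 2 B (2, 2)).prod) *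
        ((l₁₂.map fun B => Torus.dilog (Nat.gcd r 2 : ℕ) B (1, 2)).prod *
        (l₁₃.map fun B => Torus.dilog (Nat.gcd r 3 : ℕ) B (1, 3)).prod)))) *
        Torus.dilog 1 0 (0, 1)) := by
      simp [slopes, g, Function.comp_def, e₃₁, e₂₁, e₁₁, e₁₀, e₀₁, e₂₂, e₁₂, e₁₃, mul_assoc]
    rw [hprod]
    obtain ⟨w, hw⟩ : ∃ w : K, w = RatFunc.X ^ (r : ℤ) := ⟨_, rfl⟩
    obtain ⟨Q, hQ⟩ : ∃ Q : K, Q = RatFunc.X ^ ((N * r : ℤ)) := ⟨_, rfl⟩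
    obtain ⟨u, hu⟩ : ∃ u : K, u = RatFunc.X := ⟨_, rfl⟩
    have hX0 : (RatFunc.X : K) ≠ 0 := RatFunc.X_ne_zero
    have hw0 : w ≠ 0 := hw ▸ zpow_ne_zero _ hX0
    have hQ0 : Q ≠ 0 := hQ ▸ zpow_ne_zero _ hX0
    have hu0 : u ≠ 0 := hu ▸ hX0
    have hpu : ∀ k : ℕ, 0 < k → u ^ k - 1 ≠ 0 := fun k hk => hu ▸ X_pow_sub_one_ne hk
    have hpw : ∀ k : ℕ, 0 < k → w ^ k - 1 ≠ 0 := fun k hk => by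
      rw [hw, zpow_natCast, ← pow_mul]
      exact X_pow_sub_one_ne (Nat.mul_pos hr hk)
    have q₁ : qdiff RatFunc.X 1 = u - u⁻¹ := by simp [qdiff, hu]
    have q₂ : qdiff RatFunc.X 2 = u ^ 2 - (u ^ 2)⁻¹ := by
      rw [qdiff, hu, zpow_neg]; norm_cast
    have q₃ : qdiff RatFunc.X 3 = u ^ 3 - (u ^ 3)⁻¹ := by
      rw [qdiff, hu, zpow_neg]; norm_cast
    have qr₁ : qdiff RatFunc.X r = w - w⁻¹ := by rw [qdiff, hw, zpow_neg]
    have qr₂ : qdiff RatFunc.X (2 * r) = w ^ 2 - (w ^ 2)⁻¹ := by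
      rw [qdiff, hw, zpow_neg, mul_comm, zpow_mul]; norm_cast
    have qr₃ : qdiff RatFunc.X (3 * r) = w ^ 3 - (w ^ 3)⁻¹ := by
      rw [qdiff, hw, zpow_neg, mul_comm, zpow_mul]; norm_cast
    have qw₁ : qdiff w 1 = w - w⁻¹ := by simp [qdiff]
    have qw₂ : qdiff w 2 = w ^ 2 - (w ^ 2)⁻¹ := by rw [qdiff, zpow_neg]; norm_cast
    have qw₃ : qdiff w 3 = w ^ 3 - (w ^ 3)⁻¹ := by rw [qdiff, zpow_neg]; norm_cast
    have hQw : w ^ (N : ℤ) = Q := by rw [hw, hQ, ← zpow_mul, mul_comm]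
    have Q₀ : qdiff RatFunc.X (N * r) = Q - Q⁻¹ := by rw [qdiff, hQ, zpow_neg]
    have Q₂ : qdiff RatFunc.X (2 * (N * r)) = Q ^ 2 - (Q ^ 2)⁻¹ := by
      rw [qdiff, hQ, zpow_neg, mul_comm 2, zpow_mul]; norm_cast
    have Qu₁ : qdiff RatFunc.X (N * r - 1) = Q / u - u / Q := by
      rw [qdiff, neg_sub, zpow_sub₀ hX0, zpow_sub₀ hX0, zpow_one, hQ, hu]
    have Qu₂ : qdiff RatFunc.X (N * r - 2) = Q / u ^ 2 - u ^ 2 / Q := by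
      rw [qdiff, neg_sub, zpow_sub₀ hX0, zpow_sub₀ hX0, hQ, hu]; norm_cast
    have Qr₁ : qdiff RatFunc.X (N * r - r) = Q / w - w / Q := by
      rw [qdiff, neg_sub, zpow_sub₀ hX0, zpow_sub₀ hX0, hQ, hw]
    have Qw₀ : qdiff w N = Q - Q⁻¹ := by rw [qdiff, zpow_neg, hQw]
    have Qw₁ : qdiff w (N - 1) = Q / w - w / Q := by
      rw [qdiff, neg_sub, zpow_sub₀ hw0, zpow_sub₀ hw0, zpow_one, hQw]
    have Qw₂ : qdiff w (N - 2) = Q / w ^ 2 - w ^ 2 / Q := by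
      rw [qdiff, neg_sub, zpow_sub₀ hw0, zpow_sub₀ hw0, hQw]; norm_cast
    have g₂ : qdiff RatFunc.X (Nat.gcd r 2 : ℕ) ≠ 0 :=
      qdiff_X_ne_zero (Int.natCast_ne_zero.2 (Nat.gcd_ne_zero_right two_ne_zero))
    have g₃ : qdiff RatFunc.X (Nat.gcd r 3 : ℕ) ≠ 0 :=
      qdiff_X_ne_zero (Int.natCast_ne_zero.2 (Nat.gcd_ne_zero_right three_ne_zero))
    rw [← hw] at h₂₁ h₃₁
    simp only [Nat.gcd_one_left, Nat.cast_one, mul_one, q₁, q₂, q₃, qr₁, qr₂, qw₁, qw₂, qw₃,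
      Q₀, Q₂, Qu₁, Qu₂, Qr₁, Qw₀, Qw₁, Qw₂] at h₁₁ h₁₁' h₂₂ h₁₂ h₁₃ h₂₁ h₃₁
    -- coefficients of the factors
    have c₁₁ := Torus.coeff_prod_dilog_one (Γ := Γ) (n := (1, 1)) (by simp) 1 l₁₁
    have c₁₁' := Torus.coeff_prod_dilog_two (Γ := Γ) (n := (1, 1)) (by simp) 1 l₁₁
    have c₂₂ := Torus.coeff_prod_dilog_one (Γ := Γ) (n := (2, 2)) (by simp) 2 l₂₂
    have c₁₂ := Torus.coeff_prod_dilog_one (Γ := Γ) (n := (1, 2)) (by simp) (Nat.gcd r 2 : ℕ) l₁₂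
    have c₁₃ := Torus.coeff_prod_dilog_one (Γ := Γ) (n := (1, 3)) (by simp) (Nat.gcd r 3 : ℕ) l₁₃
    have c₂₁ := Torus.coeff_prod_dilog_one (Γ := Γ) (n := (2, 1)) (by simp) 1 l₂₁
    have c₃₁ := Torus.coeff_prod_dilog_one (Γ := Γ) (n := (3, 1)) (by simp) 1 l₃₁
    rw [h₁₁, q₁] at c₁₁
    rw [h₁₁, h₁₁', q₁, mul_one, q₂] at c₁₁'
    rw [h₂₂, q₂] at c₂₂
    rw [h₁₂, mul_div_right_comm, mul_div_cancel_right₀ _ g₂] at c₁₂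
    rw [h₁₃, mul_div_right_comm, mul_div_cancel_right₀ _ g₃] at c₁₃
    rw [h₂₁, q₁] at c₂₁
    rw [h₃₁, q₁] at c₃₁
    have r₁₁ := Torus.ray_prod_dilog (Γ := Γ) (1, 1) 1 l₁₁
    have r₂₂ := Torus.ray_prod_dilog (Γ := Γ) (2, 2) 2 l₂₂
    have r₁₂ := Torus.ray_prod_dilog (Γ := Γ) (1, 2) (Nat.gcd r 2 : ℕ) l₁₂
    have r₁₃ := Torus.ray_prod_dilog (Γ := Γ) (1, 3) (Nat.gcd r 3 : ℕ) l₁₃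
    have r₂₁ := Torus.ray_prod_dilog (Γ := Γ) (2, 1) 1 l₂₁
    have r₃₁ := Torus.ray_prod_dilog (Γ := Γ) (3, 1) 1 l₃₁
    have z₁₁ := Torus.coeff_zero_prod_dilog (Γ := Γ) (1, 1) 1 l₁₁
    have z₂₂ := Torus.coeff_zero_prod_dilog (Γ := Γ) (2, 2) 2 l₂₂
    have z₁₂ := Torus.coeff_zero_prod_dilog (Γ := Γ) (1, 2) (Nat.gcd r 2 : ℕ) l₁₂
    have z₁₃ := Torus.coeff_zero_prod_dilog (Γ := Γ) (1, 3) (Nat.gcd r 3 : ℕ) l₁₃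
    have z₂₁ := Torus.coeff_zero_prod_dilog (Γ := Γ) (2, 1) 1 l₂₁
    have z₃₁ := Torus.coeff_zero_prod_dilog (Γ := Γ) (3, 1) 1 l₃₁
    have sα₂ : (Torus.dilog r 0 (1, 0) : Γ.Torus).coeff (2, 0) =
        w⁻¹ / ((w - w⁻¹) * (w ^ 2 - (w ^ 2)⁻¹)) := by
      have h := Torus.coeff_dilog_two (Γ := Γ) (n := (1, 0)) (by simp) r 0
      rw [mul_zero, zpow_zero, qr₁, qr₂,
        qexp_coeff_two hw0 (hpw 2 two_pos) (pow_two_add_one_ne (hpw 4 four_pos))] at h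
      exact h
    have sβ₂ : (Torus.dilog 1 0 (0, 1) : Γ.Torus).coeff (0, 2) =
        u⁻¹ / ((u - u⁻¹) * (u ^ 2 - (u ^ 2)⁻¹)) := by
      have h := Torus.coeff_dilog_two (Γ := Γ) (n := (0, 1)) (by simp) 1 0
      rw [mul_zero, zpow_zero, mul_one, q₁, q₂,
        qexp_coeff_two hu0 (hpu 2 two_pos) (pow_two_add_one_ne (hpu 4 four_pos))] at h
      exact h
    have sα₃ : (Torus.dilog r 0 (1, 0) : Γ.Torus).coeff (3, 0) =
        (w ^ 3)⁻¹ / ((w - w⁻¹) * (w ^ 2 - (w ^ 2)⁻¹) * (w ^ 3 - (w ^ 3)⁻¹)) := by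
      have h := Torus.coeff_dilog_three (Γ := Γ) (n := (1, 0)) (by simp) r
      rw [qr₁, qr₂, qr₃, qexp_coeff_three hw0 (hpw 2 two_pos)
        (pow_two_add_one_ne (hpw 4 four_pos)) (pow_four_add_ne (hpw 6 (by norm_num)))] at h
      exact h
    have sβ₃ : (Torus.dilog 1 0 (0, 1) : Γ.Torus).coeff (0, 3) =
        (u ^ 3)⁻¹ / ((u - u⁻¹) * (u ^ 2 - (u ^ 2)⁻¹) * (u ^ 3 - (u ^ 3)⁻¹)) := by
      have h := Torus.coeff_dilog_three (Γ := Γ) (n := (0, 1)) (by simp) 1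
      rw [mul_one, mul_one, q₁, q₂, q₃, qexp_coeff_three hu0 (hpu 2 two_pos)
        (pow_two_add_one_ne (hpu 4 four_pos)) (pow_four_add_ne (hpu 6 (by norm_num)))] at h
      exact h
    have sα₁ : (Torus.dilog r 0 (1, 0) : Γ.Torus).coeff (1, 0) = 1 / (w - w⁻¹) := by
      rw [Torus.coeff_dilog_one (by simp), zpow_zero, qr₁]
    have sβ₁ : (Torus.dilog 1 0 (0, 1) : Γ.Torus).coeff (0, 1) = 1 / (u - u⁻¹) := by
      rw [Torus.coeff_dilog_one (by simp), zpow_zero, q₁]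
    refine van_ordered_product hM hQ hu0 hw0 (hpu 2 two_pos)
      (pow_two_add_one_ne (hpu 4 four_pos)) (pow_four_add_ne (hpu 6 (by norm_num)))
      (hpw 2 two_pos) (pow_two_add_one_ne (hpw 4 four_pos))
      (pow_four_add_ne (hpw 6 (by norm_num))) (Torus.ray_dilog _ _ _) (Torus.ray_dilog _ _ _)
      r₃₁ r₂₁ r₁₁ r₂₂ r₁₂ r₁₃ (Torus.coeff_zero_dilog _ _ _) (Torus.coeff_zero_dilog _ _ _)
      z₃₁ z₂₁ z₁₁ z₂₂ z₁₂ z₁₃ sα₁ sα₂ sα₃ sβ₁ sβ₂ sβ₃ ?_ ?_ ?_ ?_ ?_ ?_ ?_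
    · rw [c₁₁, div_div, mul_comm (w - w⁻¹)]
    · refine c₁₁'.trans ?_
      rw [div_div _ (w - w⁻¹), div_div _ (w ^ 2 - (w ^ 2)⁻¹), mul_comm (w - w⁻¹),
        mul_comm (w ^ 2 - (w ^ 2)⁻¹)]
    · rw [c₂₂, div_div]
      congr 1
      ring
    · rw [c₁₂]
    · rw [c₁₃]
    · rw [c₂₁, mul_div_mul_right _ _ (sub_inv_ne hw0 (hpw 2 two_pos)), div_div]
    · rw [c₃₁, mul_div_mul_right _ _ (sub_inv_ne hw0 (hpw 2 two_pos)), div_div]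
end
end FixedData
end QCSD

/-! ### Normalization factors, symmetries, and the factorization in all cases. -/

namespace QCSD
namespace FixedData
noncomputable section
variable {Γ : FixedData}

/-- The factor $q-q^{-1}$ in the embedding of the Lie algebra cancels against the denominator of
$[ja]_q$ and leaves $X^{jA}-X^{-jA}$. -/
theorem toSeries_Psi {a b : ℚ} {A B : ℤ} (hA : (Γ.δ₀ : ℚ) * a = A) (hB : (Γ.δ₀ : ℚ) * b = B)
    (n : ℕ × ℕ) : toSeries (Γ.Psi a b n) = Torus.dilog A B n := by
  have hne := Γ.qpow_one_sub_ne
  rw [Psi, toSeries_expG, ← Torus.ray_eq_toTorus, Torus.dilog]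
  congr 2
  funext j
  have h1 : Γ.qpow (j * a) = RatFunc.X ^ ((j : ℤ) * A) :=
    Γ.qpow_of_eq (by push_cast; rw [← hA]; ring)
  have h2 : Γ.qpow (-(j * a)) = RatFunc.X ^ (-((j : ℤ) * A)) :=
    Γ.qpow_of_eq (by push_cast; rw [← hA]; ring)
  have h3 : Γ.qpow (j * b) = RatFunc.X ^ ((j : ℤ) * B) :=
    Γ.qpow_of_eq (by push_cast; rw [← hB]; ring)
  rw [qnum, h1, h2, h3, qdiff, mul_div_assoc', div_div_eq_mul_div]
  field_simp

variable (Γ) in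
/-- The integer `δ₀ / δ(n)`. -/
def colevel (n : ℕ × ℕ) : ℕ := Nat.gcd (Γ.δ₀ / Γ.δ₁ * n.1) (Γ.δ₀ / Γ.δ₂ * n.2)

/-- The condition $tn_i\in\delta_i\mathbb Z$ means $t(\delta_0/\delta_i)n_i\in\delta_0\mathbb Z$. By
Bézout both conditions together say that $t$ times the greatest common divisor lies in
$\delta_0\mathbb Z$, so the least positive $t$ is $\delta_0$ divided by it. -/
theorem colevel_mul_normFactor {n : ℕ × ℕ} (hn : n ≠ 0) :
    (Γ.colevel n : ℚ) * Γ.normFactor n = Γ.δ₀ := by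
  have h₁ : Γ.δ₁ * (Γ.δ₀ / Γ.δ₁) = Γ.δ₀ := Nat.mul_div_cancel' (Nat.dvd_lcm_left _ _)
  have h₂ : Γ.δ₂ * (Γ.δ₀ / Γ.δ₂) = Γ.δ₀ := Nat.mul_div_cancel' (Nat.dvd_lcm_right _ _)
  have h₀ := Γ.δ₀_pos
  have hc : colevel Γ n = Nat.gcd (Γ.δ₀ / Γ.δ₁ * n.1) (Γ.δ₀ / Γ.δ₂ * n.2) := rfl
  generalize Γ.δ₀ / Γ.δ₁ = p at *
  generalize Γ.δ₀ / Γ.δ₂ = q at *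
  have hp : 0 < p := Nat.pos_of_ne_zero fun h => by rw [h] at h₁; omega
  have hq : 0 < q := Nat.pos_of_ne_zero fun h => by rw [h] at h₂; omega
  have hg : 0 < Γ.colevel n := by
    rw [hc, Nat.pos_iff_ne_zero, Ne, Nat.gcd_eq_zero_iff]
    rintro ⟨h3, h4⟩
    exact hn (Prod.ext ((Nat.mul_eq_zero.1 h3).resolve_left hp.ne')
      ((Nat.mul_eq_zero.1 h4).resolve_left hq.ne'))
  have hgQ : (0 : ℚ) < Γ.colevel n := by exact_mod_cast hg
  have hbez := Nat.gcd_eq_gcd_ab (p * n.1) (q * n.2)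
  obtain ⟨a', ha'⟩ : Γ.colevel n ∣ p * n.1 := hc ▸ Nat.gcd_dvd_left _ _
  obtain ⟨b', hb'⟩ : Γ.colevel n ∣ q * n.2 := hc ▸ Nat.gcd_dvd_right _ _
  rw [← hc] at hbez
  have h₁Q : (Γ.δ₁ : ℚ) * p = Γ.δ₀ := by exact_mod_cast h₁
  have h₂Q : (Γ.δ₂ : ℚ) * q = Γ.δ₀ := by exact_mod_cast h₂
  have ha'Q : (p : ℚ) * n.1 = Γ.colevel n * a' := by exact_mod_cast ha'
  have hb'Q : (q : ℚ) * n.2 = Γ.colevel n * b' := by exact_mod_cast hb'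
  have hbezQ : (Γ.colevel n : ℚ) = p * n.1 * (Nat.gcdA (p * n.1) (q * n.2) : ℤ) +
      q * n.2 * (Nat.gcdB (p * n.1) (q * n.2) : ℤ) := by exact_mod_cast hbez
  have h₀Q : (0 : ℚ) < Γ.δ₀ := by exact_mod_cast h₀
  have hleast : IsLeast (Γ.multipliers n) (Γ.δ₀ / Γ.colevel n) := by
    refine ⟨⟨by positivity, ⟨a', ?_⟩, ⟨b', ?_⟩⟩, ?_⟩
    · push_cast
      field_simp
      rw [← h₁Q]
      linear_combination (Γ.δ₁ : ℚ) * ha'Q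
    · push_cast
      field_simp
      rw [← h₂Q]
      linear_combination (Γ.δ₂ : ℚ) * hb'Q
    · rintro t ⟨ht, ⟨a, ha⟩, ⟨b, hb⟩⟩
      rw [div_le_iff₀ hgQ]
      generalize Nat.gcdA (p * n.1) (q * n.2) = x at *
      generalize Nat.gcdB (p * n.1) (q * n.2) = y at *
      have e : t * Γ.colevel n = Γ.δ₀ * ((a * x + b * y : ℤ) : ℚ) := by
        rw [hbezQ]
        push_cast
        linear_combination (p : ℚ) * x * ha + (q : ℚ) * y * hb + (a : ℚ) * x * h₁Q +
          (b : ℚ) * y * h₂Q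
      have hpos : 0 < t * Γ.colevel n := by positivity
      rw [e] at hpos ⊢
      have : 0 < ((a * x + b * y : ℤ) : ℚ) := pos_of_mul_pos_right hpos h₀Q.le
      have : 1 ≤ a * x + b * y := by exact_mod_cast this
      have : (1 : ℚ) ≤ ((a * x + b * y : ℤ) : ℚ) := by exact_mod_cast this
      nlinarith
  rw [(Γ.isLeast_normFactor hn).unique hleast]
  field_simp

theorem toSeries_Psi_normFactor {n : ℕ × ℕ} (hn : n ≠ 0) (B : ℤ) :
    toSeries (Γ.Psi (1 / Γ.normFactor n) ((B : ℚ) / Γ.δ₀) n) = Torus.dilog (Γ.colevel n) B n := by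
  have h₀ : (Γ.δ₀ : ℚ) ≠ 0 := Nat.cast_ne_zero.2 Γ.δ₀_pos.ne'
  have h := colevel_mul_normFactor (Γ := Γ) hn
  have h1 : Γ.normFactor n ≠ 0 := fun h2 => h₀ (by rw [← h, h2, mul_zero])
  refine toSeries_Psi ?_ ?_ n
  · rw [← h]
    push_cast
    field_simp
  · field_simp

/-- The fixed data with the opposite form. -/
def op (Γ : FixedData) : FixedData where
  δ₁ := Γ.δ₁
  δ₂ := Γ.δ₂
  ω := -Γ.ω
  δ₁_pos := Γ.δ₁_pos
  δ₂_pos := Γ.δ₂_pos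
  int₁ := by
    obtain ⟨z, hz⟩ := Γ.int₁
    exact ⟨-z, by push_cast; rw [← hz]; ring⟩
  int₂ := by
    obtain ⟨z, hz⟩ := Γ.int₂
    exact ⟨-z, by push_cast; rw [← hz]; ring⟩

namespace Torus

/-- Relabelling of the exponents. -/
def relabel (s : ℕ × ℕ → ℕ × ℕ) (Γ' : FixedData) (f : Γ.Torus) : Γ'.Torus := fun n => f.coeff (s n)

theorem coeff_relabel (s : ℕ × ℕ → ℕ × ℕ) (Γ' : FixedData) (f : Γ.Torus) (n : ℕ × ℕ) :
    (relabel s Γ' f).coeff n = f.coeff (s n) := rfl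

/-- A relabelling that reverses the form. -/
structure Reversing (Γ Γ' : FixedData) (s : ℕ × ℕ → ℕ × ℕ) : Prop where
  add : ∀ a b, s (a + b) = s a + s b
  inv : ∀ a, s (s a) = a
  deg : ∀ a, deg (s a) = deg a
  qpow : ∀ a b, Γ'.qpow (Γ'.form (s a) (s b)) = Γ.qpow (Γ.form b a)

namespace Reversing

variable {Γ' : FixedData} {s : ℕ × ℕ → ℕ × ℕ} (h : Reversing Γ Γ' s)

theorem zero (h : Reversing Γ Γ' s) : s 0 = 0 := by
  rw [← deg_eq_zero, h.deg]; rfl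

theorem smul (h : Reversing Γ Γ' s) (j : ℕ) (a : ℕ × ℕ) : s (j • a) = j • s a := by
  induction j with
  | zero => rw [zero_smul, zero_smul, h.zero]
  | succ j ih => rw [succ_nsmul, succ_nsmul, h.add, ih]

theorem one (h : Reversing Γ Γ' s) : relabel s Γ' (1 : Γ.Torus) = 1 := by
  refine ext fun n => ?_
  rw [coeff_relabel, coeff_one, coeff_one]
  congr 1
  rw [eq_iff_iff, ← deg_eq_zero, h.deg, deg_eq_zero]

/-- The reversal of the form is compensated by the reversal of the order, so relabelling is an
anti-homomorphism of quantum tori. -/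
theorem mul (h : Reversing Γ Γ' s) (f g : Γ.Torus) :
    relabel s Γ' (f * g) = relabel s Γ' g * relabel s Γ' f := by
  refine ext fun n => ?_
  rw [coeff_relabel, coeff_mul, coeff_mul]
  refine Finset.sum_nbij' (fun p => (s p.2, s p.1)) (fun p => (s p.2, s p.1)) ?_ ?_ ?_ ?_ ?_
  · intro p hp
    rw [mem_splits] at hp ⊢
    rw [add_comm, ← h.add, hp, h.inv]
  · intro p hp
    rw [mem_splits] at hp ⊢
    rw [add_comm, ← h.add, hp]
  · intro p _
    simp only [h.inv]
  · intro p _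
    simp only [h.inv]
  · intro p _
    simp only [coeff_relabel, h.inv, h.qpow]
    ring

theorem pow (h : Reversing Γ Γ' s) (f : Γ.Torus) (k : ℕ) :
    relabel s Γ' (f ^ k) = relabel s Γ' f ^ k := by
  induction k with
  | zero => rw [pow_zero, pow_zero, h.one]
  | succ k ih => rw [pow_succ, h.mul, ih, pow_succ']

theorem exp (h : Reversing Γ Γ' s) (f : Γ.Torus) :
    relabel s Γ' (Torus.exp f) = Torus.exp (relabel s Γ' f) := by
  refine ext fun n => ?_
  rw [coeff_relabel, coeff_exp, coeff_exp, h.deg]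
  refine Finset.sum_congr rfl fun k _ => ?_
  rw [← h.pow, coeff_relabel]

theorem ray (h : Reversing Γ Γ' s) (n : ℕ × ℕ) (c : ℕ → K) :
    relabel s Γ' (Torus.ray n c : Γ.Torus) = Torus.ray (s n) c := by
  refine ext fun m => ?_
  rw [coeff_relabel, coeff_ray, coeff_ray, h.deg]
  refine Finset.sum_congr (Finset.filter_congr fun j _ => ?_) fun _ _ => rfl
  rw [← h.smul]
  constructor
  · intro e; rw [e, h.inv]
  · intro e; rw [← e, h.inv]

theorem dilog (h : Reversing Γ Γ' s) (A B : ℤ) (n : ℕ × ℕ) :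
    relabel s Γ' (Torus.dilog A B n : Γ.Torus) = Torus.dilog A B (s n) := by
  rw [Torus.dilog, h.exp, h.ray, Torus.dilog]

theorem list_prod (h : Reversing Γ Γ' s) (l : List Γ.Torus) :
    relabel s Γ' l.prod = (l.map (relabel s Γ')).reverse.prod := by
  induction l with
  | nil => exact h.one
  | cons f l ih => simp [h.mul, ih]

theorem van (h : Reversing Γ Γ' s) {d : ℕ} {f g : Γ.Torus} (hv : Van d (f - g)) :
    Van d (relabel s Γ' f - relabel s Γ' g) := fun n hn => hv (s n) (by rwa [h.deg])

/-- An anti-homomorphism reverses the product on the left, the order of the rays, and the order of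
the factors on each ray. -/
theorem factorization (h : Reversing Γ Γ' s) {d : ℕ} {A : ℕ × ℕ → ℕ}
    {g : ℕ × ℕ → List ((ℕ × ℕ) × ℤ)} {l : List (ℕ × ℕ)} {B C : ℤ} {m n : ℕ × ℕ}
    (hv : Van d ((Torus.dilog B 0 m * Torus.dilog C 0 n : Γ.Torus) -
      (l.map fun n => ((g n).map fun x => Torus.dilog (A x.1) x.2 x.1).prod).prod)) :
    Van d ((Torus.dilog C 0 (s n) * Torus.dilog B 0 (s m) : Γ'.Torus) -
      ((l.map s).reverse.map fun n =>
        ((((g (s n)).map fun x => (s x.1, x.2)).reverse).map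
          fun x => Torus.dilog (A (s x.1)) x.2 x.1).prod).prod) := by
  have h1 := h.van hv
  rw [h.mul, h.dilog, h.dilog, h.list_prod, List.map_map, ← List.map_reverse] at h1
  rw [← List.map_reverse, List.map_map]
  convert h1 using 4
  refine funext fun k => ?_
  rw [Function.comp_apply, Function.comp_apply, h.list_prod, h.inv, ← List.map_reverse,
    ← List.map_reverse, ← List.map_reverse, List.map_map, List.map_map]
  congr 1
  refine List.map_congr_left fun x _ => ?_
  rw [Function.comp_apply, Function.comp_apply, h.dilog, h.inv]

end Reversing

/-- The exchange of $e_1$ and $e_2$ carries the case $\delta_1\mid\delta_2$ to the case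
$\delta_2\mid\delta_1$. As it also reverses products, the sign of $\omega$ is kept. -/
theorem reversing_swap (Γ : FixedData) : Reversing Γ Γ Prod.swap where
  add _ _ := rfl
  inv _ := rfl
  deg a := by simp only [QCSD.deg, Prod.fst_swap, Prod.snd_swap]; omega
  qpow a b := by
    congr 1
    simp only [form, Prod.fst_swap, Prod.snd_swap]
    ring

/-- This reduces $\omega<0$ to $\omega>0$. -/
theorem reversing_op (Γ : FixedData) : Reversing Γ.op Γ id where
  add _ _ := rfl
  inv _ := rfl
  deg _ := rfl
  qpow a b := by
    have : Γ.form (id a) (id b) = Γ.op.form b a := by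
      simp only [form, op, id]
      ring
    rw [this]
    rfl

end Torus

theorem colevel_of_dvd (h : Γ.δ₁ ∣ Γ.δ₂) (n : ℕ × ℕ) :
    Γ.colevel n = level (Γ.δ₂ / Γ.δ₁) n := by
  have : Γ.δ₀ = Γ.δ₂ := Nat.lcm_eq_right h
  rw [colevel, level, this, Nat.div_self Γ.δ₂_pos, one_mul]

theorem colevel_of_dvd' (h : Γ.δ₂ ∣ Γ.δ₁) (n : ℕ × ℕ) :
    Γ.colevel n = level (Γ.δ₁ / Γ.δ₂) n.swap := by
  have : Γ.δ₀ = Γ.δ₁ := Nat.lcm_eq_left h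
  rw [colevel, level, this, Nat.div_self Γ.δ₁_pos, one_mul, Nat.gcd_comm]
  rfl

theorem exists_factorization_of_pos (hω : 0 < Γ.ω) (hδ : Γ.δ₁ ∣ Γ.δ₂ ∨ Γ.δ₂ ∣ Γ.δ₁) :
    ∃ g : ℕ × ℕ → List ((ℕ × ℕ) × ℤ),
      (∀ n ∈ slopes, ∀ x ∈ g n, ∃ k : ℕ, 1 ≤ k ∧ x.1 = k • n) ∧
      Torus.Van 5 ((Torus.dilog (Γ.colevel (0, 1)) 0 (0, 1) *
        Torus.dilog (Γ.colevel (1, 0)) 0 (1, 0) : Γ.Torus) -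
        (slopes.map fun n =>
          ((g n).map fun x => Torus.dilog (Γ.colevel x.1) x.2 x.1).prod).prod) := by
  have posN : ∀ δ : ℕ, 0 < δ → (∃ z : ℤ, (δ : ℚ) * Γ.ω = z) →
      ∃ N : ℕ, 0 < N ∧ (δ : ℚ) * Γ.ω = N := by
    rintro δ h ⟨z, hz⟩
    have hz0 : (0 : ℚ) < z := by rw [← hz]; positivity
    have hz0 : 0 < z := by exact_mod_cast hz0
    obtain ⟨N, rfl⟩ := Int.eq_ofNat_of_zero_le hz0.le
    exact ⟨N, by omega, by exact_mod_cast hz⟩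
  rcases hδ with hδ | hδ
  · have h₀ : Γ.δ₀ = Γ.δ₂ := Nat.lcm_eq_right hδ
    -- With $N=\delta_1\omega$ and $r=\delta_2/\delta_1$ one has $\delta_0\omega=\delta_2\omega=Nr$.
    -- This is where divisibility enters: $q^\omega$ is the $N$-th power of $q^{1/\delta_1}=X^r$
    -- with $X=q^{1/\delta_2}$.
    obtain ⟨N, hN, hNω⟩ := posN _ Γ.δ₁_pos Γ.int₁
    have hc := colevel_of_dvd hδ
    obtain ⟨r, hr⟩ := hδ
    have hr0 : 0 < r := Nat.pos_of_ne_zero fun h => by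
      have := Γ.δ₂_pos; rw [hr, h] at this; omega
    rw [hr, Nat.mul_div_cancel_left _ Γ.δ₁_pos] at hc
    obtain ⟨g, hg, hv⟩ := exists_ordered_factorization (Γ := Γ) hr0 hN (by
      rw [h₀, hr]; push_cast; rw [← hNω]; ring)
    refine ⟨g, hg, ?_⟩
    simpa only [hc, show level r (0, 1) = 1 by simp [level],
      show level r (1, 0) = r by simp [level], Nat.cast_one] using hv
  · have h₀ : Γ.δ₀ = Γ.δ₁ := Nat.lcm_eq_left hδ
    obtain ⟨N, hN, hNω⟩ := posN _ Γ.δ₂_pos Γ.int₂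
    have hc := colevel_of_dvd' hδ
    obtain ⟨r, hr⟩ := hδ
    have hr0 : 0 < r := Nat.pos_of_ne_zero fun h => by
      have := Γ.δ₁_pos; rw [hr, h] at this; omega
    rw [hr, Nat.mul_div_cancel_left _ Γ.δ₂_pos] at hc
    obtain ⟨g, hg, hv⟩ := exists_ordered_factorization (Γ := Γ) hr0 hN (by
      rw [h₀, hr]; push_cast; rw [← hNω]; ring)
    refine ⟨fun n => ((g n.swap).map fun x => (x.1.swap, x.2)).reverse, ?_, ?_⟩
    · intro n hn x hx
      rw [List.mem_reverse, List.mem_map] at hx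
      obtain ⟨y, hy, rfl⟩ := hx
      have hn' : n.swap ∈ slopes := by
        simp only [slopes, List.mem_cons, List.not_mem_nil, or_false] at hn ⊢
        rcases hn with rfl | rfl | rfl | rfl | rfl | rfl | rfl <;> simp
      obtain ⟨k, hk, he⟩ := hg _ hn' y hy
      exact ⟨k, hk, by rw [he]; rfl⟩
    · have h1 := (Torus.reversing_swap Γ).factorization hv
      -- The list of slopes is invariant under the exchange of coordinates followed by reversal, so
      -- the order of the rays is the required one again.
      rw [show (slopes.map Prod.swap).reverse = slopes from rfl] at h1
      simpa only [hc, show level r (Prod.swap (0, 1)) = r by simp [level],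
        show level r (Prod.swap (1, 0)) = 1 by simp [level], Nat.cast_one,
        show Prod.swap ((1, 0) : ℕ × ℕ) = (0, 1) from rfl,
        show Prod.swap ((0, 1) : ℕ × ℕ) = (1, 0) from rfl,
        show level r (0, 1) = 1 by simp [level],
        show level r (1, 0) = r by simp [level]] using h1

theorem exists_factorization_of_neg (hω : Γ.ω < 0) (hδ : Γ.δ₁ ∣ Γ.δ₂ ∨ Γ.δ₂ ∣ Γ.δ₁) :
    ∃ g : ℕ × ℕ → List ((ℕ × ℕ) × ℤ),
      (∀ n ∈ slopes, ∀ x ∈ g n, ∃ k : ℕ, 1 ≤ k ∧ x.1 = k • n) ∧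
      Torus.Van 5 ((Torus.dilog (Γ.colevel (1, 0)) 0 (1, 0) *
        Torus.dilog (Γ.colevel (0, 1)) 0 (0, 1) : Γ.Torus) -
        (slopes.reverse.map fun n =>
          ((g n).map fun x => Torus.dilog (Γ.colevel x.1) x.2 x.1).prod).prod) := by
  obtain ⟨g, hg, hv⟩ := exists_factorization_of_pos (Γ := Γ.op) (neg_pos.2 hω) hδ
  refine ⟨fun n => (g n).reverse, fun n hn x hx => hg n hn x (List.mem_reverse.1 hx), ?_⟩
  have h1 := (Torus.reversing_op Γ).factorization hv
  simp only [List.map_id, id, Prod.mk.eta, List.map_id'] at h1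
  exact h1

/-- The product of the factors attached to the ray of `n`. -/
def rayProduct (Γ : FixedData) (h : ℕ × ℕ → List Factor) (n : ℕ × ℕ) : Γ.G :=
  ((h n).map (Factor.elt Γ)).prod

/-- Positive ordered factorization up to degree four. -/
theorem exists_factorization (hδ : Γ.δ₁ ∣ Γ.δ₂ ∨ Γ.δ₂ ∣ Γ.δ₁) :
    ∃ h : ℕ × ℕ → List Factor,
      (∀ n ∈ slopes, ∀ x ∈ h n, x.c = 1 ∧ Γ.InLattice x.b ∧ ∃ k : ℕ, 1 ≤ k ∧ x.n = k • n) ∧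
      (0 < Γ.ω → Γ.EqUpTo 4 (Γ.Psi (1 / (Γ.δ 1 : ℚ)) 0 (e 1) * Γ.Psi (1 / (Γ.δ 0 : ℚ)) 0 (e 0))
        (slopes.map (Γ.rayProduct h)).prod) ∧
      (Γ.ω < 0 → Γ.EqUpTo 4 (Γ.Psi (1 / (Γ.δ 0 : ℚ)) 0 (e 0) * Γ.Psi (1 / (Γ.δ 1 : ℚ)) 0 (e 1))
        (slopes.reverse.map (Γ.rayProduct h)).prod) := by
  have h₀ : (Γ.δ₀ : ℚ) ≠ 0 := Nat.cast_ne_zero.2 Γ.δ₀_pos.ne'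
  have h₁ : (Γ.δ₁ : ℚ) * (Γ.δ₀ / Γ.δ₁ : ℕ) = Γ.δ₀ := by
    exact_mod_cast Nat.mul_div_cancel' (Nat.dvd_lcm_left _ _)
  have h₂ : (Γ.δ₂ : ℚ) * (Γ.δ₀ / Γ.δ₂ : ℕ) = Γ.δ₀ := by
    exact_mod_cast Nat.mul_div_cancel' (Nat.dvd_lcm_right _ _)
  have hδ₁ : (Γ.δ₁ : ℚ) ≠ 0 := Nat.cast_ne_zero.2 Γ.δ₁_pos.ne'
  have hδ₂ : (Γ.δ₂ : ℚ) ≠ 0 := Nat.cast_ne_zero.2 Γ.δ₂_pos.ne'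
  have ψ₀ : toSeries (Γ.Psi (1 / (Γ.δ 0 : ℚ)) 0 (e 0)) =
      Torus.dilog (Γ.colevel (1, 0)) 0 (1, 0) := by
    refine toSeries_Psi ?_ (by simp) _
    rw [← h₁]
    simp [colevel, δ]
    field_simp
    norm_cast
  have ψ₁ : toSeries (Γ.Psi (1 / (Γ.δ 1 : ℚ)) 0 (e 1)) =
      Torus.dilog (Γ.colevel (0, 1)) 0 (0, 1) := by
    refine toSeries_Psi ?_ (by simp) _
    rw [← h₂]
    simp [colevel, δ]
    field_simp
    norm_cast
  have main : ∀ (g : ℕ × ℕ → List ((ℕ × ℕ) × ℤ)),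
      (∀ n ∈ slopes, ∀ x ∈ g n, ∃ k : ℕ, 1 ≤ k ∧ x.1 = k • n) →
      (∀ n ∈ slopes, ∀ x ∈ (g n).map fun x => (⟨x.1, (x.2 : ℚ) / Γ.δ₀, 1⟩ : Factor),
        x.c = 1 ∧ Γ.InLattice x.b ∧ ∃ k : ℕ, 1 ≤ k ∧ x.n = k • n) ∧
      ∀ n ∈ slopes, toSeries (Γ.rayProduct
        (fun n => (g n).map fun x => (⟨x.1, (x.2 : ℚ) / Γ.δ₀, 1⟩ : Factor)) n) =
        ((g n).map fun x => Torus.dilog (Γ.colevel x.1) x.2 x.1).prod := by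
    intro g hg
    refine ⟨fun n hn x hx => ?_, fun n hn => ?_⟩
    · obtain ⟨y, hy, rfl⟩ := List.mem_map.1 hx
      exact ⟨rfl, ⟨y.2, by field_simp⟩, hg n hn y hy⟩
    · rw [rayProduct, toSeries_list_prod, List.map_map, List.map_map]
      congr 1
      refine List.map_congr_left fun x hx => ?_
      obtain ⟨k, hk, hkx⟩ := hg n hn x hx
      have hn0 : n ≠ 0 := by
        rintro rfl
        simp [slopes, Prod.ext_iff] at hn
      have hx0 : x.1 ≠ 0 := by
        rw [hkx]
        intro h0
        rcases smul_eq_zero.1 h0 with h0 | h0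
        · omega
        · exact hn0 h0
      rw [Function.comp_apply, Function.comp_apply, Factor.elt, pow_one,
        toSeries_Psi_normFactor hx0]
  rcases lt_trichotomy Γ.ω 0 with hω | hω | hω
  · obtain ⟨g, hg, hv⟩ := exists_factorization_of_neg hω hδ
    obtain ⟨m₁, m₂⟩ := main g hg
    refine ⟨_, m₁, fun h => absurd h hω.not_gt, fun _ => eqUpTo_iff.2 ?_⟩
    rw [toSeries_mul, ψ₀, ψ₁, toSeries_list_prod, List.map_map]
    refine (congrArg (Torus.Van 5) ?_).mp hv
    congr 2
    exact List.map_congr_left fun n hn => (m₂ n (List.mem_reverse.1 hn)).symm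
  · exact ⟨fun _ => [], by simp, fun h => absurd hω h.ne', fun h => absurd hω h.ne⟩
  · obtain ⟨g, hg, hv⟩ := exists_factorization_of_pos hω hδ
    obtain ⟨m₁, m₂⟩ := main g hg
    refine ⟨_, m₁, fun _ => eqUpTo_iff.2 ?_, fun h => absurd h hω.not_gt⟩
    rw [toSeries_mul, ψ₀, ψ₁, toSeries_list_prod, List.map_map]
    refine (congrArg (Torus.Van 5) ?_).mp hv
    congr 2
    exact List.map_congr_left fun n hn => (m₂ n hn).symm

end
end FixedData
end QCSD

/-! ### The ordered product of the second assertion. -/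

namespace QCSD
noncomputable section
namespace FixedData
variable {Γ : FixedData}

theorem form_smul (k l : ℕ) (m n : ℕ × ℕ) : Γ.form (k • m) (l • n) = k * l * Γ.form m n := by
  simp only [form, Prod.smul_fst, Prod.smul_snd, smul_eq_mul, Nat.cast_mul]
  ring

theorem ne_zero_of_mem_slopes {n : ℕ × ℕ} (hn : n ∈ slopes) : n ≠ 0 := by
  rintro rfl
  simp [slopes, Prod.ext_iff] at hn

theorem Factor.positive_of_smul {x : Factor} {n : ℕ × ℕ} (hn : n ≠ 0)
    (hx : x.c = 1 ∧ Γ.InLattice x.b ∧ ∃ k : ℕ, 1 ≤ k ∧ x.n = k • n) : x.Positive Γ := by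
  obtain ⟨hc, hb, k, hk, hxn⟩ := hx
  refine ⟨?_, hb, by omega⟩
  rw [hxn]
  exact smul_ne_zero (by omega) hn

/-- Two factors on one ray pair to zero. For different rays the sign of the form is that for the
primitive vectors, since the multiples are positive. -/
theorem ordered_flatMap {l : List (ℕ × ℕ)} {h : ℕ × ℕ → List Factor}
    (hh : ∀ n ∈ l, ∀ x ∈ h n, ∃ k : ℕ, 1 ≤ k ∧ x.n = k • n)
    (hl : l.Pairwise fun m n => Γ.form m n ≤ 0) : Ordered Γ (l.flatMap h) := by
  rw [Ordered, List.pairwise_flatMap]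
  refine ⟨fun n hn => List.pairwise_iff_forall_sublist.2 fun {x y} hxy => ?_,
    hl.imp_of_mem fun {m n} hm hn hmn x hx y hy => ?_⟩
  · obtain ⟨k, -, hk⟩ := hh n hn x (hxy.subset (by simp))
    obtain ⟨l, -, hl⟩ := hh n hn y (hxy.subset (by simp))
    rw [hk, hl, form_smul, show Γ.form n n = 0 by simp only [form]; ring, mul_zero]
  · obtain ⟨k, -, hk⟩ := hh m hm x hx
    obtain ⟨l, -, hl⟩ := hh n hn y hy
    rw [hk, hl, form_smul]
    exact mul_nonpos_of_nonneg_of_nonpos (by positivity) hmn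

theorem prod_map_flatMap (l : List (ℕ × ℕ)) (h : ℕ × ℕ → List Factor) :
    ((l.flatMap h).map (Factor.elt Γ)).prod = (l.map (Γ.rayProduct h)).prod := by
  induction l with
  | nil => rfl
  | cons n l ih => simp [rayProduct, ih]

theorem slopes_pairwise_le : slopes.Pairwise fun m n => m.2 * n.1 ≤ m.1 * n.2 := by
  decide

theorem pairwise_slopes (hω : 0 < Γ.ω) : slopes.Pairwise fun m n => Γ.form m n ≤ 0 := by
  refine slopes_pairwise_le.imp fun {m n} h => mul_nonpos_of_nonneg_of_nonpos hω.le ?_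
  rw [sub_nonpos]
  exact_mod_cast h

theorem pairwise_reverse_slopes (hω : Γ.ω < 0) :
    slopes.reverse.Pairwise fun m n => Γ.form m n ≤ 0 := by
  rw [List.pairwise_reverse]
  refine slopes_pairwise_le.imp fun {m n} h => mul_nonpos_of_nonpos_of_nonneg hω.le ?_
  rw [sub_nonneg, mul_comm (n.1 : ℚ), mul_comm (n.2 : ℚ)]
  exact_mod_cast h

theorem exists_ordered_product (hδ : Γ.δ₁ ∣ Γ.δ₂ ∨ Γ.δ₂ ∣ Γ.δ₁) (i j : Fin 2)
    (hij : 0 < Γ.form (e j) (e i)) :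
    ∃ L : List Factor, (∀ x ∈ L, x.Positive Γ) ∧ Ordered Γ L ∧
      Γ.EqUpTo 4 (Γ.Psi (1 / (Γ.δ j : ℚ)) 0 (e j) * Γ.Psi (1 / (Γ.δ i : ℚ)) 0 (e i))
        (L.map (Factor.elt Γ)).prod := by
  obtain ⟨h, hh, hpos, hneg⟩ := exists_factorization hδ
  have hp : ∀ n ∈ slopes, ∀ x ∈ h n, x.Positive Γ := fun n hn x hx =>
    Factor.positive_of_smul (ne_zero_of_mem_slopes hn) (hh n hn x hx)
  -- Positivity of $\{e_j,e_i\}$ excludes $i=j$ and otherwise fixes the sign of $\omega$, hence the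
  -- order of the rays.
  fin_cases i <;> fin_cases j
  · simp [form, e] at hij
  · have hω : 0 < Γ.ω := by simpa [form, e] using hij
    refine ⟨slopes.flatMap h, fun x hx => ?_,
      ordered_flatMap (fun n hn x hx => (hh n hn x hx).2.2) (pairwise_slopes hω), ?_⟩
    · obtain ⟨n, hn, hx⟩ := List.mem_flatMap.1 hx
      exact hp n hn x hx
    · rw [prod_map_flatMap]
      exact hpos hω
  · have hω : Γ.ω < 0 := by simpa [form, e] using hij
    refine ⟨slopes.reverse.flatMap h, fun x hx => ?_,
      ordered_flatMap (fun n hn x hx => (hh n (List.mem_reverse.1 hn) x hx).2.2)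
        (pairwise_reverse_slopes hω), ?_⟩
    · obtain ⟨n, hn, hx⟩ := List.mem_flatMap.1 hx
      exact hp n (List.mem_reverse.1 hn) x hx
    · rw [prod_map_flatMap]
      exact hneg hω
  · simp [form, e] at hij

end FixedData
end
end QCSD

/-! ### Functions on the unit interval determined by their jumps. -/

namespace QCSD
noncomputable section
open Filter Topology

section Jumps

/-- If `f` is constant in punctured neighbourhoods of all points of `[0,1]` and constant near the
end points, then it has the same values at the end points. -/
theorem eq_of_eventually_const {α : Type*} {f : ℝ → α}
    (h : ∀ t ∈ Set.Icc (0 : ℝ) 1, ∃ a, ∀ᶠ s in 𝓝[Set.Icc 0 1] t, s ≠ t → f s = a)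
    (h0 : ∀ᶠ s in 𝓝[Set.Icc 0 1] 0, f s = f 0) (h1 : ∀ᶠ s in 𝓝[Set.Icc 0 1] 1, f s = f 1) :
    f 0 = f 1 := by
  -- The interval has no isolated points, so anything true near $t$ is true at some nearby point
  -- other than $t$.
  have hne : ∀ t ∈ Set.Icc (0 : ℝ) 1, ∀ p : ℝ → Prop, (∀ᶠ s in 𝓝[Set.Icc 0 1] t, p s) →
      ∃ s, s ≠ t ∧ p s := by
    intro t ht p hp
    have hb : (𝓝[Set.Icc (0 : ℝ) 1 \ {t}] t).NeBot := by
      have := (convex_Icc (0 : ℝ) 1).isPreconnected.preperfect_of_nontrivial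
        ⟨0, by simp, 1, by simp, zero_ne_one⟩ t ht
      rwa [accPt_principal_iff_nhdsWithin] at this
    have h2 : ∀ᶠ s in 𝓝[Set.Icc (0 : ℝ) 1 \ {t}] t, p s :=
      hp.filter_mono (nhdsWithin_mono _ Set.sdiff_subset)
    obtain ⟨s, hs, hs'⟩ := (h2.and self_mem_nhdsWithin).exists
    exact ⟨s, hs'.2, hs⟩
  have : Nonempty α := ⟨f 0⟩
  choose! v hv using h
  -- The value $v(t)$ that $f$ takes around $t$ is locally constant even where $f$ itself is not,
  -- because punctured neighbourhoods of nearby points overlap. Connectedness of the interval makes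
  -- $v$ constant.
  have hloc : IsLocallyConstant fun t : Set.Icc (0 : ℝ) 1 => v t := by
    rw [IsLocallyConstant.iff_eventually_eq]
    rintro ⟨t, ht⟩
    have h2 := eventually_eventually_nhdsWithin.2 (hv t ht)
    have h3 : ∀ᶠ r in 𝓝[Set.Icc (0 : ℝ) 1] t, v r = v t := by
      filter_upwards [h2, self_mem_nhdsWithin] with r hr hrI
      by_cases hrt : r = t
      · rw [hrt]
      have h4 : ∀ᶠ s in 𝓝[Set.Icc (0 : ℝ) 1] r, s ≠ t :=
        (eventually_ne_nhds hrt).filter_mono nhdsWithin_le_nhds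
      obtain ⟨s, hsr, ⟨hs, hs'⟩, hst⟩ := hne r hrI _ ((hr.and (hv r hrI)).and h4)
      exact (hs' hsr).symm.trans (hs hst)
    rw [nhdsWithin_eq_map_subtype_coe ht] at h3
    exact h3
  have hconst := hloc.apply_eq_of_preconnectedSpace ⟨0, by simp⟩ ⟨1, by simp⟩
  obtain ⟨s, hs, h2, h3⟩ := hne 0 (by simp) _ (h0.and (hv 0 (by simp)))
  obtain ⟨r, hr, h4, h5⟩ := hne 1 (by simp) _ (h1.and (hv 1 (by simp)))
  rw [← h2, h3 hs, ← h4, h5 hr]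
  exact hconst

variable {Q : Type*} [Group Q]

/-- At the time `t` the function `f` jumps by left multiplication by `c`. -/
def JumpsAt (f : ℝ → Q) (c : Q) (t : ℝ) : Prop :=
  ∃ a, ∀ᶠ s in 𝓝[Set.Icc 0 1] t, (s < t → f s = a) ∧ (t < s → f s = c * a)

/-- Functions with the same jumps have the same total variation. -/
theorem inv_mul_eq_of_jumpsAt {f g : ℝ → Q} {c : ℝ → Q}
    (hf : ∀ t ∈ Set.Icc (0 : ℝ) 1, JumpsAt f (c t) t)
    (hg : ∀ t ∈ Set.Icc (0 : ℝ) 1, JumpsAt g (c t) t)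
    (hf0 : ∀ᶠ s in 𝓝[Set.Icc 0 1] 0, f s = f 0) (hf1 : ∀ᶠ s in 𝓝[Set.Icc 0 1] 1, f s = f 1)
    (hg0 : ∀ᶠ s in 𝓝[Set.Icc 0 1] 0, g s = g 0) (hg1 : ∀ᶠ s in 𝓝[Set.Icc 0 1] 1, g s = g 1) :
    (f 0)⁻¹ * g 0 = (f 1)⁻¹ * g 1 := by
  -- Both functions are multiplied on the left by the same element at a jump, and this cancels in
  -- $f^{-1}g$.
  refine eq_of_eventually_const (f := fun s => (f s)⁻¹ * g s) (fun t ht => ?_) ?_ ?_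
  · obtain ⟨a, ha⟩ := hf t ht
    obtain ⟨b, hb⟩ := hg t ht
    refine ⟨a⁻¹ * b, ?_⟩
    filter_upwards [ha, hb] with s h1 h2 hs
    rcases lt_or_gt_of_ne hs with h | h
    · rw [h1.1 h, h2.1 h]
    · rw [h1.2 h, h2.2 h]; group
  · filter_upwards [hf0, hg0] with s h1 h2
    rw [h1, h2]
  · filter_upwards [hf1, hg1] with s h1 h2
    rw [h1, h2]

theorem jumpsAt_of_eventually_eq {f : ℝ → Q} {a : Q} {t : ℝ}
    (h : ∀ᶠ s in 𝓝[Set.Icc 0 1] t, f s = a) : JumpsAt f 1 t :=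
  ⟨a, h.mono fun s hs => ⟨fun _ => hs, fun _ => by rw [hs, one_mul]⟩⟩

/-- The product of the values at times before `s`, later ones standing on the left. -/
def stepProduct (L : List (ℝ × Q)) (s : ℝ) : Q :=
  ((L.filter fun x => x.1 < s).map Prod.snd).reverse.prod

/-- The product of the values at time `t`. -/
def productAt (L : List (ℝ × Q)) (t : ℝ) : Q :=
  ((L.filter fun x => x.1 = t).map Prod.snd).reverse.prod

theorem filter_le_eq_append {α : Type*} {L : List (ℝ × α)} (hL : L.Pairwise fun x y => x.1 ≤ y.1)
    (t : ℝ) : (L.filter fun x => x.1 ≤ t) =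
      (L.filter fun x => x.1 < t) ++ L.filter fun x => x.1 = t := by
  induction L with
  | nil => rfl
  | cons x l ih =>
    rw [List.pairwise_cons] at hL
    have ih := ih hL.2
    rcases lt_trichotomy x.1 t with h | h | h
    · simp [h, h.le, h.ne, ih]
    · have : (l.filter fun x => x.1 < t) = [] := by
        rw [List.filter_eq_nil_iff]
        intro y hy
        simpa [← h] using hL.1 y hy
      rw [this] at ih
      simp [h, this, ih]
    · have : (l.filter fun x => x.1 < t) = [] := by
        rw [List.filter_eq_nil_iff]
        intro y hy
        simpa using h.le.trans (hL.1 y hy)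
      rw [this] at ih
      simp [h.not_ge, h.not_gt, h.ne', this, ih]

theorem jumpsAt_stepProduct {L : List (ℝ × Q)} (hL : L.Pairwise fun x y => x.1 ≤ y.1) (t : ℝ) :
    JumpsAt (stepProduct L) (productAt L t) t := by
  refine ⟨stepProduct L t, ?_⟩
  have h : ∀ᶠ s in 𝓝 t, ∀ x ∈ L,
      (s < t → (x.1 < s ↔ x.1 < t)) ∧ (t < s → (x.1 < s ↔ x.1 ≤ t)) := by
    refine L.finite_toSet.eventually_all.2 fun x _ => ?_
    rcases lt_trichotomy x.1 t with h | h | h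
    · filter_upwards [lt_mem_nhds h] with s hs
      simp [h, h.le, hs]
    · refine Eventually.of_forall fun s => ?_
      simp only [h, lt_irrefl, iff_false, not_lt, le_refl, iff_true]
      exact ⟨le_of_lt, id⟩
    · filter_upwards [gt_mem_nhds h] with s hs
      simp [h.not_gt, h.not_ge, hs.le]
  filter_upwards [nhdsWithin_le_nhds h] with s hs
  refine ⟨fun hst => ?_, fun hst => ?_⟩
  · rw [stepProduct, stepProduct]
    congr 3
    refine List.filter_congr fun x hx => ?_
    simp only [(hs x hx).1 hst]
  · have : (L.filter fun x => x.1 < s) = L.filter fun x => x.1 ≤ t :=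
      List.filter_congr fun x hx => by simp only [(hs x hx).2 hst]
    rw [stepProduct, this, filter_le_eq_append hL, List.map_append, List.reverse_append,
      List.prod_append]
    rfl

theorem stepProduct_of_forall_le {L : List (ℝ × Q)} {s : ℝ} (hL : ∀ x ∈ L, s ≤ x.1) :
    stepProduct L s = 1 := by
  have : (L.filter fun x => x.1 < s) = [] := by
    rw [List.filter_eq_nil_iff]
    intro x hx
    simpa using hL x hx
  rw [stepProduct, this]
  rfl

theorem stepProduct_of_forall_lt {L : List (ℝ × Q)} {s : ℝ} (hL : ∀ x ∈ L, x.1 < s) :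
    stepProduct L s = (L.map Prod.snd).reverse.prod := by
  have : (L.filter fun x => x.1 < s) = L := by
    rw [List.filter_eq_self]
    intro x hx
    simpa using hL x hx
  rw [stepProduct, this]

theorem stepProduct_eventually_zero {L : List (ℝ × Q)} (hL : ∀ x ∈ L, 0 < x.1) :
    ∀ᶠ s in 𝓝[Set.Icc 0 1] 0, stepProduct L s = stepProduct L 0 := by
  have h : ∀ᶠ s in 𝓝 (0 : ℝ), ∀ x ∈ L, s < x.1 :=
    L.finite_toSet.eventually_all.2 fun x hx => gt_mem_nhds (hL x hx)
  filter_upwards [nhdsWithin_le_nhds h] with s hs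
  rw [stepProduct_of_forall_le fun x hx => (hs x hx).le,
    stepProduct_of_forall_le fun x hx => (hL x hx).le]

theorem stepProduct_eventually_one {L : List (ℝ × Q)} (hL : ∀ x ∈ L, x.1 < 1) :
    ∀ᶠ s in 𝓝[Set.Icc 0 1] 1, stepProduct L s = stepProduct L 1 := by
  have h : ∀ᶠ s in 𝓝 (1 : ℝ), ∀ x ∈ L, x.1 < s :=
    L.finite_toSet.eventually_all.2 fun x hx => lt_mem_nhds (hL x hx)
  filter_upwards [nhdsWithin_le_nhds h] with s hs
  rw [stepProduct_of_forall_lt hs, stepProduct_of_forall_lt hL]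

end Jumps

end
end QCSD

/-! ### Path-ordered products in terms of the elements at points of the plane. -/

namespace QCSD
noncomputable section
open FixedData Filter Topology
universe u' v'

namespace FixedData
variable {Γ : FixedData}

theorem eq_of_cross_eq {m n : ℕ × ℕ} (hm : Nat.gcd m.1 m.2 = 1) (hn : Nat.gcd n.1 n.2 = 1)
    (h : m.1 * n.2 = m.2 * n.1) : m = n := by
  refine Prod.ext (Nat.dvd_antisymm ?_ ?_) (Nat.dvd_antisymm ?_ ?_)
  · exact Nat.Coprime.dvd_of_dvd_mul_left hm ⟨_, h.symm⟩
  · exact Nat.Coprime.dvd_of_dvd_mul_right hn ⟨m.2, by rw [h, mul_comm]⟩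
  · exact Nat.Coprime.dvd_of_dvd_mul_left (Nat.Coprime.symm hm) ⟨_, h⟩
  · exact Nat.Coprime.dvd_of_dvd_mul_right (Nat.Coprime.symm hn) ⟨m.1, by rw [← h, mul_comm]⟩

/-- A primitive vector is determined by a nonzero point orthogonal to it. -/
theorem eq_of_pairing_eq_zero {m n : ℕ × ℕ} (hm : Nat.gcd m.1 m.2 = 1)
    (hn : Nat.gcd n.1 n.2 = 1) {z : ℝ × ℝ} (hz : z ≠ 0) (h1 : pairing m z = 0)
    (h2 : pairing n z = 0) : m = n := by
  refine eq_of_cross_eq hm hn ?_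
  unfold pairing at h1 h2
  have h3 : ((m.1 : ℝ) * n.2 - m.2 * n.1) * z.1 = 0 := by linear_combination n.2 * h1 - m.2 * h2
  have h4 : ((m.1 : ℝ) * n.2 - m.2 * n.1) * z.2 = 0 := by linear_combination m.1 * h2 - n.1 * h1
  have h5 : ((m.1 : ℝ) * n.2 - m.2 * n.1) = 0 := by
    by_contra h
    exact hz (Prod.ext ((mul_eq_zero.1 h3).resolve_left h) ((mul_eq_zero.1 h4).resolve_left h))
  exact_mod_cast sub_eq_zero.1 h5

theorem differentiable_pairing (n : ℕ × ℕ) : Differentiable ℝ (pairing n) := by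
  unfold pairing
  fun_prop

theorem continuous_pairing (n : ℕ × ℕ) : Continuous (pairing n) :=
  (differentiable_pairing n).continuous

theorem hasDerivAt_pairing (n : ℕ × ℕ) {γ : ℝ → ℝ × ℝ} {t : ℝ} (h : DifferentiableAt ℝ γ t) :
    HasDerivAt (fun s => pairing n (γ s)) (pairing n (deriv γ t)) t := by
  have h1 := h.hasDerivAt
  have hx : HasDerivAt (fun s => (γ s).1) (deriv γ t).1 t :=
    (ContinuousLinearMap.fst ℝ ℝ ℝ).hasFDerivAt.comp_hasDerivAt t h1
  have hy : HasDerivAt (fun s => (γ s).2) (deriv γ t).2 t :=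
    (ContinuousLinearMap.snd ℝ ℝ ℝ).hasFDerivAt.comp_hasDerivAt t h1
  exact (hx.const_mul _).add (hy.const_mul _)

theorem eventually_sign_of_deriv_pos {f : ℝ → ℝ} {v t : ℝ} (h : HasDerivAt f v t) (h0 : f t = 0)
    (hv : 0 < v) : ∀ᶠ s in 𝓝 t, (s < t → f s < 0) ∧ (t < s → 0 < f s) := by
  have h2 := eventually_nhdsWithin_sign_eq_of_deriv_pos (f := f) (by rw [h.deriv]; exact hv) h0
  filter_upwards [h2] with s hs
  refine ⟨fun hst => ?_, fun hst => ?_⟩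
  · rwa [sign_neg (sub_neg.2 hst), sign_eq_neg_one_iff] at hs
  · rwa [sign_pos (sub_pos.2 hst), sign_eq_one_iff] at hs

/-- A curve crossing a line transversally changes sides. -/
theorem eventually_pairing_sign {n : ℕ × ℕ} {γ : ℝ → ℝ × ℝ} {t : ℝ} (h : DifferentiableAt ℝ γ t)
    (h0 : pairing n (γ t) = 0) (hv : 0 < pairing n (deriv γ t)) :
    ∀ᶠ s in 𝓝 t, (s < t → pairing n (γ s) < 0) ∧ (t < s → 0 < pairing n (γ s)) :=
  eventually_sign_of_deriv_pos (hasDerivAt_pairing n h) h0 hv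

theorem eventually_pairing_sign_neg {n : ℕ × ℕ} {γ : ℝ → ℝ × ℝ} {t : ℝ}
    (h : DifferentiableAt ℝ γ t)
    (h0 : pairing n (γ t) = 0) (hv : pairing n (deriv γ t) < 0) :
    ∀ᶠ s in 𝓝 t, (s < t → 0 < pairing n (γ s)) ∧ (t < s → pairing n (γ s) < 0) := by
  simpa using eventually_sign_of_deriv_pos (hasDerivAt_pairing n h).neg (by simp [h0])
    (neg_pos.2 hv)

/-- This matches the sign convention for crossings: passing from the positive to the negative side
of $n^\perp$ multiplies by $F$, the other direction by $F^{-1}$. -/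
theorem jumpsAt_of_halfplanes {Q : Type*} [Group Q] {Φ : ℝ × ℝ → Q} {A F : Q} {n : ℕ × ℕ}
    {γ : ℝ → ℝ × ℝ} {t : ℝ} (h : DifferentiableAt ℝ γ t) (h0 : pairing n (γ t) = 0)
    (hv : pairing n (deriv γ t) ≠ 0)
    (hΦ : ∀ᶠ w in 𝓝 (γ t), (0 < pairing n w → Φ w = A) ∧ (pairing n w < 0 → Φ w = F * A)) :
    JumpsAt (fun s => Φ (γ s)) (if pairing n (deriv γ t) < 0 then F else F⁻¹) t := by
  have hΦ' := h.continuousAt.eventually hΦ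
  split_ifs with hs
  · refine ⟨A, nhdsWithin_le_nhds ?_⟩
    filter_upwards [hΦ', eventually_pairing_sign_neg h h0 hs] with s h1 h2
    exact ⟨fun h => h1.1 (h2.1 h), fun h => h1.2 (h2.2 h)⟩
  · refine ⟨F * A, nhdsWithin_le_nhds ?_⟩
    filter_upwards [hΦ', eventually_pairing_sign h h0 (lt_of_le_of_ne (not_lt.1 hs) hv.symm)]
      with s h1 h2
    exact ⟨fun h => h1.2 (h2.1 h), fun h => by rw [h1.1 (h2.2 h)]; group⟩

end FixedData

namespace ScatteringDiagram
variable {Γ : FixedData} (D : ScatteringDiagram.{u'} Γ) (ℓ : ℕ)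

open Classical in
/-- The walls through the point `z` that are nontrivial in `G^{≤ℓ}`. -/
def wallsAt (z : ℝ × ℝ) : List D.Index :=
  (D.finite_nontrivial ℓ).toFinset.toList.filter fun i => z ∈ D.cone i

theorem mem_wallsAt {z : ℝ × ℝ} {i : D.Index} :
    i ∈ D.wallsAt ℓ z ↔ (D.wall i).elt ∉ Γ.Ggt ℓ ∧ z ∈ D.cone i := by
  simp [wallsAt]

theorem nodup_wallsAt (z : ℝ × ℝ) : (D.wallsAt ℓ z).Nodup :=
  (Finset.nodup_toList _).filter _

/-- The product of the elements of the walls through `z`. -/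
def elementAt (z : ℝ × ℝ) : Γ.G := ((D.wallsAt ℓ z).map fun i => (D.wall i).elt).prod

variable {D ℓ}

theorem pairing_eq_zero {z : ℝ × ℝ} {i : D.Index} (h : z ∈ D.cone i) :
    pairing (D.wall i).normal z = 0 := (D.wall i).support_subset h

theorem normal_eq {z : ℝ × ℝ} (hz : z ≠ 0) {n : ℕ × ℕ} (hn : Nat.gcd n.1 n.2 = 1)
    (hnz : pairing n z = 0) {i : D.Index} (h : z ∈ D.cone i) : (D.wall i).normal = n :=
  eq_of_pairing_eq_zero (D.wall i).primitive hn hz (pairing_eq_zero h) hnz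

theorem elt_mem_rayGroup {z : ℝ × ℝ} (hz : z ≠ 0) {n : ℕ × ℕ} (hn : Nat.gcd n.1 n.2 = 1)
    (hnz : pairing n z = 0) {i : D.Index} (h : z ∈ D.cone i) :
    (D.wall i).elt ∈ Γ.rayGroup n := by
  rw [← normal_eq hz hn hnz h]
  exact mem_rayGroup_of_mem_Gpar (D.wall i).elt_mem

theorem elementAt_mem_rayGroup {z : ℝ × ℝ} (hz : z ≠ 0) {n : ℕ × ℕ} (hn : Nat.gcd n.1 n.2 = 1)
    (hnz : pairing n z = 0) : D.elementAt ℓ z ∈ Γ.rayGroup n := by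
  refine Submonoid.list_prod_mem _ fun g hg => ?_
  obtain ⟨i, hi, rfl⟩ := List.mem_map.1 hg
  exact elt_mem_rayGroup hz hn hnz ((D.mem_wallsAt ℓ).1 hi).2

theorem elementAt_eq_one {z : ℝ × ℝ} (h : ∀ i, z ∈ D.cone i → (D.wall i).elt ∈ Γ.Ggt ℓ) :
    D.elementAt ℓ z = 1 := by
  have : D.wallsAt ℓ z = [] := List.eq_nil_iff_forall_not_mem.2 fun i hi => by
    rw [mem_wallsAt] at hi
    exact hi.1 (h i hi.2)
  rw [elementAt, this]
  rfl

/-- All walls through a nonzero point of the plane share one primitive normal vector. Their elements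
are supported on one ray and commute, so the order of the product does not matter. -/
theorem elementAt_eq_of_perm {z : ℝ × ℝ} (hz : z ≠ 0) {l : List D.Index}
    (h : l.Perm (D.wallsAt ℓ z)) : (l.map fun i => (D.wall i).elt).prod = D.elementAt ℓ z := by
  refine (h.map _).prod_eq' (List.pairwise_map.2 (List.pairwise_iff_forall_sublist.2
    fun {i j} hij => ?_))
  have hi := ((D.mem_wallsAt ℓ).1 (h.subset (hij.subset (a := i) (by simp)))).2
  have hj := ((D.mem_wallsAt ℓ).1 (h.subset (hij.subset (a := j) (by simp)))).2
  exact commute_of_mem_rayGroup (elt_mem_rayGroup hz (D.wall j).primitive (pairing_eq_zero hj) hi)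
    (mem_rayGroup_of_mem_Gpar (D.wall j).elt_mem)

/-- The crossings with the classes of their factors in `G^{≤ℓ}`. -/
def factors (γ : ℝ → ℝ × ℝ) (ℓ : ℕ) (L : List (ℝ × D.Index)) : List (ℝ × (Γ.G ⧸ Γ.Ggt ℓ)) :=
  L.map fun x => (x.1, ((D.crossing γ x : Γ.G) : Γ.G ⧸ Γ.Ggt ℓ))

theorem mk_pathProduct (γ : ℝ → ℝ × ℝ) (L : List (ℝ × D.Index)) :
    ((D.pathProduct γ L : Γ.G) : Γ.G ⧸ Γ.Ggt ℓ) = ((factors γ ℓ L).map Prod.snd).reverse.prod := by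
  have := map_list_prod (QuotientGroup.mk' (Γ.Ggt ℓ)) (L.map (D.crossing γ)).reverse
  rw [List.map_reverse, List.map_map] at this
  rw [factors, List.map_map]
  exact this

section Crossings
variable {γ : ℝ → ℝ × ℝ} {L : List (ℝ × D.Index)}

theorem IsCrossingList.perm_wallsAt (hL : D.IsCrossingList γ ℓ L) {t : ℝ}
    (ht : t ∈ Set.Icc (0 : ℝ) 1) :
    ((L.filter fun x => x.1 = t).map Prod.snd).Perm (D.wallsAt ℓ (γ t)) := by
  rw [List.perm_ext_iff_of_nodup _ (D.nodup_wallsAt ℓ _)]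
  · intro i
    rw [mem_wallsAt, List.mem_map]
    constructor
    · rintro ⟨⟨s, j⟩, hx, rfl⟩
      rw [List.mem_filter, hL.mem_iff] at hx
      obtain ⟨⟨-, h1, h2⟩, h3⟩ := hx
      simp only [decide_eq_true_eq] at h3
      subst h3
      exact ⟨h2, h1⟩
    · rintro ⟨h1, h2⟩
      refine ⟨(t, i), ?_, rfl⟩
      rw [List.mem_filter, hL.mem_iff]
      exact ⟨⟨ht, h2, h1⟩, by simp⟩
  · refine List.Nodup.map_on ?_ (hL.nodup.filter _)
    rintro x hx y hy hxy
    simp only [List.mem_filter, decide_eq_true_eq] at hx hy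
    exact Prod.ext (hx.2.trans hy.2.symm) hxy

open Classical in
/-- The factor of a curve at the time of a crossing. -/
theorem IsCrossingList.productAt_factors (hL : D.IsCrossingList γ ℓ L) {t : ℝ}
    (ht : t ∈ Set.Icc (0 : ℝ) 1) (hz : γ t ≠ 0) {n : ℕ × ℕ} (hn : Nat.gcd n.1 n.2 = 1)
    (hnz : pairing n (γ t) = 0) :
    productAt (factors γ ℓ L) t = if pairing n (deriv γ t) < 0 then
      ((D.elementAt ℓ (γ t) : Γ.G) : Γ.G ⧸ Γ.Ggt ℓ)
      else ((D.elementAt ℓ (γ t) : Γ.G) : Γ.G ⧸ Γ.Ggt ℓ)⁻¹ := by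
  have hp := hL.perm_wallsAt ht
  have h1 : productAt (factors γ ℓ L) t = QuotientGroup.mk' (Γ.Ggt ℓ)
      (((L.filter fun x => x.1 = t).map (D.crossing γ)).reverse.prod) := by
    rw [map_list_prod, productAt, factors, List.filter_map, List.map_map, List.map_reverse,
      List.map_map]
    rfl
  have h2 : ∀ x ∈ L.filter fun x => x.1 = t, D.crossing γ x =
      if pairing n (deriv γ t) < 0 then (D.wall x.2).elt else (D.wall x.2).elt⁻¹ := by
    intro x hx
    rw [List.mem_filter, hL.mem_iff] at hx
    obtain ⟨⟨-, h1, h2⟩, h3⟩ := hx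
    simp only [decide_eq_true_eq] at h3
    rw [h3] at h1
    rw [crossing, normal_eq hz hn hnz h1, h3]
  rw [h1, List.map_congr_left h2]
  split_ifs with hs
  · rw [← List.map_reverse, ← elementAt_eq_of_perm hz ((List.reverse_perm _).trans hp),
      ← List.map_reverse, List.map_map]
    rfl
  · rw [← elementAt_eq_of_perm hz hp, ← QuotientGroup.mk_inv, List.prod_inv_reverse, List.map_map,
      List.map_map]
    rfl

theorem IsCrossingList.productAt_factors_eq_one (hL : D.IsCrossingList γ ℓ L) {t : ℝ}
    (ht : t ∈ Set.Icc (0 : ℝ) 1) (h : ∀ i, γ t ∈ D.cone i → (D.wall i).elt ∈ Γ.Ggt ℓ) :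
    productAt (factors γ ℓ L) t = 1 := by
  have hp := hL.perm_wallsAt ht
  have : D.wallsAt ℓ (γ t) = [] := List.eq_nil_iff_forall_not_mem.2 fun i hi => by
    rw [mem_wallsAt] at hi
    exact hi.1 (h i hi.2)
  rw [this, List.perm_nil, List.map_eq_nil_iff] at hp
  rw [productAt, factors, List.filter_map]
  simp only [Function.comp_def, hp]
  rfl

theorem sorted_factors (hL : D.IsCrossingList γ ℓ L) :
    (factors γ ℓ L).Pairwise fun x y => x.1 ≤ y.1 :=
  List.pairwise_map.2 hL.sorted

theorem Admissible.ne_zero (hγ : D.Admissible γ) (h0 : 0 ∈ D.sing) {t : ℝ}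
    (ht : t ∈ Set.Icc (0 : ℝ) 1) : γ t ≠ 0 := fun h => hγ.avoids_sing t ht (h ▸ h0)

theorem Admissible.mem_Ioo (hγ : D.Admissible γ) {t : ℝ} (ht : t ∈ Set.Icc (0 : ℝ) 1) {i : D.Index}
    (h : γ t ∈ D.cone i) : t ∈ Set.Ioo (0 : ℝ) 1 := by
  refine ⟨lt_of_le_of_ne ht.1 ?_, lt_of_le_of_ne ht.2 ?_⟩
  · rintro rfl
    exact hγ.left_end (Set.mem_iUnion.2 ⟨i, h⟩)
  · rintro rfl
    exact hγ.right_end (Set.mem_iUnion.2 ⟨i, h⟩)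

theorem Admissible.differentiableAt (hγ : D.Admissible γ) {t : ℝ} (ht : t ∈ Set.Ioo (0 : ℝ) 1) :
    DifferentiableAt ℝ γ t :=
  (hγ.smooth.contDiffAt (Icc_mem_nhds ht.1 ht.2)).differentiableAt (by simp)

theorem Admissible.mem_Ioo_factors (hγ : D.Admissible γ) (hL : D.IsCrossingList γ ℓ L) :
    ∀ x ∈ factors γ ℓ L, x.1 ∈ Set.Ioo (0 : ℝ) 1 := by
  intro x hx
  obtain ⟨y, hy, rfl⟩ := List.mem_map.1 hx
  obtain ⟨h1, h2, -⟩ := (hL.mem_iff y).1 hy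
  exact hγ.mem_Ioo h1 h2

/-- The path-ordered product is determined by the jumps along the curve. -/
theorem Admissible.mk_pathProduct_eq (hγ : D.Admissible γ) (hL : D.IsCrossingList γ ℓ L)
    {g : ℝ → Γ.G ⧸ Γ.Ggt ℓ}
    (hg : ∀ t ∈ Set.Icc (0 : ℝ) 1, JumpsAt g (productAt (factors γ ℓ L) t) t)
    (hg0 : ∀ᶠ s in 𝓝[Set.Icc 0 1] 0, g s = g 0) (hg1 : ∀ᶠ s in 𝓝[Set.Icc 0 1] 1, g s = g 1) :
    ((D.pathProduct γ L : Γ.G) : Γ.G ⧸ Γ.Ggt ℓ) = g 1 * (g 0)⁻¹ := by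
  have hI := hγ.mem_Ioo_factors hL
  have h0 : stepProduct (factors γ ℓ L) 0 = 1 := stepProduct_of_forall_le fun x hx => (hI x hx).1.le
  have h1 := stepProduct_of_forall_lt fun x hx => (hI x hx).2
  -- The product over the crossings before time $s$ is $1$ at the beginning and the whole
  -- path-ordered product at the end, and it has the same jumps as $g$.
  have := inv_mul_eq_of_jumpsAt (fun t _ => jumpsAt_stepProduct (sorted_factors hL) t) hg
    (stepProduct_eventually_zero fun x hx => (hI x hx).1)
    (stepProduct_eventually_one fun x hx => (hI x hx).2) hg0 hg1
  rw [h0, inv_one, one_mul] at this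
  rw [mk_pathProduct, ← h1, this]
  group

end Crossings

/-- Diagrams with the same elements at all points are equivalent. -/
theorem equivUpTo_of_elementAt {D : ScatteringDiagram.{u'} Γ} {D' : ScatteringDiagram.{v'} Γ}
    (h0 : 0 ∈ D.sing) (h : ∀ z, z ≠ 0 → Γ.EqUpTo ℓ (D.elementAt ℓ z) (D'.elementAt ℓ z)) :
    EquivUpTo ℓ D D' := by
  intro γ hγ hγ' L L' hL hL'
  have hI := hγ'.mem_Ioo_factors hL'
  have h1 := hγ.mk_pathProduct_eq hL (g := stepProduct (factors γ ℓ L')) (fun t ht => ?_)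
    (stepProduct_eventually_zero fun x hx => (hI x hx).1)
    (stepProduct_eventually_one fun x hx => (hI x hx).2)
  · rw [stepProduct_of_forall_le fun x hx => (hI x hx).1.le,
      stepProduct_of_forall_lt fun x hx => (hI x hx).2, inv_one, mul_one, ← mk_pathProduct] at h1
    exact h1
  · have : productAt (factors γ ℓ L) t = productAt (factors γ ℓ L') t := by
      -- A point orthogonal to no primitive vector lies on no wall of either diagram. Otherwise the
      -- normal vector is the same for all walls of both diagrams through the point, hence so is the
      -- sign of the crossing.
      by_cases hn : ∃ n : ℕ × ℕ, Nat.gcd n.1 n.2 = 1 ∧ pairing n (γ t) = 0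
      · obtain ⟨n, hn, hnz⟩ := hn
        have hz := hγ.ne_zero h0 ht
        have he : ((D.elementAt ℓ (γ t) : Γ.G) : Γ.G ⧸ Γ.Ggt ℓ) = D'.elementAt ℓ (γ t) := h _ hz
        rw [hL.productAt_factors ht hz hn hnz, hL'.productAt_factors ht hz hn hnz, he]
      · rw [hL.productAt_factors_eq_one ht, hL'.productAt_factors_eq_one ht]
        · exact fun i hi => absurd ⟨_, (D'.wall i).primitive, pairing_eq_zero hi⟩ hn
        · exact fun i hi => absurd ⟨_, (D.wall i).primitive, pairing_eq_zero hi⟩ hn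
    rw [this]
    exact jumpsAt_stepProduct (sorted_factors hL') t

/-- A diagram is consistent if the elements at the points of the walls are the jumps of a function
on the plane. -/
theorem consistentUpTo_of_potential (h0 : 0 ∈ D.sing) (Φ : ℝ × ℝ → Γ.G ⧸ Γ.Ggt ℓ)
    (h1 : ∀ z, z ≠ 0 → z ∉ D.supp → ∀ᶠ w in 𝓝 z, Φ w = Φ z)
    (h2 : ∀ z, z ≠ 0 → ∀ i, z ∈ D.cone i → ∃ A, ∀ᶠ w in 𝓝 z,
      (0 < pairing (D.wall i).normal w → Φ w = A) ∧
      (pairing (D.wall i).normal w < 0 → Φ w = D.elementAt ℓ z * A)) :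
    D.ConsistentUpTo ℓ := by
  intro γ hγ hloop L hL
  have hc : ∀ t ∈ Set.Icc (0 : ℝ) 1, γ t ∉ D.supp → ∀ᶠ s in 𝓝[Set.Icc 0 1] t,
      Φ (γ s) = Φ (γ t) := fun t ht hts =>
    (hγ.smooth.continuousOn t ht).eventually (h1 _ (hγ.ne_zero h0 ht) hts)
  have := hγ.mk_pathProduct_eq hL (g := fun s => Φ (γ s)) (fun t ht => ?_)
    (hc 0 (by simp) hγ.left_end) (hc 1 (by simp) hγ.right_end)
  · rw [hloop, mul_inv_cancel] at this
    exact this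
  · by_cases hts : γ t ∈ D.supp
    · obtain ⟨i, hi⟩ := Set.mem_iUnion.1 hts
      obtain ⟨A, hA⟩ := h2 _ (hγ.ne_zero h0 ht) i hi
      rw [hL.productAt_factors ht (hγ.ne_zero h0 ht) (D.wall i).primitive (pairing_eq_zero hi)]
      exact jumpsAt_of_halfplanes (hγ.differentiableAt (hγ.mem_Ioo ht hi)) (pairing_eq_zero hi)
        (hγ.transversal t ht i hi) hA
    · rw [hL.productAt_factors_eq_one ht fun i hi => absurd (Set.mem_iUnion.2 ⟨i, hi⟩) hts]
      exact jumpsAt_of_eventually_eq (hc t ht hts)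

end ScatteringDiagram
-- A piecewise constant function on the plane with prescribed jumps across rays.
theorem slopes_pairwise_lt : slopes.Pairwise fun m n => m.2 * n.1 < m.1 * n.2 := by
  decide

/-- A wall whose normal vector is not in the list has a normal vector of degree above four, so its
element is trivial modulo $G^{>4}$. -/
theorem mem_slopes {n : ℕ × ℕ} (hn : Nat.gcd n.1 n.2 = 1) (hd : deg n ≤ 4) : n ∈ slopes := by
  obtain ⟨a, b⟩ := n
  simp only [deg] at hd hn
  have ha : a ≤ 4 := by omega
  have hb : b ≤ 4 := by omega
  interval_cases a <;> interval_cases b <;> simp_all [slopes]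

theorem gcd_eq_one_of_mem_slopes : ∀ n ∈ slopes, Nat.gcd n.1 n.2 = 1 := by
  decide

/-- A point orthogonal to `n` on the side of the fourth quadrant. -/
theorem exists_eq_smul {n : ℕ × ℕ} (hn : n ≠ 0) {z : ℝ × ℝ} (hz : 0 < z.1 ∨ z.2 < 0)
    (h : pairing n z = 0) : ∃ c : ℝ, 0 < c ∧ z = c • ((n.2 : ℝ), -(n.1 : ℝ)) := by
  unfold pairing at h
  rcases hz with hz | hz
  · have h2 : n.2 ≠ 0 := by
      intro h2
      have h1 : n.1 ≠ 0 := fun h1 => hn (Prod.ext h1 h2)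
      have : (0 : ℝ) < n.1 * z.1 := mul_pos (by positivity) hz
      rw [h2] at h
      simp at h
      rcases h with h | h
      · exact h1 h
      · exact hz.ne' h
    have h2' : (0 : ℝ) < n.2 := by positivity
    refine ⟨z.1 / n.2, by positivity, Prod.ext ?_ ?_⟩
    · simp [h2'.ne']
    · simp only [Prod.smul_mk, smul_eq_mul]
      field_simp
      linarith
  · have h1 : n.1 ≠ 0 := by
      intro h1
      have h2 : n.2 ≠ 0 := fun h2 => hn (Prod.ext h1 h2)
      rw [h1] at h
      simp at h
      rcases h with h | h
      · exact h2 h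
      · exact hz.ne h
    have h1' : (0 : ℝ) < n.1 := by positivity
    refine ⟨-z.2 / n.1, div_pos (neg_pos.2 hz) h1', Prod.ext ?_ ?_⟩
    · simp only [Prod.smul_mk, smul_eq_mul]
      field_simp
      linarith
    · simp [h1'.ne']

section Potential
variable {Q : Type*} [Group Q] (J : ℕ × ℕ → Q) (κ : Q)

/-- The product over the rays between the third quadrant and `z`, counterclockwise. -/
def sectorProduct (z : ℝ × ℝ) : Q :=
  ((slopes.filter fun n => 0 < pairing n z).map J).reverse.prod

/-- The function on the plane with value `1` on the third quadrant, value `κ` on the second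
quadrant, and jump `J n` across the ray spanned by `(n.2, -n.1)` for `n` in `slopes`. -/
def potential (z : ℝ × ℝ) : Q := if z.1 < 0 ∧ 0 < z.2 then κ else sectorProduct J z

variable {J κ}

theorem eventually_pairing_pos {n : ℕ × ℕ} {z : ℝ × ℝ} (h : 0 < pairing n z) :
    ∀ᶠ w in 𝓝 z, 0 < pairing n w :=
  (continuous_pairing n).continuousAt.eventually (lt_mem_nhds h)

theorem eventually_pairing_neg {n : ℕ × ℕ} {z : ℝ × ℝ} (h : pairing n z < 0) :
    ∀ᶠ w in 𝓝 z, pairing n w < 0 :=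
  (continuous_pairing n).continuousAt.eventually (gt_mem_nhds h)

theorem potential_eventually_eq_sectorProduct {z : ℝ × ℝ} (hz : 0 < z.1 ∨ z.2 < 0) :
    ∀ᶠ w in 𝓝 z, potential J κ w = sectorProduct J w := by
  rcases hz with hz | hz
  · filter_upwards [continuous_fst.continuousAt.eventually (lt_mem_nhds hz)] with w hw
    exact if_neg fun h => h.1.not_gt hw
  · filter_upwards [continuous_snd.continuousAt.eventually (gt_mem_nhds hz)] with w hw
    exact if_neg fun h => h.2.not_gt hw

theorem potential_eventually_of_mem {z : ℝ × ℝ} (hz : 0 < z.1 ∨ z.2 < 0) {n : ℕ × ℕ}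
    (hn : n ∈ slopes) (h : pairing n z = 0) :
    ∃ A, ∀ᶠ w in 𝓝 z, potential J κ w = (if 0 < pairing n w then J n else 1) * A := by
  obtain ⟨c, hc, hzc⟩ := exists_eq_smul (ne_zero_of_mem_slopes hn) hz h
  obtain ⟨l₁, l₂, hl⟩ := List.append_of_mem hn
  have hp := slopes_pairwise_lt
  rw [hl, List.pairwise_append, List.pairwise_cons] at hp
  obtain ⟨-, ⟨hp₂, -⟩, hp₁⟩ := hp
  have hz' : ∀ m, pairing m z = c * (m.1 * n.2 - m.2 * n.1) := by
    intro m
    rw [hzc, pairing]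
    simp only [Prod.smul_mk, smul_eq_mul]
    ring
  -- At the ray of $n$ the slopes before $n$ pair positively with the point and those after $n$
  -- negatively. Nearby, only the sign of the pairing with $n$ can change, so only the factor $J(n)$
  -- appears or disappears.
  have h₁ : ∀ᶠ w in 𝓝 z, ∀ m ∈ l₁, 0 < pairing m w := by
    refine l₁.finite_toSet.eventually_all.2 fun m hm => eventually_pairing_pos ?_
    rw [hz']
    refine mul_pos hc (sub_pos.2 ?_)
    exact_mod_cast hp₁ m hm n (by simp)
  have h₂ : ∀ᶠ w in 𝓝 z, ∀ m ∈ l₂, pairing m w < 0 := by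
    refine l₂.finite_toSet.eventually_all.2 fun m hm => eventually_pairing_neg ?_
    rw [hz']
    refine mul_neg_of_pos_of_neg hc (sub_neg.2 ?_)
    have := hp₂ m hm
    rw [mul_comm n.2, mul_comm n.1] at this
    exact_mod_cast this
  refine ⟨(l₁.map J).reverse.prod, ?_⟩
  filter_upwards [potential_eventually_eq_sectorProduct (J := J) (κ := κ) hz, h₁, h₂]
    with w hw hw₁ hw₂
  have e₁ : (l₁.filter fun m => 0 < pairing m w) = l₁ :=
    List.filter_eq_self.2 fun m hm => by simpa using hw₁ m hm
  have e₂ : (l₂.filter fun m => 0 < pairing m w) = [] :=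
    List.filter_eq_nil_iff.2 fun m hm => by simpa using (hw₂ m hm).le
  rw [hw, sectorProduct, hl, List.filter_append, List.filter_cons, e₁, e₂]
  by_cases hnw : 0 < pairing n w <;> simp [hnw]

theorem potential_eventually_of_ne {z : ℝ × ℝ} (hz : 0 < z.1 ∨ z.2 < 0)
    (h : ∀ n ∈ slopes, pairing n z ≠ 0) : ∀ᶠ w in 𝓝 z, potential J κ w = potential J κ z := by
  have h' : ∀ᶠ w in 𝓝 z, ∀ m ∈ slopes, (0 < pairing m w ↔ 0 < pairing m z) := by
    refine slopes.finite_toSet.eventually_all.2 fun m hm => ?_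
    rcases lt_or_gt_of_ne (h m hm) with hm | hm
    · filter_upwards [eventually_pairing_neg hm] with w hw
      simp [hm.not_gt, hw.not_gt]
    · filter_upwards [eventually_pairing_pos hm] with w hw
      simp [hm, hw]
  have h0 := potential_eventually_eq_sectorProduct (J := J) (κ := κ) hz
  filter_upwards [h0, h'] with w hw hw'
  rw [hw, h0.self_of_nhds, sectorProduct, sectorProduct]
  congr 3
  exact List.filter_congr fun m hm => by simp only [hw' m hm]

theorem potential_eventually_of_second_quadrant {z : ℝ × ℝ} (h1 : z.1 < 0) (h2 : 0 < z.2) :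
    ∀ᶠ w in 𝓝 z, potential J κ w = κ := by
  filter_upwards [continuous_fst.continuousAt.eventually (gt_mem_nhds h1),
    continuous_snd.continuousAt.eventually (lt_mem_nhds h2)] with w hw1 hw2
  exact if_pos ⟨hw1, hw2⟩

theorem potential_eventually_top {z : ℝ × ℝ} (h2 : 0 < z.2) :
    ∀ᶠ w in 𝓝 z, (w.1 < 0 → potential J κ w = κ) ∧
      (0 < w.1 → potential J κ w = (slopes.map J).reverse.prod) := by
  filter_upwards [continuous_snd.continuousAt.eventually (lt_mem_nhds h2)] with w hw2
  refine ⟨fun hw1 => if_pos ⟨hw1, hw2⟩, fun hw1 => ?_⟩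
  rw [potential, if_neg fun h => h.1.not_gt hw1, sectorProduct]
  congr 3
  refine List.filter_eq_self.2 fun n hn => ?_
  have h1 : (0 : ℝ) ≤ n.1 := Nat.cast_nonneg _
  have h2 : (0 : ℝ) ≤ n.2 := Nat.cast_nonneg _
  rw [decide_eq_true_eq]
  refine lt_of_le_of_ne (by unfold pairing; positivity) fun h0 => ?_
  have h3 : (n.1 : ℝ) * w.1 = 0 ∧ (n.2 : ℝ) * w.2 = 0 :=
    (add_eq_zero_iff_of_nonneg (by positivity) (by positivity)).1 h0.symm
  exact ne_zero_of_mem_slopes hn (Prod.ext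
    (by simpa [hw1.ne'] using h3.1) (by simpa [hw2.ne'] using h3.2))

theorem potential_eq_one {z : ℝ × ℝ} (h1 : z.1 < 0) (h2 : z.2 < 0) : potential J κ z = 1 := by
  rw [potential, if_neg fun h => h.2.not_gt h2, sectorProduct]
  have : (slopes.filter fun n => 0 < pairing n z) = [] := by
    refine List.filter_eq_nil_iff.2 fun n _ => ?_
    rw [decide_eq_true_eq, not_lt]
    exact add_nonpos (mul_nonpos_of_nonneg_of_nonpos (Nat.cast_nonneg _) h1.le)
      (mul_nonpos_of_nonneg_of_nonpos (Nat.cast_nonneg _) h2.le)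
  rw [this]
  rfl

theorem potential_eventually_left {z : ℝ × ℝ} (h1 : z.1 < 0) :
    ∀ᶠ w in 𝓝 z, (0 < w.2 → potential J κ w = κ) ∧ (w.2 < 0 → potential J κ w = 1) := by
  filter_upwards [continuous_fst.continuousAt.eventually (gt_mem_nhds h1)] with w hw1
  exact ⟨fun hw2 => if_pos ⟨hw1, hw2⟩, fun hw2 => potential_eq_one hw1 hw2⟩

end Potential

/-! ### Orientation, and consistency of a diagram of rays. -/

namespace FixedData
variable (Γ : FixedData)

/-- The sign of the form. -/
def sgn : ℝ := if 0 < Γ.ω then 1 else -1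

/-- The contribution of a counterclockwise crossing of an outgoing ray with element `g`. -/
def orient {Q : Type*} [Group Q] (g : Q) : Q := if 0 < Γ.ω then g⁻¹ else g

variable {Γ}

theorem sgn_mul_sgn : Γ.sgn * Γ.sgn = 1 := by
  unfold sgn
  split_ifs <;> norm_num

theorem sgn_smul_sgn_smul (z : ℝ × ℝ) : Γ.sgn • Γ.sgn • z = z := by
  rw [smul_smul, sgn_mul_sgn, one_smul]

theorem pairing_smul (n : ℕ × ℕ) (c : ℝ) (z : ℝ × ℝ) : pairing n (c • z) = c * pairing n z := by
  simp only [pairing, Prod.smul_fst, Prod.smul_snd, smul_eq_mul]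
  ring

/-- For negative $\omega$ the plane is turned by a half turn, which exchanges the two sides of each
line; `orient` compensates for this, so that both signs share the same model. -/
theorem exists_halfplanes {Q : Type*} [Group Q] {Φ : ℝ × ℝ → Q} {A g : Q} {n : ℕ × ℕ} {z : ℝ × ℝ}
    (h : ∀ᶠ w in 𝓝 (Γ.sgn • z), (pairing n w < 0 → Φ w = A) ∧
      (0 < pairing n w → Φ w = Γ.orient g * A)) :
    ∃ A, ∀ᶠ w in 𝓝 z, (0 < pairing n w → Φ (Γ.sgn • w) = A) ∧
      (pairing n w < 0 → Φ (Γ.sgn • w) = g * A) := by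
  have h' := (continuous_const_smul Γ.sgn).continuousAt.eventually h
  simp only [pairing_smul] at h'
  unfold sgn orient at h'
  unfold sgn
  split_ifs at h' ⊢ with hω
  · refine ⟨g⁻¹ * A, h'.mono fun w hw => ?_⟩
    simp only [one_mul] at hw
    exact ⟨hw.2, fun h => by rw [hw.1 h]; group⟩
  · refine ⟨A, h'.mono fun w hw => ?_⟩
    simp only [neg_mul, one_mul, Left.neg_neg_iff, Left.neg_pos_iff] at hw
    exact hw

end FixedData

/-- The cases follow the definition of the potential: the complement of the closed second quadrant,
on or off the rays of the slopes, then the two boundary half-axes of that quadrant, which are the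
incoming rays, then its interior. -/
theorem plane_cases {z : ℝ × ℝ} (hz : z ≠ 0) :
    ((0 < z.1 ∨ z.2 < 0) ∧ ∃ n ∈ slopes, pairing n z = 0) ∨
    ((0 < z.1 ∨ z.2 < 0) ∧ ∀ n ∈ slopes, pairing n z ≠ 0) ∨
    (z.1 = 0 ∧ 0 < z.2) ∨ (z.1 < 0 ∧ z.2 = 0) ∨ (z.1 < 0 ∧ 0 < z.2) := by
  by_cases hU : 0 < z.1 ∨ z.2 < 0
  · by_cases hn : ∃ n ∈ slopes, pairing n z = 0
    · exact Or.inl ⟨hU, hn⟩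
    · exact Or.inr (Or.inl ⟨hU, fun n hn' h => hn ⟨n, hn', h⟩⟩)
  · push Not at hU
    rcases hU.1.lt_or_eq with h1 | h1 <;> rcases hU.2.lt_or_eq with h2 | h2
    · exact Or.inr (Or.inr (Or.inr (Or.inr ⟨h1, h2⟩)))
    · exact Or.inr (Or.inr (Or.inr (Or.inl ⟨h1, h2.symm⟩)))
    · exact Or.inr (Or.inr (Or.inl ⟨h1, h2⟩))
    · exact absurd (Prod.ext h1 h2.symm) hz

theorem pairing_e_zero (z : ℝ × ℝ) : pairing (e 0) z = z.1 := by simp [pairing, e]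

theorem pairing_e_one (z : ℝ × ℝ) : pairing (e 1) z = z.2 := by simp [pairing, e]

theorem gcd_e (k : Fin 2) : Nat.gcd (e k).1 (e k).2 = 1 := by
  fin_cases k <;> simp [e]

namespace FixedData

/-- The elements of the incoming walls. -/
def seed (Γ : FixedData) (k : Fin 2) : Γ.G := Γ.Psi (1 / (Γ.δ k : ℚ)) 0 (e k)

variable {Γ : FixedData}

theorem sgn_ne_zero : Γ.sgn ≠ 0 := by
  unfold sgn
  split_ifs <;> norm_num

theorem orient_one {Q : Type*} [Group Q] : Γ.orient (1 : Q) = 1 := by simp [orient]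

variable (Γ) in
/-- The ordered product of the elements of the outgoing rays agrees with the product of the
elements of the incoming walls. -/
def Factorizes (ℓ : ℕ) (H : ℕ × ℕ → Γ.G) : Prop :=
  (0 < Γ.ω → Γ.EqUpTo ℓ (Γ.seed 1 * Γ.seed 0) (slopes.map H).prod) ∧
  (Γ.ω < 0 → Γ.EqUpTo ℓ (Γ.seed 0 * Γ.seed 1) (slopes.reverse.map H).prod)

/-- For positive $\omega$ the right side is the factorization with both members inverted; for
negative $\omega$ it is the factorization itself. In this form it says that the counterclockwise
jumps around the origin close up. -/
theorem factorizes_iff (hω : Γ.ω ≠ 0) {ℓ : ℕ} {H : ℕ × ℕ → Γ.G} :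
    Γ.Factorizes ℓ H ↔
      (slopes.map fun n => Γ.orient ((H n : Γ.G) : Γ.G ⧸ Γ.Ggt ℓ)).reverse.prod =
      Γ.orient ((Γ.seed 0 : Γ.G) : Γ.G ⧸ Γ.Ggt ℓ) *
        Γ.orient ((Γ.seed 1 : Γ.G) : Γ.G ⧸ Γ.Ggt ℓ) := by
  have h1 : ∀ l : List (ℕ × ℕ), (((l.map H).prod : Γ.G) : Γ.G ⧸ Γ.Ggt ℓ) =
      (l.map fun n => ((H n : Γ.G) : Γ.G ⧸ Γ.Ggt ℓ)).prod := by
    intro l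
    have := map_list_prod (QuotientGroup.mk' (Γ.Ggt ℓ)) (l.map H)
    rw [List.map_map] at this
    exact this
  rcases lt_or_gt_of_ne hω with hω | hω
  · simp only [Factorizes, hω.not_gt, hω, false_imp_iff, true_and, true_imp_iff, orient, if_false,
      EqUpTo, h1, List.map_reverse, QuotientGroup.mk_mul]
    exact eq_comm
  · have h2 : (slopes.map fun n => ((H n : Γ.G) : Γ.G ⧸ Γ.Ggt ℓ)⁻¹).reverse.prod =
        ((slopes.map fun n => ((H n : Γ.G) : Γ.G ⧸ Γ.Ggt ℓ)).prod)⁻¹ := by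
      rw [List.prod_inv_reverse, List.map_map]
      rfl
    simp only [Factorizes, hω.not_gt, hω, false_imp_iff, and_true, true_imp_iff, orient, if_true,
      EqUpTo, h1, QuotientGroup.mk_mul, h2, ← mul_inv_rev, inv_inj]
    exact eq_comm

end FixedData

namespace ScatteringDiagram
variable {Γ : FixedData} {ℓ : ℕ}

/-- The elements at the points of the plane: `H n` on the outgoing ray orthogonal to `n`, the seed
elements on the incoming rays, and trivial elsewhere. -/
structure Rays (D : ScatteringDiagram.{u'} Γ) (ℓ : ℕ) (H : ℕ × ℕ → Γ.G) : Prop where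
  outgoing : ∀ n ∈ slopes, ∀ c : ℝ, 0 < c →
    Γ.EqUpTo ℓ (D.elementAt ℓ (Γ.sgn • c • ((n.2 : ℝ), -(n.1 : ℝ)))) (H n)
  generic : ∀ z : ℝ × ℝ, 0 < z.1 ∨ z.2 < 0 → (∀ n ∈ slopes, pairing n z ≠ 0) →
    Γ.EqUpTo ℓ (D.elementAt ℓ (Γ.sgn • z)) 1
  top : ∀ z : ℝ × ℝ, z.1 = 0 → 0 < z.2 → Γ.EqUpTo ℓ (D.elementAt ℓ (Γ.sgn • z)) (Γ.seed 0)
  left : ∀ z : ℝ × ℝ, z.1 < 0 → z.2 = 0 → Γ.EqUpTo ℓ (D.elementAt ℓ (Γ.sgn • z)) (Γ.seed 1)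
  second_quadrant : ∀ z : ℝ × ℝ, z.1 < 0 → 0 < z.2 →
    Γ.EqUpTo ℓ (D.elementAt ℓ (Γ.sgn • z)) 1

theorem Rays.elementAt_eq {D : ScatteringDiagram.{u'} Γ} {D' : ScatteringDiagram.{v'} Γ}
    {H H' : ℕ × ℕ → Γ.G} (hD : D.Rays ℓ H) (hD' : D'.Rays ℓ H')
    (h : ∀ n ∈ slopes, Γ.EqUpTo ℓ (H n) (H' n)) (z : ℝ × ℝ) (hz : z ≠ 0) :
    Γ.EqUpTo ℓ (D.elementAt ℓ z) (D'.elementAt ℓ z) := by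
  rw [← sgn_smul_sgn_smul (Γ := Γ) z]
  have hz' : Γ.sgn • z ≠ 0 := smul_ne_zero sgn_ne_zero hz
  generalize Γ.sgn • z = w at hz'
  rcases plane_cases hz' with ⟨h1, n, hn, h2⟩ | ⟨h1, h2⟩ | ⟨h1, h2⟩ | ⟨h1, h2⟩ | ⟨h1, h2⟩
  · obtain ⟨c, hc, rfl⟩ := exists_eq_smul (ne_zero_of_mem_slopes hn) h1 h2
    exact ((hD.outgoing n hn c hc).trans (h n hn)).trans (hD'.outgoing n hn c hc).symm
  · exact (hD.generic w h1 h2).trans (hD'.generic w h1 h2).symm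
  · exact (hD.top w h1 h2).trans (hD'.top w h1 h2).symm
  · exact (hD.left w h1 h2).trans (hD'.left w h1 h2).symm
  · exact (hD.second_quadrant w h1 h2).trans (hD'.second_quadrant w h1 h2).symm

variable {D : ScatteringDiagram.{u'} Γ} {H : ℕ × ℕ → Γ.G}

/-- The jump of the potential across an outgoing ray or a point without nontrivial walls. -/
theorem Rays.exists_halfplanes (hD : D.Rays ℓ H) {κ : Γ.G ⧸ Γ.Ggt ℓ} {z : ℝ × ℝ} {n : ℕ × ℕ}
    (hz : z ≠ 0) (hn : Nat.gcd n.1 n.2 = 1) (hnz : pairing n z = 0)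
    (hU : (0 < (Γ.sgn • z).1 ∨ (Γ.sgn • z).2 < 0) ∨ (Γ.sgn • z).1 < 0 ∧ 0 < (Γ.sgn • z).2) :
    ∃ A, ∀ᶠ w in 𝓝 z,
      (0 < pairing n w → potential (fun n => Γ.orient ((H n : Γ.G) : Γ.G ⧸ Γ.Ggt ℓ)) κ
        (Γ.sgn • w) = A) ∧
      (pairing n w < 0 → potential (fun n => Γ.orient ((H n : Γ.G) : Γ.G ⧸ Γ.Ggt ℓ)) κ
        (Γ.sgn • w) = D.elementAt ℓ z * A) := by
  rw [← sgn_smul_sgn_smul (Γ := Γ) z]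
  have hz' : Γ.sgn • z ≠ 0 := smul_ne_zero sgn_ne_zero hz
  have hnz' : pairing n (Γ.sgn • z) = 0 := by rw [pairing_smul, hnz, mul_zero]
  generalize Γ.sgn • z = y at hU hz' hnz'
  have const : ∀ A : Γ.G ⧸ Γ.Ggt ℓ, Γ.EqUpTo ℓ (D.elementAt ℓ (Γ.sgn • y)) 1 →
      (∀ᶠ w in 𝓝 y, potential (fun n => Γ.orient ((H n : Γ.G) : Γ.G ⧸ Γ.Ggt ℓ)) κ w = A) →
      ∀ᶠ w in 𝓝 y, (pairing n w < 0 →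
        potential (fun n => Γ.orient ((H n : Γ.G) : Γ.G ⧸ Γ.Ggt ℓ)) κ w = A) ∧
        (0 < pairing n w → potential (fun n => Γ.orient ((H n : Γ.G) : Γ.G ⧸ Γ.Ggt ℓ)) κ w =
          Γ.orient ((D.elementAt ℓ (Γ.sgn • y) : Γ.G) : Γ.G ⧸ Γ.Ggt ℓ) * A) := by
    intro A h1 h2
    have h1 : ((D.elementAt ℓ (Γ.sgn • y) : Γ.G) : Γ.G ⧸ Γ.Ggt ℓ) = 1 := h1
    filter_upwards [h2] with w hw
    rw [h1, orient_one, one_mul]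
    exact ⟨fun _ => hw, fun _ => hw⟩
  suffices h : ∃ A, ∀ᶠ w in 𝓝 y, (pairing n w < 0 →
      potential (fun n => Γ.orient ((H n : Γ.G) : Γ.G ⧸ Γ.Ggt ℓ)) κ w = A) ∧
      (0 < pairing n w → potential (fun n => Γ.orient ((H n : Γ.G) : Γ.G ⧸ Γ.Ggt ℓ)) κ w =
        Γ.orient ((D.elementAt ℓ (Γ.sgn • y) : Γ.G) : Γ.G ⧸ Γ.Ggt ℓ) * A) by
    obtain ⟨A, hA⟩ := h
    refine FixedData.exists_halfplanes (A := A) ?_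
    rwa [sgn_smul_sgn_smul]
  rcases hU with hU | hU
  · by_cases hm : ∃ m ∈ slopes, pairing m y = 0
    · obtain ⟨m, hm, hmy⟩ := hm
      obtain rfl := eq_of_pairing_eq_zero hn (gcd_eq_one_of_mem_slopes m hm) hz' hnz' hmy
      obtain ⟨A, hA⟩ := potential_eventually_of_mem
        (J := fun n => Γ.orient ((H n : Γ.G) : Γ.G ⧸ Γ.Ggt ℓ)) (κ := κ) hU hm hmy
      obtain ⟨c, hc, rfl⟩ := exists_eq_smul (ne_zero_of_mem_slopes hm) hU hmy
      have he : ((D.elementAt ℓ (Γ.sgn • c • ((n.2 : ℝ), -(n.1 : ℝ))) : Γ.G) : Γ.G ⧸ Γ.Ggt ℓ) =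
        H n := hD.outgoing n hm c hc
      refine ⟨A, hA.mono fun w hw => ⟨fun h => ?_, fun h => ?_⟩⟩
      · rw [hw, if_neg h.not_gt, one_mul]
      · rw [hw, if_pos h, he]
    · push Not at hm
      exact ⟨_, const _ (hD.generic y hU hm) (potential_eventually_of_ne hU hm)⟩
  · exact ⟨_, const _ (hD.second_quadrant y hU.1 hU.2)
      (potential_eventually_of_second_quadrant hU.1 hU.2)⟩

theorem Rays.consistentUpTo (hω : Γ.ω ≠ 0) (hD : D.Rays ℓ H) (hH : Γ.Factorizes ℓ H)
    (h0 : 0 ∈ D.sing) (htop : ∀ z : ℝ × ℝ, z.1 = 0 → 0 < z.2 → Γ.sgn • z ∈ D.supp)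
    (hleft : ∀ z : ℝ × ℝ, z.1 < 0 → z.2 = 0 → Γ.sgn • z ∈ D.supp) : D.ConsistentUpTo ℓ := by
  rw [factorizes_iff hω] at hH
  -- The value on the second quadrant is chosen to make the jump across the left incoming ray
  -- correct. The jump across the top incoming ray is then correct by the factorization.
  refine consistentUpTo_of_potential h0 (fun z =>
    potential (fun n => Γ.orient ((H n : Γ.G) : Γ.G ⧸ Γ.Ggt ℓ))
      (Γ.orient ((Γ.seed 1 : Γ.G) : Γ.G ⧸ Γ.Ggt ℓ)) (Γ.sgn • z)) ?_ ?_
  · intro z hz hs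
    have h1 : D.elementAt ℓ z = 1 :=
      elementAt_eq_one fun i hi => absurd (Set.mem_iUnion.2 ⟨i, hi⟩) hs
    rw [← sgn_smul_sgn_smul (Γ := Γ) z] at h1 hs
    have hz' : Γ.sgn • z ≠ 0 := smul_ne_zero sgn_ne_zero hz
    refine (continuous_const_smul Γ.sgn).continuousAt.eventually (p := fun w =>
      potential _ _ w = potential _ _ (Γ.sgn • z)) ?_
    beta_reduce
    generalize Γ.sgn • z = y at h1 hs hz'
    rcases plane_cases hz' with ⟨h2, n, hn, h3⟩ | ⟨h2, h3⟩ | ⟨h2, h3⟩ | ⟨h2, h3⟩ | ⟨h2, h3⟩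
    · obtain ⟨A, hA⟩ := potential_eventually_of_mem
        (J := fun n => Γ.orient ((H n : Γ.G) : Γ.G ⧸ Γ.Ggt ℓ))
        (κ := Γ.orient ((Γ.seed 1 : Γ.G) : Γ.G ⧸ Γ.Ggt ℓ)) h2 hn h3
      obtain ⟨c, hc, rfl⟩ := exists_eq_smul (ne_zero_of_mem_slopes hn) h2 h3
      -- A point of an outgoing ray may lie on no wall. Then the element there is trivial, hence so
      -- is the class of $H(n)$, and the potential does not jump.
      have he := hD.outgoing n hn c hc
      rw [h1] at he
      have he : (1 : Γ.G ⧸ Γ.Ggt ℓ) = H n := he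
      simp only [← he, orient_one, ite_self, one_mul] at hA
      have hA' := hA.self_of_nhds
      exact hA.mono fun w hw => hw.trans hA'.symm
    · exact potential_eventually_of_ne h2 h3
    · exact absurd (htop y h2 h3) hs
    · exact absurd (hleft y h2 h3) hs
    · have hA := potential_eventually_of_second_quadrant
        (J := fun n => Γ.orient ((H n : Γ.G) : Γ.G ⧸ Γ.Ggt ℓ))
        (κ := Γ.orient ((Γ.seed 1 : Γ.G) : Γ.G ⧸ Γ.Ggt ℓ)) h2 h3
      have hA' := hA.self_of_nhds
      exact hA.mono fun w hw => hw.trans hA'.symm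
  · intro z hz i hi
    have hnz := pairing_eq_zero hi
    have hz' : Γ.sgn • z ≠ 0 := smul_ne_zero sgn_ne_zero hz
    have hnz' : pairing (D.wall i).normal (Γ.sgn • z) = 0 := by rw [pairing_smul, hnz, mul_zero]
    have hprim := (D.wall i).primitive
    rcases plane_cases hz' with ⟨h2, -⟩ | ⟨h2, -⟩ | ⟨h2, h3⟩ | ⟨h2, h3⟩ | h2
    · exact hD.exists_halfplanes hz hprim hnz (Or.inl h2)
    · exact hD.exists_halfplanes hz hprim hnz (Or.inl h2)
    · have hn := eq_of_pairing_eq_zero hprim (gcd_e 0) hz' hnz' (by rw [pairing_e_zero, h2])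
      have he : ((D.elementAt ℓ z : Γ.G) : Γ.G ⧸ Γ.Ggt ℓ) = Γ.seed 0 := by
        have := hD.top _ h2 h3
        rwa [sgn_smul_sgn_smul] at this
      rw [he, hn]
      refine FixedData.exists_halfplanes (A := Γ.orient ((Γ.seed 1 : Γ.G) : Γ.G ⧸ Γ.Ggt ℓ)) ?_
      filter_upwards [potential_eventually_top
        (J := fun n => Γ.orient ((H n : Γ.G) : Γ.G ⧸ Γ.Ggt ℓ))
        (κ := Γ.orient ((Γ.seed 1 : Γ.G) : Γ.G ⧸ Γ.Ggt ℓ)) h3] with w hw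
      rw [pairing_e_zero, ← hH]
      exact hw
    · have hn := eq_of_pairing_eq_zero hprim (gcd_e 1) hz' hnz' (by rw [pairing_e_one, h3])
      have he : ((D.elementAt ℓ z : Γ.G) : Γ.G ⧸ Γ.Ggt ℓ) = Γ.seed 1 := by
        have := hD.left _ h2 h3
        rwa [sgn_smul_sgn_smul] at this
      rw [he, hn]
      refine FixedData.exists_halfplanes (A := 1) ?_
      filter_upwards [potential_eventually_left
        (J := fun n => Γ.orient ((H n : Γ.G) : Γ.G ⧸ Γ.Ggt ℓ))
        (κ := Γ.orient ((Γ.seed 1 : Γ.G) : Γ.G ⧸ Γ.Ggt ℓ)) h2] with w hw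
      rw [pairing_e_one, mul_one]
      exact hw.symm
    · exact hD.exists_halfplanes hz hprim hnz (Or.inr h2)

end ScatteringDiagram
-- Incoming directions, singular points and existence of crossing lists.
namespace FixedData
variable {Γ : FixedData}

theorem sgn_mul_ω : Γ.sgn * (Γ.ω : ℝ) = |(Γ.ω : ℝ)| := by
  unfold sgn
  split_ifs with h
  · rw [one_mul, abs_of_pos (by exact_mod_cast h)]
  · rw [neg_one_mul, abs_of_nonpos (by exact_mod_cast not_lt.1 h)]

theorem pStar_eq (n : ℕ × ℕ) : Γ.pStar n = (Γ.ω : ℝ) • (-(n.2 : ℝ), (n.1 : ℝ)) := by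
  simp [pStar, form, e]

/-- A point of `n^⊥` outside the half-plane of the outgoing rays is a multiple of `p*(n)`. -/
theorem exists_pStar_eq (hω : Γ.ω ≠ 0) {n : ℕ × ℕ} (hn : n ≠ 0) {z : ℝ × ℝ} (hz : z.1 < 0 ∨ 0 < z.2)
    (h : pairing n z = 0) : ∃ c : ℝ, 0 ≤ c ∧ Γ.pStar n = c • Γ.sgn • z := by
  obtain ⟨c, hc, hzc⟩ := exists_eq_smul hn (z := (-1 : ℝ) • z) (by simpa using hz)
    (by rw [pairing_smul, h, mul_zero])
  have hzc' : z = c • (-(n.2 : ℝ), (n.1 : ℝ)) := by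
    rw [← neg_neg z, ← neg_one_smul ℝ z, hzc]
    simp
  refine ⟨|(Γ.ω : ℝ)| / c, by positivity, ?_⟩
  rw [pStar_eq, ← sgn_mul_ω, hzc', smul_smul, smul_smul]
  congr 1
  have := sgn_mul_sgn (Γ := Γ)
  field_simp
  linear_combination -this

end FixedData

namespace ScatteringDiagram
variable {Γ : FixedData} {D : ScatteringDiagram.{u'} Γ} {ℓ : ℕ}

theorem smul_mem_cone {i : D.Index} {z : ℝ × ℝ} (hz : z ∈ D.cone i) {c : ℝ} (hc : 0 ≤ c) :
    c • z ∈ D.cone i := (D.wall i).support.smul_mem hc hz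

theorem smul_mem_cone_iff {i : D.Index} {z : ℝ × ℝ} {c : ℝ} (hc : 0 < c) :
    c • z ∈ D.cone i ↔ z ∈ D.cone i := by
  refine ⟨fun h => ?_, fun h => smul_mem_cone h hc.le⟩
  have := smul_mem_cone h (inv_pos.2 hc).le
  rwa [smul_smul, inv_mul_cancel₀ hc.ne', one_smul] at this

theorem elementAt_smul {c : ℝ} (hc : 0 < c) (z : ℝ × ℝ) :
    D.elementAt ℓ (c • z) = D.elementAt ℓ z := by
  rw [elementAt, elementAt, wallsAt, wallsAt]
  congr 2
  exact List.filter_congr fun i _ => decide_eq_decide.2 (smul_mem_cone_iff hc)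

theorem elementAt_of_unique {z : ℝ × ℝ} {i : D.Index} (hi : z ∈ D.cone i)
    (h : ∀ j, z ∈ D.cone j → j = i) : Γ.EqUpTo ℓ (D.elementAt ℓ z) (D.wall i).elt := by
  by_cases he : (D.wall i).elt ∈ Γ.Ggt ℓ
  · rw [elementAt_eq_one fun j hj => h j hj ▸ he]
    exact ((QuotientGroup.eq_one_iff _).2 he).symm
  · have : D.wallsAt ℓ z = [i] := by
      refine List.perm_singleton.1 ((List.perm_ext_iff_of_nodup (D.nodup_wallsAt ℓ z)
        (List.nodup_singleton i)).2 fun j => ?_)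
      rw [mem_wallsAt, List.mem_singleton]
      exact ⟨fun hj => h j hj.2, fun hj => hj ▸ ⟨he, hi⟩⟩
    rw [elementAt, this, List.map_singleton, List.prod_singleton]
    rfl

/-- The singular points of a diagram in a plane. -/
theorem eq_zero_of_mem_sing {z : ℝ × ℝ} (hz : z ∈ D.sing) : z = 0 := by
  rcases hz with hz | hz
  · obtain ⟨i, hi⟩ := Set.mem_iUnion.1 hz
    obtain ⟨⟨y, hy⟩, hfr, rfl⟩ := mem_intrinsicFrontier.1 hi
    change y = 0
    by_contra hy0
    set n := (D.wall i).normal with hn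
    have hline : ∀ w ∈ affineSpan ℝ (D.cone i), pairing n w = 0 := by
      let p : Submodule ℝ (ℝ × ℝ) :=
        { carrier := {w | pairing n w = 0}
          add_mem' := fun {a b} ha hb => by
            simp only [Set.mem_ofPred_eq, pairing, Prod.fst_add, Prod.snd_add] at ha hb ⊢
            linear_combination ha + hb
          zero_mem' := by simp [pairing]
          smul_mem' := fun c a ha => by
            simp only [Set.mem_ofPred_eq] at ha ⊢
            rw [pairing_smul, ha, mul_zero] }
      intro w hw
      have : affineSpan ℝ (D.cone i) ≤ p.toAffineSubspace :=
        affineSpan_le.2 fun v hv => (D.wall i).support_subset hv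
      exact this hw
    have hn0 : n ≠ 0 := by
      intro h
      have := (D.wall i).primitive
      rw [← hn, h] at this
      simp at this
    have hsq : 0 < y.1 * y.1 + y.2 * y.2 := by
      rcases eq_or_ne y.1 0 with h | h
      · have : y.2 ≠ 0 := fun h' => hy0 (Prod.ext h h')
        nlinarith [mul_self_pos.2 this, mul_self_nonneg y.1]
      · nlinarith [mul_self_pos.2 h, mul_self_nonneg y.2]
    -- Near a nonzero point $y$ the points of the line are positive multiples of $y$, so they belong
    -- to the cone if and only if $y$ does. Hence $y$ is not in the relative frontier.
    have hnear : ∀ᶠ w : affineSpan ℝ (D.cone i) in 𝓝 ⟨y, hy⟩,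
        ((w : ℝ × ℝ) ∈ D.cone i ↔ y ∈ D.cone i) := by
      have hc : Continuous fun w : affineSpan ℝ (D.cone i) =>
          (w : ℝ × ℝ).1 * y.1 + (w : ℝ × ℝ).2 * y.2 := by fun_prop
      filter_upwards [hc.continuousAt.eventually (lt_mem_nhds hsq)] with w hw
      have hw' : (w : ℝ × ℝ) = (((w : ℝ × ℝ).1 * y.1 + (w : ℝ × ℝ).2 * y.2) /
          (y.1 * y.1 + y.2 * y.2)) • y := by
        have h1 := hline _ w.2
        have h2 := hline _ hy
        unfold pairing at h1 h2
        have hx : (w : ℝ × ℝ).1 * y.2 - (w : ℝ × ℝ).2 * y.1 = 0 := by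
          have e1 : (n.1 : ℝ) * ((w : ℝ × ℝ).1 * y.2 - (w : ℝ × ℝ).2 * y.1) = 0 := by
            linear_combination y.2 * h1 - (w : ℝ × ℝ).2 * h2
          have e2 : (n.2 : ℝ) * ((w : ℝ × ℝ).1 * y.2 - (w : ℝ × ℝ).2 * y.1) = 0 := by
            linear_combination (w : ℝ × ℝ).1 * h2 - y.1 * h1
          by_contra hne
          exact hn0 (Prod.ext (by simpa [hne] using e1) (by simpa [hne] using e2))
        refine Prod.ext ?_ ?_
        · simp only [Prod.smul_fst, smul_eq_mul]
          rw [div_mul_eq_mul_div, eq_div_iff hsq.ne']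
          linear_combination y.2 * hx
        · simp only [Prod.smul_snd, smul_eq_mul]
          rw [div_mul_eq_mul_div, eq_div_iff hsq.ne']
          linear_combination (-y.1) * hx
      rw [hw']
      exact smul_mem_cone_iff (div_pos hw hsq)
    by_cases hyc : y ∈ D.cone i
    · refine hfr.2 (mem_interior_iff_mem_nhds.2 ?_)
      filter_upwards [hnear] with w hw
      exact hw.2 hyc
    · obtain ⟨w, hw, hw'⟩ := (mem_closure_iff_frequently.1 hfr.1).and_eventually hnear |>.exists
      exact hyc (hw'.1 hw)
  · simp only [Set.mem_iUnion] at hz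
    obtain ⟨i, j, hrank, hz⟩ := hz
    have h1 : Submodule.span ℝ (D.cone i ∩ D.cone j) = ⊥ := Submodule.finrank_eq_zero.1 hrank
    have h2 : z ∈ Submodule.span ℝ (D.cone i ∩ D.cone j) := Submodule.subset_span hz
    rwa [h1, Submodule.mem_bot] at h2

theorem zero_mem_cone (i : D.Index) : (0 : ℝ × ℝ) ∈ D.cone i := (D.wall i).support.zero_mem

/-- Two walls meeting only in the origin make it singular, so admissible curves avoid the one point
at which walls with different normal vectors can meet. -/
theorem zero_mem_sing {i j : D.Index} (h : ∀ z, z ∈ D.cone i → z ∈ D.cone j → z = 0) :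
    0 ∈ D.sing := by
  have h1 : D.cone i ∩ D.cone j = {0} := by
    ext z
    refine ⟨fun hz => h z hz.1 hz.2, ?_⟩
    rintro rfl
    exact ⟨zero_mem_cone i, zero_mem_cone j⟩
  refine Or.inr (Set.mem_iUnion₂.2 ⟨i, j, Set.mem_iUnion.2 ⟨?_, ?_⟩⟩)
  · rw [h1, Submodule.span_zero_singleton, finrank_bot]
  · rw [h1]; rfl

/-- A crossing list exists if every nontrivial wall is crossed finitely often. -/
theorem exists_isCrossingList {γ : ℝ → ℝ × ℝ}
    (h : ∀ i, {t | t ∈ Set.Icc (0 : ℝ) 1 ∧ γ t ∈ D.cone i}.Finite) :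
    ∃ L, D.IsCrossingList γ ℓ L := by
  have hfin : {x : ℝ × D.Index | x.1 ∈ Set.Icc (0 : ℝ) 1 ∧ γ x.1 ∈ D.cone x.2 ∧
      (D.wall x.2).elt ∉ Γ.Ggt ℓ}.Finite := by
    refine ((D.finite_nontrivial ℓ).biUnion fun i _ => (h i).image fun t => (t, i)).subset ?_
    rintro ⟨t, i⟩ ⟨h1, h2, h3⟩
    exact Set.mem_biUnion (x := i) h3 ⟨t, ⟨h1, h2⟩, rfl⟩
  refine ⟨hfin.toFinset.toList.insertionSort fun x y => x.1 ≤ y.1, ?_, fun x => ?_, ?_⟩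
  · exact (List.perm_insertionSort _ _).nodup_iff.2 (Finset.nodup_toList _)
  · rw [(List.perm_insertionSort _ _).mem_iff, Finset.mem_toList, Set.Finite.mem_toFinset]
    rfl
  · have : Std.Total fun x y : ℝ × D.Index => x.1 ≤ y.1 := ⟨fun x y => le_total _ _⟩
    have : IsTrans (ℝ × D.Index) fun x y => x.1 ≤ y.1 := ⟨fun x y z => le_trans⟩
    exact List.pairwise_insertionSort _ _

/-- A function with nonvanishing derivative at its zeros has finitely many zeros in `[0,1]`. -/
theorem _root_.QCSD.finite_zeros {f f' : ℝ → ℝ} (hf : ∀ t, HasDerivAt f (f' t) t)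
    (h : ∀ t, f t = 0 → f' t ≠ 0) : {t | t ∈ Set.Icc (0 : ℝ) 1 ∧ f t = 0}.Finite := by
  by_contra hinf
  obtain ⟨x, -, hx⟩ := Set.Infinite.exists_accPt_of_subset_isCompact hinf isCompact_Icc
    fun t ht => ht.1
  rw [accPt_iff_frequently_nhdsNE] at hx
  by_cases h0 : f x = 0
  · obtain ⟨y, hy, hy'⟩ := (hx.and_eventually ((hf x).eventually_ne (c := 0) (h x h0))).exists
    exact hy' hy.2
  · have : ∀ᶠ y in 𝓝[≠] x, f y ≠ 0 :=
      ((hf x).continuousAt.eventually_ne h0).filter_mono nhdsWithin_le_nhds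
    obtain ⟨y, hy, hy'⟩ := (hx.and_eventually this).exists
    exact hy' hy.2

end ScatteringDiagram
-- The loop around the origin and the factorization read off along it.
theorem JumpsAt.congr {Q : Type*} [Group Q] {f g : ℝ → Q} {c : Q} {t : ℝ} (hf : JumpsAt f c t)
    (h : ∀ᶠ s in 𝓝[Set.Icc 0 1] t, g s = f s) : JumpsAt g c t := by
  obtain ⟨a, ha⟩ := hf
  refine ⟨a, ?_⟩
  filter_upwards [ha, h] with s h1 h2
  rwa [h2]

/-- The angle at time `s` of a loop around the origin with base point in the third quadrant. -/
def angle (s : ℝ) : ℝ := 2 * Real.pi * s - 3 * Real.pi / 4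

/-- The point of the unit circle at time `s`. -/
def circlePoint (s : ℝ) : ℝ × ℝ := (Real.cos (angle s), Real.sin (angle s))

theorem hasDerivAt_circlePoint (s : ℝ) : HasDerivAt circlePoint
    (-Real.sin (angle s) * (2 * Real.pi), Real.cos (angle s) * (2 * Real.pi)) s := by
  have h : HasDerivAt angle (2 * Real.pi) s := by
    have := ((hasDerivAt_id s).const_mul (2 * Real.pi)).sub_const (3 * Real.pi / 4)
    rw [mul_one] at this
    exact this
  exact h.cos.prodMk h.sin

theorem contDiff_circlePoint {n : WithTop ℕ∞} : ContDiff ℝ n circlePoint := by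
  unfold circlePoint angle
  fun_prop

theorem circlePoint_ne_zero (s : ℝ) : circlePoint s ≠ 0 := by
  intro h
  have h1 : Real.cos (angle s) = 0 := congrArg Prod.fst h
  have h2 : Real.sin (angle s) = 0 := congrArg Prod.snd h
  have := Real.sin_sq_add_cos_sq (angle s)
  rw [h1, h2] at this
  norm_num at this

theorem circlePoint_third_quadrant {s : ℝ} (h : 7 / 8 < s) (h' : s ≤ 1) :
    (circlePoint s).1 < 0 ∧ (circlePoint s).2 < 0 := by
  have hπ := Real.pi_pos
  have e1 : Real.cos (angle s) = -Real.cos (angle s - Real.pi) := by rw [Real.cos_sub_pi, neg_neg]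
  have e2 : Real.sin (angle s) = -Real.sin (angle s - Real.pi) := by rw [Real.sin_sub_pi, neg_neg]
  have h1 : 0 < angle s - Real.pi := by unfold angle; nlinarith
  have h2 : angle s - Real.pi < Real.pi / 2 := by unfold angle; nlinarith
  constructor
  · change Real.cos (angle s) < 0
    rw [e1, neg_lt_zero]
    exact Real.cos_pos_of_mem_Ioo ⟨by linarith, h2⟩
  · change Real.sin (angle s) < 0
    rw [e2, neg_lt_zero]
    exact Real.sin_pos_of_pos_of_lt_pi h1 (by linarith)

theorem circlePoint_zero : circlePoint 0 = circlePoint 1 := by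
  have : angle 1 = angle 0 + 2 * Real.pi := by unfold angle; ring
  rw [circlePoint, circlePoint, this, Real.cos_add_two_pi, Real.sin_add_two_pi]

/-- The circle meets the lower, right, upper and left half-axes at the times $1/8$, $3/8$, $5/8$ and
$7/8$; the left one is the incoming ray crossed last. -/
theorem circlePoint_seven_eighths : circlePoint (7 / 8) = (-1, 0) := by
  have : angle (7 / 8) = Real.pi := by unfold angle; ring
  rw [circlePoint, this, Real.cos_pi, Real.sin_pi]

theorem circlePoint_not_left {s : ℝ} (h : 0 ≤ s) (h' : s < 7 / 8) :
    ¬ ((circlePoint s).1 < 0 ∧ (circlePoint s).2 = 0) := by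
  rintro ⟨h1, h2⟩
  have hπ := Real.pi_pos
  have h3 : angle s = 0 := (Real.sin_eq_zero_iff_of_lt_of_lt (by unfold angle; nlinarith)
    (by unfold angle; nlinarith)).1 h2
  change Real.cos (angle s) < 0 at h1
  rw [h3, Real.cos_zero] at h1
  norm_num at h1

theorem circlePoint_snd_pos {s : ℝ} (h : 3 / 8 < s) (h' : s < 7 / 8) : 0 < (circlePoint s).2 := by
  have hπ := Real.pi_pos
  exact Real.sin_pos_of_pos_of_lt_pi (by unfold angle; nlinarith) (by unfold angle; nlinarith)

namespace FixedData
variable {Γ : FixedData}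

theorem ne_zero_of_gcd {n : ℕ × ℕ} (hn : Nat.gcd n.1 n.2 = 1) : n ≠ 0 := by
  rintro rfl
  simp at hn

theorem pairing_neg {n : ℕ × ℕ} (hn : n ≠ 0) {z : ℝ × ℝ} (h1 : z.1 < 0) (h2 : z.2 < 0) :
    pairing n z < 0 := by
  unfold pairing
  rcases Nat.eq_zero_or_pos n.1 with h | h
  · have h' : 0 < n.2 := Nat.pos_of_ne_zero fun h' => hn (Prod.ext h h')
    have : (0 : ℝ) < n.2 := by exact_mod_cast h'
    rw [h]
    nlinarith
  · have h3 : (0 : ℝ) < n.1 := by exact_mod_cast h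
    have h4 : (0 : ℝ) ≤ n.2 := Nat.cast_nonneg _
    nlinarith [mul_neg_of_pos_of_neg h3 h1, mul_nonpos_of_nonneg_of_nonpos h4 h2.le]

variable (Γ) in
/-- The loop along which the consistency relation is read off. -/
def loop (s : ℝ) : ℝ × ℝ := Γ.sgn • circlePoint s

theorem hasDerivAt_loop (s : ℝ) : HasDerivAt Γ.loop (Γ.sgn •
    (-Real.sin (angle s) * (2 * Real.pi), Real.cos (angle s) * (2 * Real.pi))) s :=
  (hasDerivAt_circlePoint s).const_smul Γ.sgn

theorem pairing_deriv_loop (n : ℕ × ℕ) (s : ℝ) : pairing n (deriv Γ.loop s) =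
    Γ.sgn * (2 * Real.pi) * (n.2 * (circlePoint s).1 - n.1 * (circlePoint s).2) := by
  rw [(hasDerivAt_loop s).deriv, pairing_smul, pairing, circlePoint]
  ring

theorem pairing_loop (n : ℕ × ℕ) (s : ℝ) :
    pairing n (Γ.loop s) = Γ.sgn * pairing n (circlePoint s) := pairing_smul _ _ _

/-- Position and velocity on the circle are perpendicular and nonzero, so only $n=0$ pairs to zero
with both. -/
theorem pairing_deriv_loop_ne_zero {n : ℕ × ℕ} (hn : n ≠ 0) {s : ℝ}
    (h : pairing n (Γ.loop s) = 0) : pairing n (deriv Γ.loop s) ≠ 0 := by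
  intro h'
  rw [pairing_loop, mul_eq_zero, or_iff_right sgn_ne_zero] at h
  rw [pairing_deriv_loop, mul_eq_zero, or_iff_right
    (mul_ne_zero sgn_ne_zero (by positivity))] at h'
  have hc := Real.sin_sq_add_cos_sq (angle s)
  simp only [pairing, circlePoint] at h h'
  refine hn (Prod.ext ?_ ?_)
  · have : (n.1 : ℝ) = 0 := by
      linear_combination (-(n.1 : ℝ)) * hc + Real.cos (angle s) * h - Real.sin (angle s) * h'
    exact_mod_cast this
  · have : (n.2 : ℝ) = 0 := by
      linear_combination (-(n.2 : ℝ)) * hc + Real.sin (angle s) * h + Real.cos (angle s) * h'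
    exact_mod_cast this

end FixedData

namespace ScatteringDiagram
variable {Γ : FixedData} {D : ScatteringDiagram.{u'} Γ} {ℓ : ℕ}

theorem notMem_cone_of_third_quadrant {z : ℝ × ℝ} (h1 : z.1 < 0) (h2 : z.2 < 0) (i : D.Index) :
    Γ.sgn • z ∉ D.cone i := by
  intro h
  have := pairing_eq_zero h
  rw [pairing_smul, mul_eq_zero, or_iff_right sgn_ne_zero] at this
  exact (pairing_neg (ne_zero_of_gcd (D.wall i).primitive) h1 h2).ne this

theorem admissible_loop : D.Admissible Γ.loop := by
  have h1 : Γ.loop 1 ∉ D.supp := by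
    have := circlePoint_third_quadrant (s := 1) (by norm_num) le_rfl
    intro h
    obtain ⟨i, hi⟩ := Set.mem_iUnion.1 h
    exact notMem_cone_of_third_quadrant this.1 this.2 i hi
  refine ⟨?_, h1, ?_, fun t _ i hi => ?_, fun t _ ht => ?_⟩
  · rwa [loop, circlePoint_zero]
  · exact (contDiff_circlePoint.const_smul Γ.sgn).contDiffOn
  · exact pairing_deriv_loop_ne_zero (ne_zero_of_gcd (D.wall i).primitive) (pairing_eq_zero hi)
  · exact smul_ne_zero sgn_ne_zero (circlePoint_ne_zero t) (eq_zero_of_mem_sing ht)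

theorem exists_isCrossingList_loop : ∃ L, D.IsCrossingList Γ.loop ℓ L := by
  refine exists_isCrossingList fun i => ?_
  refine (finite_zeros (f := fun s => pairing (D.wall i).normal (Γ.loop s))
    (f' := fun s => pairing (D.wall i).normal (deriv Γ.loop s)) (fun t =>
      hasDerivAt_pairing _ (hasDerivAt_loop t).differentiableAt) fun t ht =>
      pairing_deriv_loop_ne_zero (ne_zero_of_gcd (D.wall i).primitive) ht).subset ?_
  exact fun t ht => ⟨ht.1, pairing_eq_zero ht.2⟩

/-- The consistency relation along the loop. -/
theorem Rays.factorizes {H : ℕ × ℕ → Γ.G} (hω : Γ.ω ≠ 0) (hD : D.Rays ℓ H)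
    (hcons : D.ConsistentUpTo ℓ) : Γ.Factorizes ℓ H := by
  rw [factorizes_iff hω]
  set J : ℕ × ℕ → Γ.G ⧸ Γ.Ggt ℓ := fun n => Γ.orient ((H n : Γ.G) : Γ.G ⧸ Γ.Ggt ℓ) with hJ
  set K₀ := Γ.orient ((Γ.seed 0 : Γ.G) : Γ.G ⧸ Γ.Ggt ℓ) with hK₀
  set K₁ := Γ.orient ((Γ.seed 1 : Γ.G) : Γ.G ⧸ Γ.Ggt ℓ) with hK₁
  -- With this $\kappa$ the potential has the correct jump across the top incoming ray by
  -- definition. Its jump across the left ray is not yet known to be correct, so from time $7/8$ on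
  -- the function `g` is continued by the correct jump instead. The path-ordered product of the loop
  -- is then $K_1^{-1}\kappa$, and its triviality is the factorization.
  set κ := K₀⁻¹ * (slopes.map J).reverse.prod with hκ
  let g : ℝ → Γ.G ⧸ Γ.Ggt ℓ := fun s =>
    if s < 7 / 8 then potential J κ (Γ.sgn • Γ.loop s) else K₁⁻¹ * κ
  have hback : ∀ s, Γ.sgn • Γ.loop s = circlePoint s := fun s => sgn_smul_sgn_smul _
  obtain ⟨L, hL⟩ := exists_isCrossingList_loop (D := D) (ℓ := ℓ)
  have hA := admissible_loop (D := D)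
  have hdiff : ∀ t, DifferentiableAt ℝ Γ.loop t := fun t => (hasDerivAt_loop t).differentiableAt
  have hcirc : ∀ t, ContinuousAt circlePoint t := fun t => (hasDerivAt_circlePoint t).continuousAt
  have hlt : ∀ t : ℝ, t < 7 / 8 →
      ∀ᶠ s in 𝓝[Set.Icc 0 1] t, g s = potential J κ (Γ.sgn • Γ.loop s) :=
    fun t ht => nhdsWithin_le_nhds <| by
      filter_upwards [gt_mem_nhds ht] with s hs
      exact if_pos hs
  have hgt : ∀ t : ℝ, 7 / 8 < t → ∀ᶠ s in 𝓝[Set.Icc 0 1] t, g s = K₁⁻¹ * κ :=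
    fun t ht => nhdsWithin_le_nhds <| by
      filter_upwards [lt_mem_nhds ht] with s hs
      exact if_neg hs.not_gt
  have h3 := circlePoint_third_quadrant (s := 1) (by norm_num) le_rfl
  rw [← circlePoint_zero] at h3
  have hg0 : g 0 = 1 := by
    change (if (0 : ℝ) < 7 / 8 then _ else _) = _
    rw [if_pos (by norm_num), hback]
    exact potential_eq_one h3.1 h3.2
  have hg1 : g 1 = K₁⁻¹ * κ := if_neg (by norm_num)
  have main := hA.mk_pathProduct_eq hL (g := g) (fun t ht => ?_) ?_ ?_
  · have h4 : ((D.pathProduct Γ.loop L : Γ.G) : Γ.G ⧸ Γ.Ggt ℓ) = 1 :=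
      hcons _ hA (by rw [loop, circlePoint_zero]; rfl) L hL
    rw [h4, hg0, hg1, inv_one, mul_one, hκ] at main
    have := congrArg (fun x => K₀ * (K₁ * x)) main
    simpa using this.symm
  · have hz : Γ.loop t ≠ 0 := smul_ne_zero sgn_ne_zero (circlePoint_ne_zero t)
    rcases lt_trichotomy t (7 / 8) with h | h | h
    · refine JumpsAt.congr ?_ (hlt t h)
      by_cases hn : ∃ n : ℕ × ℕ, Nat.gcd n.1 n.2 = 1 ∧ pairing n (Γ.loop t) = 0
      · obtain ⟨n, hn, hnz⟩ := hn
        rw [hL.productAt_factors ht hz hn hnz]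
        have hne := pairing_deriv_loop_ne_zero (ne_zero_of_gcd hn) hnz
        suffices hΦ : ∃ A, ∀ᶠ w in 𝓝 (Γ.loop t), (0 < pairing n w → potential J κ (Γ.sgn • w) = A) ∧
            (pairing n w < 0 → potential J κ (Γ.sgn • w) = D.elementAt ℓ (Γ.loop t) * A) by
          obtain ⟨A, hA⟩ := hΦ
          exact jumpsAt_of_halfplanes (Φ := fun z => potential J κ (Γ.sgn • z)) (hdiff t) hnz hne hA
        rcases plane_cases (circlePoint_ne_zero t) with
          ⟨h2, -⟩ | ⟨h2, -⟩ | ⟨h2, h3⟩ | h2 | h2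
        · exact hD.exists_halfplanes hz hn hnz (Or.inl (by rwa [hback]))
        · exact hD.exists_halfplanes hz hn hnz (Or.inl (by rwa [hback]))
        · have hnz' : pairing n (circlePoint t) = 0 := by
            rw [← hback, pairing_smul, hnz, mul_zero]
          have hn0 := eq_of_pairing_eq_zero hn (gcd_e 0) (circlePoint_ne_zero t) hnz'
            (by rw [pairing_e_zero, h2])
          have he : ((D.elementAt ℓ (Γ.loop t) : Γ.G) : Γ.G ⧸ Γ.Ggt ℓ) = Γ.seed 0 := hD.top _ h2 h3
          rw [he, hn0]
          refine FixedData.exists_halfplanes (A := κ) ?_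
          rw [hback]
          filter_upwards [potential_eventually_top (J := J) (κ := κ) h3] with w hw
          rw [pairing_e_zero, ← hK₀, hκ, mul_inv_cancel_left]
          exact hw
        · exact absurd h2 (circlePoint_not_left ht.1 h)
        · exact hD.exists_halfplanes hz hn hnz (Or.inr (by rwa [hback]))
      · have hn' : ∀ n : ℕ × ℕ, Nat.gcd n.1 n.2 = 1 → pairing n (circlePoint t) ≠ 0 :=
          fun n h1 h2 => hn ⟨n, h1, by rw [pairing_loop, h2, mul_zero]⟩
        rw [hL.productAt_factors_eq_one ht
          fun i hi => absurd ⟨_, (D.wall i).primitive, pairing_eq_zero hi⟩ hn]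
        suffices hΦ : ∃ A, ∀ᶠ w in 𝓝 (circlePoint t), potential J κ w = A by
          obtain ⟨A, hA⟩ := hΦ
          refine jumpsAt_of_eventually_eq (a := A) (nhdsWithin_le_nhds ?_)
          simp only [hback]
          exact (hcirc t).eventually hA
        rcases plane_cases (circlePoint_ne_zero t) with
          ⟨-, n, h2, h3⟩ | ⟨h2, h3⟩ | ⟨h2, -⟩ | h2 | h2
        · exact absurd h3 (hn' n (gcd_eq_one_of_mem_slopes n h2))
        · exact ⟨_, potential_eventually_of_ne h2 h3⟩
        · exact absurd (by rw [pairing_e_zero, h2]) (hn' _ (gcd_e 0))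
        · exact absurd h2 (circlePoint_not_left ht.1 h)
        · exact ⟨_, potential_eventually_of_second_quadrant h2.1 h2.2⟩
    · subst h
      have hc := circlePoint_seven_eighths
      have he : ((D.elementAt ℓ (Γ.loop (7 / 8)) : Γ.G) : Γ.G ⧸ Γ.Ggt ℓ) = Γ.seed 1 :=
        hD.left _ (by rw [hc]; norm_num) (by rw [hc])
      -- A counterclockwise loop crosses an incoming ray in the sense opposite to that of the
      -- outgoing ray with the same normal vector, hence the inverse.
      have hp : productAt (factors Γ.loop ℓ L) (7 / 8) = K₁⁻¹ := by
        rw [hL.productAt_factors ht hz (gcd_e 1)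
            (by rw [pairing_loop, pairing_e_one, hc, mul_zero]),
          he, pairing_deriv_loop, hc, hK₁]
        have hπ := Real.pi_pos
        have h1 : ((e 1).2 : ℝ) * (-1) - (e 1).1 * 0 = -1 := by simp [e]
        rw [h1]
        by_cases h2 : 0 < Γ.ω
        · rw [sgn, orient, if_pos h2, if_pos h2, if_pos (by nlinarith), inv_inv]
        · rw [sgn, orient, if_neg h2, if_neg h2, if_neg (by nlinarith)]
      rw [hp]
      refine ⟨κ, nhdsWithin_le_nhds ?_⟩
      filter_upwards [(hcirc (7 / 8)).eventually (potential_eventually_left (J := J) (κ := κ)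
        (by rw [hc]; norm_num)), lt_mem_nhds (show (3 / 8 : ℝ) < 7 / 8 by norm_num)] with s h1 h2
      refine ⟨fun h => ?_, fun h => if_neg h.not_gt⟩
      change (if s < 7 / 8 then _ else _) = _
      rw [if_pos h, hback]
      exact h1.1 (circlePoint_snd_pos h2 h)
    · rw [hL.productAt_factors_eq_one ht fun i hi => absurd hi (notMem_cone_of_third_quadrant
        (circlePoint_third_quadrant h ht.2).1 (circlePoint_third_quadrant h ht.2).2 i)]
      exact jumpsAt_of_eventually_eq (hgt t h)
  · have h4 : ∀ᶠ s in 𝓝 (0 : ℝ), potential J κ (circlePoint s) = potential J κ (circlePoint 0) :=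
      (hcirc 0).eventually (potential_eventually_of_ne (Or.inr h3.2)
        fun n hn => (pairing_neg (ne_zero_of_mem_slopes hn) h3.1 h3.2).ne)
    filter_upwards [hlt 0 (by norm_num), nhdsWithin_le_nhds h4] with s h5 h6
    rw [h5, hback, h6, hg0]
    exact potential_eq_one h3.1 h3.2
  · rw [hg1]
    exact hgt 1 (by norm_num)

end ScatteringDiagram
-- Uniqueness of the factorization, and the rays of a QCSD.
namespace FixedData
variable {Γ : FixedData}

theorem eq_of_smul_eq_smul {m n : ℕ × ℕ} (hm : Nat.gcd m.1 m.2 = 1) (hn : Nat.gcd n.1 n.2 = 1)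
    {j k : ℕ} (h : j • m = k • n) (h0 : j • m ≠ 0) : m = n := by
  have hj : j ≠ 0 := fun hj => h0 (by rw [hj, zero_smul])
  have hk : k ≠ 0 := fun hk => h0 (by rw [h, hk, zero_smul])
  have h1 : j * m.1 = k * n.1 := congrArg Prod.fst h
  have h2 : j * m.2 = k * n.2 := congrArg Prod.snd h
  refine eq_of_cross_eq hm hn (Nat.eq_of_mul_eq_mul_left
    (Nat.pos_of_ne_zero (mul_ne_zero hj hk)) ?_)
  linear_combination k * n.2 * h1 - k * n.1 * h2

/-- Uniqueness of ordered factorizations. -/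
theorem Factorizes.unique (hω : Γ.ω ≠ 0) {ℓ : ℕ} {H H' : ℕ × ℕ → Γ.G} (h : Γ.Factorizes ℓ H)
    (h' : Γ.Factorizes ℓ H') (hr : ∀ n ∈ slopes, H n ∈ Γ.rayGroup n)
    (hr' : ∀ n ∈ slopes, H' n ∈ Γ.rayGroup n) : ∀ n ∈ slopes, Γ.EqUpTo ℓ (H n) (H' n) := by
  have key : ∀ l : List (ℕ × ℕ), l.Nodup → (∀ n, n ∈ l ↔ n ∈ slopes) →
      Γ.EqUpTo ℓ (l.map H).prod (l.map H').prod → ∀ n ∈ slopes, Γ.EqUpTo ℓ (H n) (H' n) := by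
    intro l hl hmem he n hn
    rw [eqUpTo_iff, toSeries_list_prod, toSeries_list_prod, List.map_map, List.map_map] at he
    rw [eqUpTo_iff]
    exact Torus.van_sub_of_van_prod_sub hl
      (fun n hn n' hn' j k => eq_of_smul_eq_smul (gcd_eq_one_of_mem_slopes n ((hmem n).1 hn))
        (gcd_eq_one_of_mem_slopes n' ((hmem n').1 hn')))
      (fun n _ => coeff_zero_toSeries _) (fun n _ => coeff_zero_toSeries _)
      (fun n hn => hr n ((hmem n).1 hn)) (fun n hn => hr' n ((hmem n).1 hn)) he n ((hmem n).2 hn)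
  have hnd : slopes.Nodup := by decide
  rcases lt_or_gt_of_ne hω with hω | hω
  · exact key slopes.reverse (List.nodup_reverse.2 hnd) (fun n => List.mem_reverse)
      ((h.2 hω).symm.trans (h'.2 hω))
  · exact key slopes hnd (fun n => Iff.rfl) ((h.1 hω).symm.trans (h'.1 hω))

end FixedData

namespace ScatteringDiagram
variable {Γ : FixedData} {D : ScatteringDiagram.{u'} Γ} {ℓ : ℕ}

/-- Outside the closed outgoing quadrant $p^*(n)$ is a nonnegative multiple of the given point, and
supports are cones. -/
theorem incoming_of_mem_cone (hω : Γ.ω ≠ 0) {i : D.Index} {z : ℝ × ℝ} (hz : z.1 < 0 ∨ 0 < z.2)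
    (hi : Γ.sgn • z ∈ D.cone i) : (D.wall i).Incoming := by
  have h := pairing_eq_zero hi
  rw [pairing_smul, mul_eq_zero, or_iff_right sgn_ne_zero] at h
  obtain ⟨c, hc, he⟩ := exists_pStar_eq hω (ne_zero_of_gcd (D.wall i).primitive) hz h
  rw [Wall.Incoming, he]
  exact smul_mem_cone hi hc

theorem IsQCSD.zero_mem_sing (h : D.IsQCSD) : 0 ∈ D.sing := by
  obtain ⟨w, -, -, hw⟩ := h.incoming
  refine ScatteringDiagram.zero_mem_sing (i := w 0) (j := w 1) fun z h0 h1 => ?_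
  rw [(hw 0).2.1] at h0
  rw [(hw 1).2.1] at h1
  exact Prod.ext ((pairing_e_zero z).symm.trans h0) ((pairing_e_one z).symm.trans h1)

/-- Every wall that leaves the closed outgoing quadrant is incoming, hence is one of the two axes;
this determines all elements there. On the outgoing quadrant, walls orthogonal to none of the slopes
are trivial modulo $G^{>4}$, and the element at a point depends only on its ray. It includes all
walls through the ray, in particular the outgoing half of an incoming line. -/
theorem IsQCSD.rays (hω : Γ.ω ≠ 0) (h : D.IsQCSD) :
    D.Rays 4 fun n => D.elementAt 4 (Γ.sgn • ((n.2 : ℝ), -(n.1 : ℝ))) := by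
  obtain ⟨w, -, hinc, hw⟩ := h.incoming
  have hmem : ∀ z : ℝ × ℝ, z.1 < 0 ∨ 0 < z.2 → ∀ i, Γ.sgn • z ∈ D.cone i →
      ∃ k, w k = i ∧ pairing (e k) z = 0 := by
    intro z hz i hi
    obtain ⟨k, hk⟩ := (hinc i).1 (incoming_of_mem_cone hω hz hi)
    refine ⟨k, hk, ?_⟩
    have := pairing_eq_zero hi
    rwa [← hk, (hw k).1, pairing_smul, mul_eq_zero, or_iff_right sgn_ne_zero] at this
  have hself : ∀ (z : ℝ × ℝ) (k : Fin 2), pairing (e k) z = 0 → Γ.sgn • z ∈ D.cone (w k) := by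
    intro z k hz
    rw [(hw k).2.1]
    change pairing (e k) (Γ.sgn • z) = 0
    rw [pairing_smul, hz, mul_zero]
  have hseed : ∀ (z : ℝ × ℝ) (k : Fin 2), z.1 < 0 ∨ 0 < z.2 → pairing (e k) z = 0 →
      (∀ j, pairing (e j) z = 0 → j = k) →
      Γ.EqUpTo 4 (D.elementAt 4 (Γ.sgn • z)) (Γ.seed k) := by
    intro z k hz hk hj
    have := elementAt_of_unique (ℓ := 4) (hself z k hk) fun i hi => by
      obtain ⟨j, rfl, h⟩ := hmem z hz i hi
      rw [hj j h]
    rwa [(hw k).2.2] at this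
  refine ⟨fun n hn c hc => ?_, fun z hz hn => ?_, fun z h1 h2 => ?_, fun z h1 h2 => ?_,
    fun z h1 h2 => ?_⟩
  · rw [smul_comm, elementAt_smul hc]
    rfl
  · rw [elementAt_eq_one fun i hi => mem_Ggt_of_mem_Gpar (D.wall i).elt_mem ?_]
    · rfl
    · by_contra hd
      have := pairing_eq_zero hi
      rw [pairing_smul, mul_eq_zero, or_iff_right sgn_ne_zero] at this
      exact hn _ (mem_slopes (D.wall i).primitive (not_lt.1 hd)) this
  · refine hseed z 0 (Or.inr h2) (by rw [pairing_e_zero, h1]) fun j hj => ?_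
    fin_cases j
    · rfl
    · exact absurd ((pairing_e_one z).symm.trans hj) h2.ne'
  · refine hseed z 1 (Or.inl h1) (by rw [pairing_e_one, h2]) fun j hj => ?_
    fin_cases j
    · exact absurd ((pairing_e_zero z).symm.trans hj) h1.ne
    · rfl
  · rw [elementAt_eq_one fun i hi => ?_]
    · rfl
    · obtain ⟨k, -, hk⟩ := hmem z (Or.inl h1) i hi
      fin_cases k
      · exact absurd ((pairing_e_zero z).symm.trans hk) h1.ne
      · exact absurd ((pairing_e_one z).symm.trans hk) h2.ne'

/-! ### Diagrams of rays -/

/-- The diagram with the given walls. -/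
def ofList (W : List (Wall Γ)) : ScatteringDiagram.{0} Γ where
  Index := Fin W.length
  wall := W.get
  finite_nontrivial _ := Set.toFinite _

theorem eqUpTo_prod_filter {α : Type*} (f : α → Γ.G) (p : α → Bool)
    (hp : ∀ x, p x = false → f x ∈ Γ.Ggt ℓ) (l : List α) :
    Γ.EqUpTo ℓ ((l.filter p).map f).prod (l.map f).prod := by
  induction l with
  | nil => rfl
  | cons x l ih =>
    have ih : ((((l.filter p).map f).prod : Γ.G) : Γ.G ⧸ Γ.Ggt ℓ) = ((l.map f).prod : Γ.G) := ih
    change ((_ : Γ.G) : Γ.G ⧸ Γ.Ggt ℓ) = (_ : Γ.G)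
    rw [List.map_cons, List.prod_cons, QuotientGroup.mk_mul, ← ih]
    cases hx : p x
    · rw [List.filter_cons_of_neg (by simp [hx]), (QuotientGroup.eq_one_iff _).2 (hp x hx), one_mul]
    · rw [List.filter_cons_of_pos hx, List.map_cons, List.prod_cons, QuotientGroup.mk_mul]

open Classical in
theorem elementAt_ofList (W : List (Wall Γ)) {z : ℝ × ℝ} (hz : z ≠ 0) :
    Γ.EqUpTo ℓ ((ofList W).elementAt ℓ z)
      ((W.filter fun w => z ∈ w.support).map Wall.elt).prod := by
  set M : List (Fin W.length) := (List.finRange W.length).filter fun i => z ∈ (W.get i).support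
  have h1 : (M.map fun i => (W.get i).elt) = (W.filter fun w => z ∈ w.support).map Wall.elt := by
    conv_rhs => rw [← List.map_get_finRange W]
    rw [List.filter_map, List.map_map]
    rfl
  have h2 : (M.filter fun i => (W.get i).elt ∉ Γ.Ggt ℓ).Perm ((ofList W).wallsAt ℓ z) := by
    refine (List.perm_ext_iff_of_nodup (((List.nodup_finRange _).filter _).filter _)
      (nodup_wallsAt _ ℓ z)).2 fun i => ?_
    refine Iff.trans ?_ ((ofList W).mem_wallsAt ℓ).symm
    refine List.mem_filter.trans ((and_congr_left' List.mem_filter).trans ?_)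
    simp only [List.mem_finRange, true_and, decide_eq_true_eq]
    exact and_comm
  rw [← elementAt_eq_of_perm hz h2, ← h1]
  exact eqUpTo_prod_filter (fun i => (W.get i).elt) _ (fun i hi => by simpa using hi) M

end ScatteringDiagram

/-- The ray spanned by a vector. -/
def rayCone (v : ℝ × ℝ) : PointedCone ℝ (ℝ × ℝ) := PointedCone.hull ℝ {v}

theorem mem_rayCone {v z : ℝ × ℝ} : z ∈ rayCone v ↔ ∃ c : ℝ, 0 ≤ c ∧ c • v = z := by
  rw [rayCone, PointedCone.hull, Submodule.mem_span_singleton]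
  exact ⟨fun ⟨c, h⟩ => ⟨c, c.2, h⟩, fun ⟨c, hc, h⟩ => ⟨⟨c, hc⟩, h⟩⟩

theorem finrank_span_rayCone {v : ℝ × ℝ} (hv : v ≠ 0) :
    Module.finrank ℝ (Submodule.span ℝ (rayCone v : Set (ℝ × ℝ))) = 1 := by
  have : Submodule.span ℝ (rayCone v : Set (ℝ × ℝ)) = Submodule.span ℝ {v} := by
    refine le_antisymm (Submodule.span_le.2 fun z hz => ?_) (Submodule.span_mono ?_)
    · obtain ⟨c, -, rfl⟩ := mem_rayCone.1 hz
      exact Submodule.smul_mem _ _ (Submodule.mem_span_singleton_self v)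
    · rintro _ rfl
      exact mem_rayCone.2 ⟨1, zero_le_one, one_smul _ _⟩
  rw [this, finrank_span_singleton hv]

/-- A ray orthogonal to a primitive vector as a wall. -/
def rayWall {Γ : FixedData} (n : ℕ × ℕ) (s : ℝ) (g : Γ.G) (hn : Nat.gcd n.1 n.2 = 1) (hs : s ≠ 0)
    (hg : g ∈ Γ.Gpar n) : Wall Γ where
  normal := n
  primitive := hn
  support := rayCone (s • ((n.2 : ℝ), -(n.1 : ℝ)))
  support_subset := by
    intro z hz
    obtain ⟨c, -, rfl⟩ := mem_rayCone.1 hz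
    change pairing n _ = 0
    rw [pairing_smul, pairing_smul, pairing]
    ring
  codim_one := finrank_span_rayCone (smul_ne_zero hs fun h => ne_zero_of_gcd hn (Prod.ext
    (by simpa using congrArg Prod.snd h) (by simpa using congrArg Prod.fst h)))
  elt := g
  elt_mem := hg

namespace FixedData
variable {Γ : FixedData}

theorem mem_outgoing_iff {m n : ℕ × ℕ} (hm : Nat.gcd m.1 m.2 = 1) (hn : Nat.gcd n.1 n.2 = 1)
    {z : ℝ × ℝ} (hz : 0 < z.1 ∨ z.2 < 0) (hmz : pairing m z = 0) :
    Γ.sgn • z ∈ rayCone (Γ.sgn • ((n.2 : ℝ), -(n.1 : ℝ))) ↔ n = m := by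
  have hz0 : z ≠ 0 := by
    rintro rfl
    simp at hz
  constructor
  · intro h
    obtain ⟨c, hc, h⟩ := mem_rayCone.1 h
    rw [smul_comm] at h
    obtain rfl := smul_right_injective _ sgn_ne_zero h
    refine eq_of_pairing_eq_zero hn hm hz0 ?_ hmz
    rw [pairing_smul, pairing]
    ring
  · rintro rfl
    obtain ⟨c, hc, rfl⟩ := exists_eq_smul (ne_zero_of_gcd hn) hz hmz
    exact mem_rayCone.2 ⟨c, hc.le, smul_comm _ _ _⟩

theorem notMem_outgoing {n : ℕ × ℕ} {z : ℝ × ℝ} (hz : z.1 < 0 ∨ 0 < z.2) :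
    Γ.sgn • z ∉ rayCone (Γ.sgn • ((n.2 : ℝ), -(n.1 : ℝ))) := by
  intro h
  obtain ⟨c, hc, h⟩ := mem_rayCone.1 h
  rw [smul_comm] at h
  obtain rfl := smul_right_injective _ sgn_ne_zero h
  have h1 : 0 ≤ c * n.2 := by positivity
  have h2 : 0 ≤ c * n.1 := by positivity
  simp only [Prod.smul_mk, smul_eq_mul] at hz
  rcases hz with hz | hz <;> linarith

theorem mem_incoming_iff {n : ℕ × ℕ} (hn : n ≠ 0) {z : ℝ × ℝ} (hz : z.1 < 0 ∨ 0 < z.2) :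
    Γ.sgn • z ∈ rayCone ((-Γ.sgn) • ((n.2 : ℝ), -(n.1 : ℝ))) ↔ pairing n z = 0 := by
  constructor
  · intro h
    obtain ⟨c, hc, h⟩ := mem_rayCone.1 h
    rw [neg_smul, smul_neg, smul_comm, ← smul_neg] at h
    obtain rfl := smul_right_injective _ sgn_ne_zero h
    simp only [pairing, Prod.smul_mk, smul_eq_mul, Prod.fst_neg, Prod.snd_neg]
    ring
  · intro h
    obtain ⟨c, hc, hzc⟩ := exists_eq_smul hn (z := (-1 : ℝ) • z) (by simpa using hz)
      (by rw [pairing_smul, h, mul_zero])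
    refine mem_rayCone.2 ⟨c, hc.le, ?_⟩
    rw [smul_comm, ← hzc, neg_one_smul, smul_neg, neg_smul, neg_neg]

theorem notMem_incoming {n : ℕ × ℕ} {z : ℝ × ℝ} (hz : 0 < z.1 ∨ z.2 < 0) :
    Γ.sgn • z ∉ rayCone ((-Γ.sgn) • ((n.2 : ℝ), -(n.1 : ℝ))) := by
  intro h
  obtain ⟨c, hc, h⟩ := mem_rayCone.1 h
  rw [neg_smul, smul_neg, smul_comm, ← smul_neg] at h
  obtain rfl := smul_right_injective _ sgn_ne_zero h
  have h1 : 0 ≤ c * n.2 := by positivity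
  have h2 : 0 ≤ c * n.1 := by positivity
  simp only [Prod.smul_mk, smul_eq_mul, Prod.fst_neg, Prod.snd_neg] at hz
  rcases hz with hz | hz <;> linarith

theorem seed_mem_Gpar (k : Fin 2) : Γ.seed k ∈ Γ.Gpar (e k) := ⟨_, rfl⟩

theorem Factor.elt_mem_Gpar {x : Factor} {n : ℕ × ℕ} (hn : n ≠ 0) (hc : x.c = 1)
    (hx : ∃ k : ℕ, 1 ≤ k ∧ x.n = k • n) : x.elt Γ ∈ Γ.Gpar n := by
  obtain ⟨k, hk, he⟩ := hx
  rw [Factor.elt, hc, pow_one, he]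
  exact alongRay_smul_mem_Gpar hn hk _

theorem normFactor_e (k : Fin 2) : Γ.normFactor (e k) = Γ.δ k := by
  fin_cases k
  · simp [normFactor, e, δ, Nat.div_self Γ.δ₂_pos]
  · simp [normFactor, e, δ, Nat.div_self Γ.δ₁_pos]

theorem prod_map_ite_eq {α M : Type*} [DecidableEq α] [Monoid M] (f : α → M) {l : List α}
    (hl : l.Nodup) {a : α} (ha : a ∈ l) :
    (l.map fun b => if b = a then f b else 1).prod = f a := by
  induction l with
  | nil => simp at ha
  | cons b l ih =>
    rw [List.nodup_cons] at hl
    rw [List.map_cons, List.prod_cons]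
    by_cases hb : b = a
    · subst hb
      have : (l.map fun c => if c = b then f c else 1) = l.map fun _ => 1 :=
        List.map_congr_left fun c hc => if_neg fun h : c = b => hl.1 (h ▸ hc)
      rw [if_pos rfl, this]
      simp
    · rw [if_neg hb, one_mul, ih hl.2 ((List.mem_cons.1 ha).resolve_left fun h => hb h.symm)]

/-- The data of the rays: two incoming rays and the outgoing rays of the given factors. -/
def rayData (Γ : FixedData) (h : ℕ × ℕ → List Factor) : List ((ℕ × ℕ) × ℝ × Γ.G) :=
  (e 0, -Γ.sgn, Γ.seed 0) :: (e 1, -Γ.sgn, Γ.seed 1) ::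
    slopes.flatMap fun n => (h n).map fun x => (n, Γ.sgn, x.elt Γ)

open Classical in
/-- The product of the elements of the rays through a point. -/
theorem prod_filter_rayData (h : ℕ × ℕ → List Factor) (z : ℝ × ℝ) :
    (((Γ.rayData h).filter fun x => z ∈ rayCone (x.2.1 • ((x.1.2 : ℝ), -(x.1.1 : ℝ)))).map
      fun x => x.2.2).prod =
    (if z ∈ rayCone ((-Γ.sgn) • (((e 0).2 : ℝ), -((e 0).1 : ℝ))) then Γ.seed 0 else 1) *
    (if z ∈ rayCone ((-Γ.sgn) • (((e 1).2 : ℝ), -((e 1).1 : ℝ))) then Γ.seed 1 else 1) *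
    (slopes.map fun n => if z ∈ rayCone (Γ.sgn • ((n.2 : ℝ), -(n.1 : ℝ))) then
      Γ.rayProduct h n else 1).prod := by
  have h1 : ∀ l : List (ℕ × ℕ), (((l.flatMap fun n => (h n).map fun x => (n, Γ.sgn, x.elt Γ)).filter
      fun x : (ℕ × ℕ) × ℝ × Γ.G => z ∈ rayCone (x.2.1 • ((x.1.2 : ℝ), -(x.1.1 : ℝ)))).map
      fun x => x.2.2).prod =
      (l.map fun n => if z ∈ rayCone (Γ.sgn • ((n.2 : ℝ), -(n.1 : ℝ))) then
        Γ.rayProduct h n else 1).prod := by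
    intro l
    induction l with
    | nil => rfl
    | cons n l ih =>
      rw [List.flatMap_cons, List.filter_append, List.map_append, List.prod_append, ih,
        List.map_cons, List.prod_cons, List.filter_map]
      congr 1
      by_cases hz : z ∈ rayCone (Γ.sgn • ((n.2 : ℝ), -(n.1 : ℝ)))
      · simp [Function.comp_def, hz, rayProduct, -Prod.smul_mk]
      · simp [Function.comp_def, hz, -Prod.smul_mk]
  rw [rayData, List.filter_cons, List.filter_cons]
  split_ifs <;> simp_all [mul_assoc, -Prod.smul_mk]

end FixedData

namespace ScatteringDiagram
variable {Γ : FixedData}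

/-- The walls with the given data. -/
theorem exists_walls (l : List ((ℕ × ℕ) × ℝ × Γ.G))
    (hl : ∀ x ∈ l, Nat.gcd x.1.1 x.1.2 = 1 ∧ x.2.1 ≠ 0 ∧ x.2.2 ∈ Γ.Gpar x.1) :
    ∃ W : List (Wall Γ), W.map (fun w => (w.support, w.elt)) =
      l.map fun x => (rayCone (x.2.1 • ((x.1.2 : ℝ), -(x.1.1 : ℝ))), x.2.2) := by
  induction l with
  | nil => exact ⟨[], rfl⟩
  | cons x l ih =>
    obtain ⟨W, hW⟩ := ih fun y hy => hl y (List.mem_cons_of_mem _ hy)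
    obtain ⟨h1, h2, h3⟩ := hl x List.mem_cons_self
    exact ⟨rayWall x.1 x.2.1 x.2.2 h1 h2 h3 :: W, by rw [List.map_cons, List.map_cons, hW]; rfl⟩

/-- The consistent diagram with outgoing rays given by a positive factorization. -/
theorem exists_positive_diagram (hω : Γ.ω ≠ 0) {ℓ : ℕ} {h : ℕ × ℕ → List Factor}
    (hh : ∀ n ∈ slopes, ∀ x ∈ h n, x.c = 1 ∧ Γ.InLattice x.b ∧ ∃ k : ℕ, 1 ≤ k ∧ x.n = k • n)
    (hf : Γ.Factorizes ℓ (Γ.rayProduct h)) :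
    ∃ D : ScatteringDiagram.{0} Γ, D.ConsistentUpTo ℓ ∧ D.PositiveRealization ∧
      D.Rays ℓ (Γ.rayProduct h) := by
  classical
  have hmem : ∀ x ∈ Γ.rayData h, x = (e 0, -Γ.sgn, Γ.seed 0) ∨ x = (e 1, -Γ.sgn, Γ.seed 1) ∨
      ∃ n ∈ slopes, ∃ y ∈ h n, (n, Γ.sgn, y.elt Γ) = x := by
    intro x hx
    simpa only [rayData, List.mem_cons, List.mem_flatMap, List.mem_map] using hx
  -- The incoming walls are taken as half-lines rather than lines, since the outgoing halves of the
  -- axes already carry the factors on $(1,0)$ and $(0,1)$.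
  obtain ⟨W, hW⟩ := exists_walls (Γ.rayData h) (by
    intro x hx
    rcases hmem x hx with rfl | rfl | ⟨n, hn, y, hy, rfl⟩
    · exact ⟨gcd_e 0, neg_ne_zero.2 sgn_ne_zero, seed_mem_Gpar 0⟩
    · exact ⟨gcd_e 1, neg_ne_zero.2 sgn_ne_zero, seed_mem_Gpar 1⟩
    · exact ⟨gcd_eq_one_of_mem_slopes n hn, sgn_ne_zero,
        Factor.elt_mem_Gpar (ne_zero_of_mem_slopes hn) (hh n hn y hy).1 (hh n hn y hy).2.2⟩)
  have hprod : ∀ z : ℝ × ℝ, z ≠ 0 → Γ.EqUpTo ℓ ((ofList W).elementAt ℓ (Γ.sgn • z))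
      (((Γ.rayData h).filter fun x =>
        Γ.sgn • z ∈ rayCone (x.2.1 • ((x.1.2 : ℝ), -(x.1.1 : ℝ)))).map fun x => x.2.2).prod := by
    intro z hz
    have h1 := elementAt_ofList (ℓ := ℓ) W (smul_ne_zero (sgn_ne_zero (Γ := Γ)) hz)
    have h2 : (W.filter fun w => Γ.sgn • z ∈ w.support).map Wall.elt =
        ((Γ.rayData h).filter fun x =>
          Γ.sgn • z ∈ rayCone (x.2.1 • ((x.1.2 : ℝ), -(x.1.1 : ℝ)))).map fun x => x.2.2 := by
      have h3 := congrArg (fun l => (l.filter fun x : PointedCone ℝ (ℝ × ℝ) × Γ.G =>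
        Γ.sgn • z ∈ x.1).map Prod.snd) hW
      simp only [List.filter_map, List.map_map] at h3
      exact h3
    rwa [h2] at h1
  have hincoming : ∀ k : Fin 2, ∃ i : (ofList W).Index, (ofList W).cone i =
      (rayCone ((-Γ.sgn) • (((e k).2 : ℝ), -((e k).1 : ℝ))) : Set (ℝ × ℝ)) := by
    intro k
    have h1 : (rayCone ((-Γ.sgn) • (((e k).2 : ℝ), -((e k).1 : ℝ))), Γ.seed k) ∈
        W.map (fun w => (w.support, w.elt)) := by
      rw [hW, rayData]
      fin_cases k <;> simp
    obtain ⟨w, hw, he⟩ := List.mem_map.1 h1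
    obtain ⟨i, rfl⟩ := List.get_of_mem hw
    exact ⟨i, congrArg (fun C : PointedCone ℝ (ℝ × ℝ) => (C : Set (ℝ × ℝ)))
      (congrArg Prod.fst he)⟩
  have hback : ∀ z : ℝ × ℝ, z.1 < 0 ∨ 0 < z.2 →
      Γ.EqUpTo ℓ ((ofList W).elementAt ℓ (Γ.sgn • z))
        ((if pairing (e 0) z = 0 then Γ.seed 0 else 1) *
          (if pairing (e 1) z = 0 then Γ.seed 1 else 1)) := by
    intro z hz
    have h1 := hprod z (by
      rintro rfl
      simp at hz)
    rw [prod_filter_rayData, List.prod_eq_one (l := slopes.map _), mul_one] at h1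
    · simpa only [mem_incoming_iff (ne_zero_of_gcd (gcd_e _)) hz] using h1
    · intro g hg
      obtain ⟨m, -, rfl⟩ := List.mem_map.1 hg
      exact if_neg (notMem_outgoing hz)
  have hrays : (ofList W).Rays ℓ (Γ.rayProduct h) := by
    refine ⟨fun n hn c hc => ?_, fun z hz hn => ?_, fun z h1 h2 => ?_, fun z h1 h2 => ?_,
      fun z h1 h2 => ?_⟩
    · have hn0 := ne_zero_of_mem_slopes hn
      have hz : 0 < (c • ((n.2 : ℝ), -(n.1 : ℝ))).1 ∨ (c • ((n.2 : ℝ), -(n.1 : ℝ))).2 < 0 := by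
        simp only [Prod.smul_mk, smul_eq_mul]
        rcases Nat.eq_zero_or_pos n.1 with h1 | h1
        · have : 0 < n.2 := Nat.pos_of_ne_zero fun h2 => hn0 (Prod.ext h1 h2)
          left
          positivity
        · right
          have : 0 < c * n.1 := by positivity
          linarith
      have hnz : pairing n (c • ((n.2 : ℝ), -(n.1 : ℝ))) = 0 := by
        rw [pairing_smul, pairing]
        ring
      have h1 := hprod (c • ((n.2 : ℝ), -(n.1 : ℝ))) (by
        intro h0
        rw [h0] at hz
        simp at hz)
      rw [prod_filter_rayData, if_neg (notMem_incoming hz), if_neg (notMem_incoming hz), one_mul,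
        one_mul] at h1
      have h2 : (slopes.map fun m => if Γ.sgn • c • ((n.2 : ℝ), -(n.1 : ℝ)) ∈
          rayCone (Γ.sgn • ((m.2 : ℝ), -(m.1 : ℝ))) then Γ.rayProduct h m else 1) =
          slopes.map fun m => if m = n then Γ.rayProduct h m else 1 :=
        List.map_congr_left fun m hm => by
          simp only [mem_outgoing_iff (gcd_eq_one_of_mem_slopes n hn)
            (gcd_eq_one_of_mem_slopes m hm) hz hnz]
      rwa [h2, prod_map_ite_eq _ (by decide) hn] at h1
    · have h1 := hprod z (by
        rintro rfl
        simp at hz)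
      rw [prod_filter_rayData, if_neg (notMem_incoming hz), if_neg (notMem_incoming hz), one_mul,
        one_mul, List.prod_eq_one] at h1
      · exact h1
      · intro g hg
        obtain ⟨m, hm, rfl⟩ := List.mem_map.1 hg
        refine if_neg fun h2 => ?_
        obtain ⟨c, hc, h2⟩ := mem_rayCone.1 h2
        rw [smul_comm] at h2
        obtain rfl := smul_right_injective _ sgn_ne_zero h2
        refine hn m hm ?_
        rw [pairing_smul, pairing]
        ring
    · have h3 := hback z (Or.inr h2)
      rwa [if_pos ((pairing_e_zero z).trans h1), if_neg (by rw [pairing_e_one]; exact h2.ne'),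
        mul_one] at h3
    · have h3 := hback z (Or.inl h1)
      rwa [if_neg (by rw [pairing_e_zero]; exact h1.ne), if_pos ((pairing_e_one z).trans h2),
        one_mul] at h3
    · have h3 := hback z (Or.inl h1)
      rwa [if_neg (by rw [pairing_e_zero]; exact h1.ne),
        if_neg (by rw [pairing_e_one]; exact h2.ne'), mul_one] at h3
  refine ⟨ofList W, hrays.consistentUpTo hω hf ?_ ?_ ?_, fun i => ?_, hrays⟩
  · obtain ⟨i, hi⟩ := hincoming 0
    obtain ⟨j, hj⟩ := hincoming 1
    refine ScatteringDiagram.zero_mem_sing (i := i) (j := j) fun z h0 h1 => ?_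
    rw [hi] at h0
    rw [hj] at h1
    obtain ⟨c, -, rfl⟩ := mem_rayCone.1 h0
    obtain ⟨d, -, h1⟩ := mem_rayCone.1 h1
    have h2 := congrArg Prod.snd h1
    simp only [e, Prod.smul_mk, smul_eq_mul] at h2
    refine Prod.ext (by simp [e]) ?_
    simpa [e] using h2.symm
  · intro z h1 h2
    obtain ⟨i, hi⟩ := hincoming 0
    refine Set.mem_iUnion.2 ⟨i, ?_⟩
    rw [hi]
    exact (mem_incoming_iff (ne_zero_of_gcd (gcd_e 0)) (Or.inr h2)).2 ((pairing_e_zero z).trans h1)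
  · intro z h1 h2
    obtain ⟨i, hi⟩ := hincoming 1
    refine Set.mem_iUnion.2 ⟨i, ?_⟩
    rw [hi]
    exact (mem_incoming_iff (ne_zero_of_gcd (gcd_e 1)) (Or.inl h1)).2 ((pairing_e_one z).trans h2)
  · have h1 : ((W.get i).support, (W.get i).elt) ∈ W.map fun w => (w.support, w.elt) :=
      List.mem_map.2 ⟨_, List.get_mem W i, rfl⟩
    rw [hW] at h1
    obtain ⟨x, hx, he⟩ := List.mem_map.1 h1
    have he : (W.get i).elt = x.2.2 := (congrArg Prod.snd he).symm
    change ∃ (n : ℕ × ℕ) (b : ℚ) (c : ℕ), n ≠ 0 ∧ Γ.InLattice b ∧ 0 < c ∧ (W.get i).elt = _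
    rw [he]
    -- Since $\delta(e_k)=\delta_k$, the seed elements have the positive form with $b=0$ and $c=1$.
    have hseed : ∀ k : Fin 2, ∃ (n : ℕ × ℕ) (b : ℚ) (c : ℕ), n ≠ 0 ∧ Γ.InLattice b ∧ 0 < c ∧
        Γ.seed k = Γ.Psi (1 / Γ.normFactor n) b n ^ c := fun k =>
      ⟨e k, 0, 1, ne_zero_of_gcd (gcd_e k), ⟨0, by simp⟩, one_pos, by
        rw [pow_one, normFactor_e, seed]⟩
    rcases hmem x hx with rfl | rfl | ⟨n, hn, y, hy, rfl⟩
    · exact hseed 0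
    · exact hseed 1
    · obtain ⟨p1, p2, p3⟩ := Factor.positive_of_smul (ne_zero_of_mem_slopes hn) (hh n hn y hy)
      exact ⟨y.n, y.b, y.c, p1, p2, p3, rfl⟩

/-- The outgoing elements of the QCSD and those of the positive diagram both factorize the same
product of seed elements along the same ordered rays. By uniqueness they agree modulo $G^{>4}$, so
the two diagrams have the same element at every nonzero point. -/
theorem IsQCSD.positiveUpTo (hω : Γ.ω ≠ 0) (hδ : Γ.δ₁ ∣ Γ.δ₂ ∨ Γ.δ₂ ∣ Γ.δ₁)
    {D : ScatteringDiagram.{u'} Γ} (hD : D.IsQCSD) : D.PositiveUpTo 4 := by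
  obtain ⟨h, hh, hf⟩ := exists_factorization hδ
  have hf : Γ.Factorizes 4 (Γ.rayProduct h) := hf
  obtain ⟨D', hcons, hpos, hrays⟩ := exists_positive_diagram hω hh hf
  have hr := hD.rays hω
  refine ⟨D', hcons, hpos, equivUpTo_of_elementAt hD.zero_mem_sing (hr.elementAt_eq hrays
    ((hr.factorizes hω (hD.consistent 4)).unique hω hf (fun n hn => ?_) fun n hn => ?_))⟩
  · have hn0 := ne_zero_of_mem_slopes hn
    refine elementAt_mem_rayGroup (smul_ne_zero sgn_ne_zero fun h0 => hn0 (Prod.ext ?_ ?_))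
      (gcd_eq_one_of_mem_slopes n hn) ?_
    · simpa using congrArg Prod.snd h0
    · simpa using congrArg Prod.fst h0
    · rw [pairing_smul, pairing]
      ring
  · refine Submonoid.list_prod_mem _ fun g hg => ?_
    obtain ⟨x, hx, rfl⟩ := List.mem_map.1 hg
    exact mem_rayGroup_of_mem_Gpar (Factor.elt_mem_Gpar (ne_zero_of_mem_slopes hn)
      (hh n hn x hx).1 (hh n hn x hx).2.2)

end ScatteringDiagram
end
end QCSD

theorem mainTheorem6 (Γ : QCSD.FixedData) (hb : Γ.exchangeMatrix 0 1 ≠ 0)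
    (hδ : Γ.δ₁ ∣ Γ.δ₂ ∨ Γ.δ₂ ∣ Γ.δ₁) :
    (∀ D : QCSD.ScatteringDiagram.{u} Γ, D.IsQCSD → D.PositiveUpTo 4) ∧
    (∀ i j : Fin 2, 0 < Γ.form (QCSD.e j) (QCSD.e i) →
      ∃ L : List QCSD.Factor, (∀ x ∈ L, x.Positive Γ) ∧ QCSD.Ordered Γ L ∧
        Γ.EqUpTo 4
          (Γ.Psi (1 / (Γ.δ j : ℚ)) 0 (QCSD.e j) * Γ.Psi (1 / (Γ.δ i : ℚ)) 0 (QCSD.e i))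
          (L.map (QCSD.Factor.elt Γ)).prod) := by
  have hω : Γ.ω ≠ 0 := by
    intro h
    apply hb
    simp [QCSD.FixedData.exchangeMatrix, QCSD.FixedData.form, h]
  exact ⟨fun D hD => hD.positiveUpTo hω hδ,
    fun i j hij => QCSD.FixedData.exists_ordered_product hδ i j hij⟩
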